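/- Model. Researcher $0$ is present at the beginning; in step $n=1,2,\dots$ the $n$-th paper is written by a group of $\nu_n$ of the researchers $0,\dots,n-1$ ($1\le\nu_n\le n$), and then researcher $n$ arrives. The initial weights $X_0,X_1,\dots$ are nonnegative integer-valued random variables. In step $n$ the authors, listed in the order of their labels, receive nonnegative integer-valued bonuses $Y_{n,1},\dots,Y_{n,\nu_n}$; write $Z_n=Y_{n,1}+\dots+Y_{n,\nu_n}$. The weight $W(n,i)$ of researcher $i\le n$ after step $n$ is $X_i$ plus all the bonuses that $i$ has received in steps $1,\dots,n$. Given the history $\mathcal F_{n-1}$ of the first $n-1$ steps, the number $\nu_n=k$ and the bonuses of step $n$, the group of authors of the $n$-th paper is a given $k$-element subset of $\{0,\dots,n-1\}$ with probability proportional to the total weight of that subset (if all weights are $0$, an arbitrary group of size $k$ is chosen). Assumptions. (1) $X_0,X_1,\dots$ are i.i.d., and for every $n\ge1$ the variable $X_n$ is independent of $(\mathcal F_{n-1},\nu_n,Y_{n,1},\dots,Y_{n,\nu_n})$; write $X=X_0$. (2) $(\nu_n,Y_{n,1},\dots,Y_{n,\nu_n})$ is independent of $\mathcal F_{n-1}$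 for every $n\ge1$. (3) $(\nu_n,Y_{n,1},Z_n)$ converges in distribution to a triple $(\nu,Y,Z)$, and $E\nu_n\to E\nu<\infty$, $E\nu_n^2\to E\nu^2<\infty$. (4) The conditional distribution of $(Y_{n,1},\dots,Y_{n,\nu_n})$ given $\nu_n=k$ does not depend on $n$, and given $\nu_n=k$ the components are exchangeable. (5) $Z_n$ has finite expectation and variance, $\sum_{n\ge1}\operatorname{Var}(Z_n)/n^2<\infty$, and $\frac1n\sum_{i=1}^nEZ_i\to EZ$. (6) $X$, $Y$ and $Z$ have finite moment generating functions: $Ee^{tX},Ee^{tY},Ee^{tZ}<\infty$ for some $t>0$. (7) $X$, $Y$ and every $Y_{n,1}$ are positive with positive probability, and the greatest common divisor of $\{i:P(Y=i)>0\}$ is $1$. Theorem. Let $\xi_n(j)=|\{0\le i\le n: W(n,i)=j\}|$. There are constants $x_j$, $j=1,2,\dots$, such that for every $j\ge1$, $\xi_n(j)/n\to x_j$ almost surely as $n\to\infty$, and $$x_j\sim C\,j^{-\gamma}\qquad(j\to\infty)$$ for some positive constant $C$, where $$\gamma=\frac{EX+EZ}{EY}+1 .$$ That is, the weight distribution of the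 model is scale-free. -/

import Mathlib

open MeasureTheory ProbabilityTheory Filter Topology Asymptotics
open scoped BigOperators

/-- The random data of the evolving system of researchers and publications, in the case of
integer weights.  Researcher `0` is present at the beginning, and researcher `n` arrives in step
`n = 1, 2, …`, in which also the `n`-th paper is written.  (The values of `ν`, `G`, `Y` at the
index `0` play no role.) -/
structure PublicationProcess (Ω : Type*) where
  /-- `X i` is the initial weight of researcher `i`. -/
  X : ℕ → Ω → ℕ
  /-- `ν n` is the number of coauthors of the `n`-th paper. -/
  ν : ℕ → Ω → ℕ
  /-- `G n` is the group of the authors of the `n`-th paper. -/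
  G : ℕ → Ω → Finset ℕ
  /-- `Y n l` is the bonus of the `l`-th author of the `n`-th paper, `1 ≤ l ≤ ν n`. -/
  Y : ℕ → ℕ → Ω → ℕ

namespace PublicationProcess

variable {Ω : Type*} (M : PublicationProcess Ω)

/-- The total weight `Z n = Y n 1 + ⋯ + Y n (ν n)` of the `n`-th paper. -/
def Z (n : ℕ) (ω : Ω) : ℕ := ∑ l ∈ Finset.Icc 1 (M.ν n ω), M.Y n l ω

/-- The weight of researcher `i` after step `n`: the initial weight plus all bonuses obtained in
the steps `1, …, n`.  The authors of a paper are ordered by their labels, so a coauthor `i` of the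
`m`-th paper is the `l`-th one, where `l` is the number of the coauthors with label at most `i`. -/
def W (n i : ℕ) (ω : Ω) : ℕ :=
  M.X i ω + ∑ m ∈ Finset.Icc 1 n,
    if i ∈ M.G m ω then M.Y m ((M.G m ω).filter (fun k => k ≤ i)).card ω else 0

/-- The total weight of the members of the group `A` after step `n`. -/
def groupWeight (n : ℕ) (A : Finset ℕ) (ω : Ω) : ℕ := ∑ i ∈ A, M.W n i ω

/-- The total weight of all the researchers `0, …, n` after step `n`. -/
def S (n : ℕ) (ω : Ω) : ℕ := ∑ i ∈ Finset.range (n + 1), M.W n i ω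

/-- The number of researchers of weight `j` after step `n`. -/
def ξ (n j : ℕ) (ω : Ω) : ℕ :=
  ((Finset.range (n + 1)).filter (fun i => M.W n i ω = j)).card

/-- The σ-algebra generated by `ν n` and the bonuses `Y n 1, …, Y n (ν n)`. -/
@[reducible]
def bonusSigma (n : ℕ) : MeasurableSpace Ω :=
  MeasurableSpace.comap (M.ν n) ⊤ ⊔ ⨆ l : ℕ, MeasurableSpace.comap (M.Y n l) ⊤

/-- The σ-algebra `ℱ n` generated by the initial researcher and the first `n` steps. -/
@[reducible]
def past (n : ℕ) : MeasurableSpace Ω :=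
  (⨆ i ∈ Finset.range (n + 1), MeasurableSpace.comap (M.X i) ⊤) ⊔
    ⨆ m ∈ Finset.Icc 1 n, M.bonusSigma m ⊔ MeasurableSpace.comap (M.G m) ⊤

/-- The dynamics of the model under the probability measure `μ`. -/
structure IsModel [MeasurableSpace Ω] (μ : Measure Ω) : Prop where
  measurable_X : ∀ i, Measurable (M.X i)
  measurable_ν : ∀ n, Measurable (M.ν n)
  measurable_Y : ∀ n l, Measurable (M.Y n l)
  measurable_G : ∀ n (A : Finset ℕ), MeasurableSet {ω | M.G n ω = A}
  /-- Every paper has at least one author. -/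
  one_le_ν : ∀ n, 1 ≤ n → ∀ ω, 1 ≤ M.ν n ω
  /-- The authors of the `n`-th paper are chosen from the researchers `0, …, n - 1`. -/
  G_subset : ∀ n, 1 ≤ n → ∀ ω, M.G n ω ⊆ Finset.range n
  card_G : ∀ n, 1 ≤ n → ∀ ω, (M.G n ω).card = M.ν n ω
  /-- There are only `ν n` bonuses in step `n`; the sequence is continued by zeros. -/
  Y_eq_zero : ∀ n, 1 ≤ n → ∀ l ω, l ∉ Finset.Icc 1 (M.ν n ω) → M.Y n l ω = 0
  /-- Given the first `n` steps and the number of authors and the bonuses of the next step, each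
  group of the prescribed size is chosen with probability proportional to its total weight.
  (If all weights vanish, then nothing is prescribed.) -/
  selection : ∀ (n : ℕ) (A : Finset ℕ), A ⊆ Finset.range (n + 1) →
    ∀ᵐ ω ∂μ, M.ν (n + 1) ω = A.card → 0 < M.S n ω →
      (μ[Set.indicator {ω' | M.G (n + 1) ω' = A} (fun _ => (1 : ℝ)) |
          M.past n ⊔ M.bonusSigma (n + 1)]) ω =
        (M.groupWeight n A ω : ℝ) /
          ∑ B ∈ (Finset.range (n + 1)).powersetCard A.card, (M.groupWeight n B ω : ℝ)

/-- The probabilistic assumptions on the model.  The triple `(ν', Y', Z')`, defined on some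
probability space, is the limit in distribution of the triples `(ν n, Y n 1, Z n)`. -/
structure Assumptions [MeasurableSpace Ω] (μ : Measure Ω) [IsProbabilityMeasure μ]
    {Ω' : Type*} [MeasurableSpace Ω'] (μ' : Measure Ω') [IsProbabilityMeasure μ']
    (ν' Y' Z' : Ω' → ℕ) : Prop where
  indep_X : iIndepFun M.X μ
  ident_X : ∀ n, IdentDistrib (M.X n) (M.X 0) μ μ
  /-- The initial weight of the new researcher is independent of the past and of the bonuses. -/
  indep_X_past : ∀ n, Indep (MeasurableSpace.comap (M.X (n + 1)) ⊤)
    (M.past n ⊔ M.bonusSigma (n + 1)) μ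
  /-- `X` has finite moment generating function (near the origin). -/
  mgf_X : ∃ t : ℝ, 0 < t ∧ Integrable (fun ω => Real.exp (t * (M.X 0 ω : ℝ))) μ
  /-- The number of authors and the bonuses are independent of the past. -/
  indep_bonus_past : ∀ n, Indep (M.bonusSigma (n + 1)) (M.past n) μ
  tendsto_triple : TendstoInDistribution (fun n ω => (M.ν n ω, M.Y n 1 ω, M.Z n ω)) atTop
    (fun ω' => (ν' ω', Y' ω', Z' ω')) (fun _ => μ) μ'
  memLp_ν' : MemLp (fun ω' => (ν' ω' : ℝ)) 2 μ'
  tendsto_mean_ν : Tendsto (fun n => ∫ ω, (M.ν n ω : ℝ) ∂μ) atTop (𝓝 (∫ ω', (ν' ω' : ℝ) ∂μ'))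
  tendsto_sq_ν : Tendsto (fun n => ∫ ω, (M.ν n ω : ℝ) ^ 2 ∂μ) atTop
    (𝓝 (∫ ω', (ν' ω' : ℝ) ^ 2 ∂μ'))
  /-- The conditional distribution of the bonuses, given that there are `k` authors, does not
  depend on the step. -/
  ident_bonus : ∀ n m k : ℕ, 1 ≤ n → 1 ≤ m → μ {ω | M.ν n ω = k} ≠ 0 → μ {ω | M.ν m ω = k} ≠ 0 →
    IdentDistrib (fun ω l => M.Y n l ω) (fun ω l => M.Y m l ω)
      (ProbabilityTheory.cond μ {ω | M.ν n ω = k}) (ProbabilityTheory.cond μ {ω | M.ν m ω = k})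
  /-- The bonuses are conditionally interchangeable, given that there are `k` authors. -/
  exchangeable : ∀ n k : ℕ, 1 ≤ n → μ {ω | M.ν n ω = k} ≠ 0 →
    ∀ π : Equiv.Perm ℕ, (∀ l, l ∉ Finset.Icc 1 k → π l = l) →
      IdentDistrib (fun ω l => M.Y n (π l) ω) (fun ω l => M.Y n l ω)
        (ProbabilityTheory.cond μ {ω | M.ν n ω = k}) (ProbabilityTheory.cond μ {ω | M.ν n ω = k})
  /-- `Z n` has finite expectation and variance.  The variances divided by `n ^ 2` are summable, and
  the expectations converge to that of `Z` in mean; this does not follow from the convergence in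
  distribution of the `Z n`. -/
  memLp_Z : ∀ n, 1 ≤ n → MemLp (fun ω => (M.Z n ω : ℝ)) 2 μ
  summable_variance_Z : Summable (fun n : ℕ =>
    variance (fun ω => (M.Z (n + 1) ω : ℝ)) μ / ((n : ℝ) + 1) ^ 2)
  tendsto_mean_Z : Tendsto (fun n : ℕ =>
    (∑ i ∈ Finset.Icc 1 n, ∫ ω, (M.Z i ω : ℝ) ∂μ) / (n : ℝ)) atTop (𝓝 (∫ ω', (Z' ω' : ℝ) ∂μ'))
  /-- `Y` and `Z` have finite moment generating functions (near the origin). -/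
  mgf_Y : ∃ t : ℝ, 0 < t ∧ Integrable (fun ω' => Real.exp (t * (Y' ω' : ℝ))) μ'
  mgf_Z : ∃ t : ℝ, 0 < t ∧ Integrable (fun ω' => Real.exp (t * (Z' ω' : ℝ))) μ'
  /-- The initial weights and the bonuses do not vanish identically. -/
  pos_X : 0 < μ {ω | 0 < M.X 0 ω}
  pos_Y : ∀ n, 1 ≤ n → 0 < μ {ω | 0 < M.Y n 1 ω}
  pos_Y' : 0 < μ' {ω' | 0 < Y' ω'}
  /-- The greatest common divisor of the possible values of `Y` is `1`. -/
  aperiodic : ∀ d : ℕ, (∀ i : ℕ, 0 < μ' {ω' | Y' ω' = i} → d ∣ i) → d = 1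

end PublicationProcess

/-! Write $p_b=P(Y=b)$, $q_b=E[(\nu-1)1_{Y=b}]$, $r_b=P(X=b)$, $Q=E(\nu-1)$, $m=EY$ and
$\sigma=EX+EZ$.

Probability. Given the past and a group size $k+1$, a researcher of weight $w$ among $n+1$ is chosen
with probability $w/S_n+k(1-w/S_n)/n$ (`Finset.sum_filter_mem_div`). Exchangeability then expresses
the conditional drift of $\xi_n(j)$ through the $\xi_n(w)$, $w\le j$ (`condExp_increment`). The
total weight satisfies $S_n/n\to\sigma$, and the difference between increments and drift averages
out by a strong law for martingale differences. So $\xi_n(j)$ obeys a perturbed linear recursion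
whose average converges (`tendsto_div_of_recursion`). Induction on $j$ yields the limits $x_j$ and,
after multiplication by $\sigma$, $$x_j(\sigma(1+Q)+j)=\sigma r_j+\sum_{k+l=j}(k\,x_kp_l+\sigma
x_kq_l).$$

Analysis. With generating functions $A,P,q(z),R$ this is $(1-P)zA'+\sigma(1+Q-q(z))A=\sigma R$. Here
$P,q,R$ have exponentially decaying coefficients, but $A$ need not. Aperiodicity makes $1-P=(1-z)T$
with $T$ free of zeros in the closed unit disc and $T(1)=m$, so division by $T$ stays within
exponential decay (`ExpDecay.exists_inverse`). This gives $(1-z)zA'+HA=\sigma R/T$ with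
$H(1)=\alpha=\sigma/m$. Write $H=\alpha+(1-z)(\kappa+zK_1)$ and remove $K_1$ by an integrating
factor $E$. The coefficients of $B=EA$ then satisfy a first order recursion with an exponentially
small perturbation, whence $b_n(n+1)^{\alpha+1}\to w$ (`first_order_recursion`). Convolution with
the coefficients of $F=1/E$ transfers this to $x_j$, with limit $F(1)w$.

Positivity of the constant. $E(1)F(1)=1$ excludes $F(1)=0$. If $w=0$, the $x_j$ would decay
exponentially and all their moments would be finite; comparing high moments in the recursion refutes
this (`not_expDecay_of_recursion`). -/

/-! ### Algebra of power series with exponentially decaying coefficients. -/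

open PowerSeries in
/-- The coefficients of the power series decay exponentially. -/
def ExpDecay (f : PowerSeries ℝ) : Prop :=
  ∃ R : ℝ, 1 < R ∧ Summable fun n => |coeff n f| * R ^ n

namespace ExpDecay

open PowerSeries

variable {f g : PowerSeries ℝ}

lemma summable_of_le {R R' : ℝ} (h0 : 0 ≤ R') (hR : R' ≤ R)
    (h : Summable fun n => |coeff n f| * R ^ n) : Summable fun n => |coeff n f| * R' ^ n :=
  h.of_nonneg_of_le (fun n => by positivity) (fun n => by gcongr)

lemma common (hf : ExpDecay f) (hg : ExpDecay g) : ∃ R : ℝ, 1 < R ∧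
    (Summable fun n => |coeff n f| * R ^ n) ∧ Summable fun n => |coeff n g| * R ^ n := by
  obtain ⟨R, hR, hfR⟩ := hf
  obtain ⟨R', hR', hgR⟩ := hg
  have h : 1 < min R R' := lt_min hR hR'
  exact ⟨min R R', h, summable_of_le (by linarith) (min_le_left _ _) hfR,
    summable_of_le (by linarith) (min_le_right _ _) hgR⟩

lemma add (hf : ExpDecay f) (hg : ExpDecay g) : ExpDecay (f + g) := by
  obtain ⟨R, hR, h1, h2⟩ := common hf hg
  refine ⟨R, hR, (h1.add h2).of_nonneg_of_le (fun n => by positivity) (fun n => ?_)⟩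
  rw [map_add, ← add_mul]
  gcongr
  exact abs_add_le _ _

lemma neg (hf : ExpDecay f) : ExpDecay (-f) := by
  obtain ⟨R, hR, h⟩ := hf
  exact ⟨R, hR, by simpa using h⟩

lemma sub (hf : ExpDecay f) (hg : ExpDecay g) : ExpDecay (f - g) := by
  rw [sub_eq_add_neg]; exact hf.add hg.neg

lemma mul (hf : ExpDecay f) (hg : ExpDecay g) : ExpDecay (f * g) := by
  obtain ⟨R, hR, h1, h2⟩ := common hf hg
  refine ⟨R, hR, ?_⟩
  have hR0 : (0 : ℝ) ≤ R := by linarith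
  have key := summable_norm_sum_mul_antidiagonal_of_summable_norm
    (f := fun n => coeff n f * R ^ n) (g := fun n => coeff n g * R ^ n)
    (by simpa [abs_mul, abs_of_nonneg hR0] using h1)
    (by simpa [abs_mul, abs_of_nonneg hR0] using h2)
  refine key.congr (fun n => ?_)
  have : ∑ kl ∈ Finset.HasAntidiagonal.antidiagonal n, coeff kl.1 f * R ^ kl.1 * (coeff kl.2 g * R ^ kl.2)
      = coeff n (f * g) * R ^ n := by
    rw [coeff_mul, Finset.sum_mul]
    refine Finset.sum_congr rfl (fun kl hkl => ?_)
    rw [← Finset.HasAntidiagonal.mem_antidiagonal.1 hkl, pow_add]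
    ring
  rw [this, Real.norm_eq_abs, abs_mul, abs_of_nonneg (pow_nonneg hR0 n)]

lemma of_bound {C r : ℝ} (h0 : 0 ≤ r) (h1 : r < 1) (h : ∀ n, |coeff n f| ≤ C * r ^ n) :
    ExpDecay f := by
  obtain ⟨s, hs, hs1⟩ := exists_between h1
  have hs0 : 0 < s := by linarith
  refine ⟨s⁻¹, (one_lt_inv₀ hs0).2 hs1, ?_⟩
  have hq : r / s < 1 := (div_lt_one hs0).2 hs
  refine ((summable_geometric_of_lt_one (by positivity) hq).mul_left C).of_nonneg_of_le
    (fun n => by positivity) (fun n => ?_)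
  calc |coeff n f| * s⁻¹ ^ n ≤ C * r ^ n * s⁻¹ ^ n := by gcongr; exact h n
    _ = C * (r / s) ^ n := by rw [div_eq_mul_inv, mul_pow]; ring

lemma bound (hf : ExpDecay f) :
    ∃ C r : ℝ, 0 ≤ C ∧ 0 < r ∧ r < 1 ∧ ∀ n, |coeff n f| ≤ C * r ^ n := by
  obtain ⟨R, hR, h⟩ := hf
  have hR0 : 0 < R := by linarith
  refine ⟨∑' n, |coeff n f| * R ^ n, R⁻¹, tsum_nonneg (fun n => by positivity), by positivity,
    inv_lt_one_of_one_lt₀ hR, fun n => ?_⟩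
  have := h.le_tsum n (fun m _ => by positivity)
  rw [inv_pow, ← div_eq_mul_inv, le_div_iff₀ (by positivity)]
  exact this

lemma mk_of_bound {a : ℕ → ℝ} {C r : ℝ} (h0 : 0 ≤ r) (h1 : r < 1) (h : ∀ n, |a n| ≤ C * r ^ n) :
    ExpDecay (PowerSeries.mk a) :=
  of_bound h0 h1 (by simpa using h)

lemma const (a : ℝ) : ExpDecay (C a) := by
  refine ⟨2, by norm_num, summable_of_ne_finset_zero (s := {0}) (fun n hn => ?_)⟩
  rw [coeff_C, if_neg (by simpa using hn)]
  simp

lemma summable_pow (hf : ExpDecay f) (N : ℕ) :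
    Summable fun n : ℕ => |coeff n f| * ((n : ℝ) + 1) ^ N := by
  obtain ⟨B, r, hB, hr, hr1, h⟩ := hf.bound
  have key : Summable fun n : ℕ => ((n : ℝ)) ^ N * r ^ n :=
    summable_pow_mul_geometric_of_norm_lt_one N (by rwa [Real.norm_eq_abs, abs_of_pos hr])
  have key2 := ((summable_nat_add_iff 1).2 key).mul_left (B * r⁻¹)
  refine key2.of_nonneg_of_le (fun n => by positivity) (fun n => ?_)
  calc |coeff n f| * ((n : ℝ) + 1) ^ N ≤ B * r ^ n * ((n : ℝ) + 1) ^ N := by gcongr; exact h n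
    _ = B * r⁻¹ * (((n + 1 : ℕ) : ℝ) ^ N * r ^ (n + 1)) := by
      push_cast
      rw [pow_succ]
      field_simp

lemma summable_rpow (hf : ExpDecay f) (s : ℝ) :
    Summable fun n : ℕ => |coeff n f| * ((n : ℝ) + 1) ^ s := by
  refine (hf.summable_pow ⌈s⌉₊).of_nonneg_of_le (fun n => by positivity) (fun n => ?_)
  gcongr
  rw [← Real.rpow_natCast]
  exact Real.rpow_le_rpow_of_exponent_le (by linarith [n.cast_nonneg (α := ℝ)]) (Nat.le_ceil s)

lemma summable_abs (hf : ExpDecay f) : Summable fun n : ℕ => |coeff n f| := by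
  simpa using hf.summable_pow 0

lemma summable (hf : ExpDecay f) : Summable fun n : ℕ => coeff n f :=
  hf.summable_abs.of_abs

lemma tsum_mul (hf : ExpDecay f) (hg : ExpDecay g) :
    ∑' n, coeff n (f * g) = (∑' n, coeff n f) * ∑' n, coeff n g := by
  rw [tsum_mul_tsum_eq_tsum_sum_antidiagonal_of_summable_norm
    (by simpa using hf.summable_abs) (by simpa using hg.summable_abs)]
  simp only [coeff_mul]

lemma tsum_const (a : ℝ) : ∑' n, coeff n (C a) = a := by
  rw [tsum_eq_single 0 (fun n hn => by rw [coeff_C, if_neg hn])]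
  simp

lemma tail (hf : ExpDecay f) :
    ExpDecay (PowerSeries.mk fun k => ∑' i, coeff (i + (k + 1)) f) := by
  obtain ⟨B, r, hB, hr, hr1, h⟩ := hf.bound
  refine mk_of_bound (C := B * r * (1 - r)⁻¹) hr.le hr1 (fun k => ?_)
  have hg : HasSum (fun i : ℕ => B * r ^ (k + 1) * r ^ i) (B * r ^ (k + 1) * (1 - r)⁻¹) :=
    (hasSum_geometric_of_lt_one hr.le hr1).mul_left _
  have := tsum_of_norm_bounded hg (f := fun i => coeff (i + (k + 1)) f) (fun i => by
    rw [Real.norm_eq_abs]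
    refine (h _).trans (le_of_eq ?_)
    rw [pow_add]; ring)
  rw [Real.norm_eq_abs] at this
  refine this.trans (le_of_eq ?_)
  rw [pow_succ]; ring

/-- Consecutive tails differ by one coefficient. This divides the zero at $1$ out of $f(1)-f$
without leaving exponential decay; it serves both for $1-P$ and for $H-\alpha$. -/
lemma one_sub_X_mul_tail (hf : ExpDecay f) :
    (1 - X) * (PowerSeries.mk fun k => ∑' i, coeff (i + (k + 1)) f)
      = C (∑' n, coeff n f) - f := by
  ext n
  rw [sub_mul, one_mul, map_sub, map_sub, coeff_C]
  cases n with
  | zero =>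
    rw [coeff_zero_X_mul, coeff_mk, hf.summable.tsum_eq_zero_add]
    simp
  | succ n =>
    rw [coeff_succ_X_mul, coeff_mk, coeff_mk, if_neg (Nat.succ_ne_zero n),
      ((summable_nat_add_iff (n + 1)).2 hf.summable).tsum_eq_zero_add]
    simp only [zero_add, add_assoc, add_comm 1]
    ring

lemma shift (hf : ExpDecay f) : ExpDecay (PowerSeries.mk fun n => coeff (n + 1) f) := by
  obtain ⟨B, r, hB, hr, hr1, h⟩ := hf.bound
  refine mk_of_bound (C := B * r) hr.le hr1 (fun k => (h _).trans (le_of_eq ?_))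
  rw [pow_succ]; ring

end ExpDecay

/-! ### Integrating factors. -/

lemma PowerSeries.eq_C_add_X_mul_shift (f : PowerSeries ℝ) :
    f = C (coeff 0 f) + X * PowerSeries.mk fun n => coeff (n + 1) f := by
  ext n
  cases n with
  | zero => simp
  | succ n => rw [map_add, coeff_succ_X_mul, coeff_C, if_neg (Nat.succ_ne_zero n), coeff_mk, zero_add]

/-- The coefficients of the power series solution `E` of `E' = K E`, `E(0) = 1`. -/
noncomputable def odeCoeff (k : ℕ → ℝ) : ℕ → ℝ
  | 0 => 1
  | n + 1 => (∑ i : Fin (n + 1), k (n - i) * odeCoeff k i) / (n + 1)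

open PowerSeries in
lemma derivative_mk_odeCoeff (K : PowerSeries ℝ) :
    derivative (R := ℝ) (PowerSeries.mk (odeCoeff fun n => coeff n K))
      = K * PowerSeries.mk (odeCoeff fun n => coeff n K) := by
  ext n
  rw [coeff_derivative, coeff_mk, odeCoeff, coeff_mul,
    Finset.sum_fin_eq_sum_range, div_mul_cancel₀ _ (by positivity),
    ← Finset.Nat.sum_antidiagonal_swap, Finset.Nat.sum_antidiagonal_eq_sum_range_succ_mk]
  refine Finset.sum_congr rfl (fun i hi => ?_)
  rw [dif_pos (Finset.mem_range.1 hi)]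
  simp

-- Fix a rate $r$ strictly between that of $K$ and $1$. If $|e_i|\le Dr^i$ for $i\le m$, the
-- convolution in the recursion is at most $Dr^{m+1}c$ with $c$ independent of $m$ and $D$. The
-- division by $m+1$ absorbs $c$ once $m+1\ge c$, and $D$ is chosen to cover the finitely many
-- earlier indices.
open PowerSeries in
lemma ExpDecay.mk_odeCoeff {K : PowerSeries ℝ} (hK : ExpDecay K) :
    ExpDecay (PowerSeries.mk (odeCoeff fun n => coeff n K)) := by
  obtain ⟨B, ρ, hB, hρ, hρ1, h⟩ := hK.bound
  obtain ⟨r, hr, hr1⟩ := exists_between hρ1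
  have hr0 : 0 < r := hρ.trans hr
  set q := ρ / r with hq
  have hq1 : q < 1 := (div_lt_one hr0).2 hr
  have hq0 : 0 < q := by positivity
  set e := odeCoeff fun n => coeff n K with he
  set c : ℝ := B * r⁻¹ * (1 - q)⁻¹ with hc
  obtain ⟨J, hJ⟩ := exists_nat_ge c
  set D : ℝ := ∑ i ∈ Finset.range (J + 1), |e i| / r ^ i with hD
  have hD0 : 0 ≤ D := Finset.sum_nonneg (fun i _ => by positivity)
  refine mk_of_bound (C := D) hr0.le hr1 (fun n => ?_)
  induction n using Nat.strong_induction_on with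
  | _ n ih =>
    rcases Nat.lt_or_ge n (J + 1) with hn | hn
    · have : |e n| / r ^ n ≤ D :=
        Finset.single_le_sum (f := fun i => |e i| / r ^ i) (fun i _ => by positivity)
          (Finset.mem_range.2 hn)
      rwa [div_le_iff₀ (by positivity)] at this
    · obtain ⟨m, rfl⟩ : ∃ m, n = m + 1 := ⟨n - 1, by omega⟩
      have hm : (c : ℝ) ≤ m + 1 := hJ.trans (by exact_mod_cast (by omega : J ≤ m + 1))
      have h1 : |∑ i : Fin (m + 1), coeff (m - i) K * e i| ≤ D * r ^ (m + 1) * c := by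
        calc |∑ i : Fin (m + 1), coeff (m - i) K * e i|
            ≤ ∑ i : Fin (m + 1), |coeff (m - i) K * e i| := Finset.abs_sum_le_sum_abs _ _
          _ ≤ ∑ i : Fin (m + 1), B * D * r ^ m * q ^ (m - (i : ℕ)) := by
              refine Finset.sum_le_sum (fun i _ => ?_)
              rw [abs_mul]
              calc |coeff (m - i) K| * |e i| ≤ (B * ρ ^ (m - (i : ℕ))) * (D * r ^ (i : ℕ)) := by
                    gcongr
                    · exact h _
                    · exact ih i i.2
                _ = B * D * r ^ m * q ^ (m - (i : ℕ)) := by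
                    have : r ^ m = r ^ (m - (i : ℕ)) * r ^ (i : ℕ) := by
                      rw [← pow_add, Nat.sub_add_cancel (Nat.lt_succ_iff.1 i.2)]
                    rw [this, hq, div_pow]
                    field_simp
          _ = B * D * r ^ m * ∑ i ∈ Finset.range (m + 1), q ^ i := by
              rw [← Finset.mul_sum, Fin.sum_univ_eq_sum_range (fun i => q ^ (m - i)),
                ← Finset.sum_range_reflect]
              congr 1
              refine Finset.sum_congr rfl (fun i hi => ?_)
              have := Finset.mem_range.1 hi
              congr 1
              omega
          _ ≤ B * D * r ^ m * (1 - q)⁻¹ := by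
              gcongr
              rw [← tsum_geometric_of_lt_one hq0.le hq1]
              exact (summable_geometric_of_lt_one hq0.le hq1).sum_le_tsum _
                (fun i _ => by positivity)
          _ = D * r ^ (m + 1) * c := by
              rw [hc, pow_succ]; field_simp
      have h2 : e (m + 1) = (∑ i : Fin (m + 1), coeff (m - i) K * e i) / (m + 1) := by
        rw [he, odeCoeff]
      rw [h2, abs_div, abs_of_pos (by positivity : (0 : ℝ) < m + 1), div_le_iff₀ (by positivity)]
      refine h1.trans ?_
      gcongr

open PowerSeries in
/-- A multiplicative integrating factor: `E' = K E` is solved by an invertible power series with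
exponentially decaying coefficients. -/
lemma ExpDecay.exists_integrating_factor {K : PowerSeries ℝ} (hK : ExpDecay K) :
    ∃ E F : PowerSeries ℝ, ExpDecay E ∧ ExpDecay F ∧ E * F = 1 ∧
      derivative (R := ℝ) E = K * E := by
  -- The inverse is the solution of $F'=-KF$, $F(0)=1$: then $(EF)'=0$ and $EF$ has constant term
  -- $1$.
  refine ⟨_, _, hK.mk_odeCoeff, hK.neg.mk_odeCoeff, ?_, derivative_mk_odeCoeff K⟩
  refine derivative.ext ?_ ?_
  · rw [Derivation.leibniz, derivative_mk_odeCoeff, derivative_mk_odeCoeff, derivative_one]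
    simp only [smul_eq_mul]
    ring
  · rw [map_mul, ← coeff_zero_eq_constantCoeff_apply, ← coeff_zero_eq_constantCoeff_apply]
    simp [odeCoeff]

/-! ### Inversion of power series without zeros in the closed unit disc. -/

lemma eq_zero_of_forall_hasSum_zero {d : ℕ → ℂ} (hd : Summable fun n => ‖d n‖)
    (h : ∀ z : ℂ, ‖z‖ < 1 → HasSum (fun n => d n * z ^ n) 0) : d = 0 := by
  rw [← FormalMultilinearSeries.ofScalars_series_eq_zero (𝕜 := ℂ) (E := ℂ)]
  have hp : HasFPowerSeriesOnBall (0 : ℂ → ℂ) (FormalMultilinearSeries.ofScalars ℂ d) 0 1 := by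
    refine ⟨?_, one_pos, fun {z} hz => ?_⟩
    · refine FormalMultilinearSeries.le_radius_of_summable_norm (r := 1) _ ?_
      simpa using hd
    · have hz' : ‖z‖ < 1 := by
        rw [← ENNReal.ofReal_one, Metric.eball_ofReal] at hz
        simpa using hz
      simpa [FormalMultilinearSeries.ofScalars_apply_eq, mul_comm] using h z hz'
  exact hp.hasFPowerSeriesAt.eq_zero

open PowerSeries in
/-- **Wiener's lemma**, in the elementary case of exponentially decaying coefficients. -/
lemma ExpDecay.exists_inverse {T : PowerSeries ℝ} (hT : ExpDecay T)
    (hne : ∀ z : ℂ, ‖z‖ ≤ 1 → ∑' n, ((coeff n T : ℝ) : ℂ) * z ^ n ≠ 0) :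
    ∃ V : PowerSeries ℝ, ExpDecay V ∧ T * V = 1 := by
  obtain ⟨R, hR, hsum⟩ := hT
  set f : ℂ → ℂ := fun z => ∑' n, ((coeff n T : ℝ) : ℂ) * z ^ n with hf
  have hterm : ∀ (n : ℕ) (z : ℂ), z ∈ Metric.ball (0 : ℂ) R →
      ‖((coeff n T : ℝ) : ℂ) * z ^ n‖ ≤ |coeff n T| * R ^ n := by
    intro n z hz
    rw [norm_mul, norm_pow, Complex.norm_real, Real.norm_eq_abs]
    gcongr
    simpa using (mem_ball_zero_iff.1 hz).le
  have hfd : DifferentiableOn ℂ f (Metric.ball 0 R) :=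
    Complex.differentiableOn_tsum_of_summable_norm hsum (fun n => by fun_prop) Metric.isOpen_ball
      hterm
  have hU : IsOpen (Metric.ball (0 : ℂ) R ∩ f ⁻¹' {0}ᶜ) :=
    hfd.continuousOn.isOpen_inter_preimage Metric.isOpen_ball isOpen_compl_singleton
  have hsub : Metric.closedBall (0 : ℂ) 1 ⊆ Metric.ball (0 : ℂ) R ∩ f ⁻¹' {0}ᶜ := by
    intro z hz
    have hz' : ‖z‖ ≤ 1 := by simpa using hz
    exact ⟨by simpa using hz'.trans_lt hR, hne z hz'⟩
  -- By compactness the nonvanishing extends to a disc of radius $1+\delta$. There $1/f$ is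
  -- holomorphic, and its Taylor coefficients decay exponentially by convergence beyond the unit
  -- circle.
  obtain ⟨δ, hδ, hδs⟩ := (isCompact_closedBall (0 : ℂ) 1).exists_cthickening_subset_open hU hsub
  rw [cthickening_closedBall hδ.le zero_le_one] at hδs
  set r : NNReal := ⟨δ + 1, by positivity⟩ with hr
  have hrc : (r : ℝ) = δ + 1 := rfl
  have hr1 : (1 : ℝ) < r := by rw [hrc]; linarith
  have hgd : DifferentiableOn ℂ (fun z => (f z)⁻¹) (Metric.closedBall 0 r) :=
    (hfd.mono fun z hz => (hδs hz).1).inv fun z hz => (hδs hz).2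
  have hp := hgd.hasFPowerSeriesOnBall (R := r) (by exact_mod_cast (by linarith : (0 : ℝ) < r))
  set p := cauchyPowerSeries (fun z => (f z)⁻¹) 0 r
  obtain ⟨s, hs1, hsr⟩ := exists_between hr1
  set s' : NNReal := ⟨s, by linarith⟩ with hs'
  have hcsum : Summable fun n => ‖p.coeff n‖ * s ^ n := by
    have := p.summable_norm_mul_pow (r := s')
      (lt_of_lt_of_le (by exact_mod_cast hsr) hp.r_le)
    simp only [FormalMultilinearSeries.norm_apply_eq_norm_coef] at this
    exact this
  have hc1 : Summable fun n => ‖p.coeff n‖ :=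
    hcsum.of_nonneg_of_le (fun n => by positivity)
      (fun n => le_mul_of_one_le_right (norm_nonneg _) (one_le_pow₀ hs1.le))
  have ha1 : Summable fun n => ‖((coeff n T : ℝ) : ℂ)‖ :=
    hsum.of_nonneg_of_le (fun n => by positivity)
      (fun n => by
        rw [Complex.norm_real, Real.norm_eq_abs]
        exact le_mul_of_one_le_right (abs_nonneg _) (one_le_pow₀ hR.le))
  have hgs : ∀ z : ℂ, ‖z‖ < 1 → HasSum (fun n => p.coeff n * z ^ n) (f z)⁻¹ := by
    intro z hz
    have hz' : z ∈ Metric.eball (0 : ℂ) r := by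
      rw [Metric.eball_coe, mem_ball_zero_iff]
      linarith
    have := hp.hasSum hz'
    simp only [zero_add, FormalMultilinearSeries.apply_eq_pow_smul_coeff, smul_eq_mul] at this
    simpa [mul_comm] using this
  have hle : ∀ {c : ℕ → ℂ} (z : ℂ), ‖z‖ < 1 → (Summable fun n => ‖c n‖) →
      Summable fun n => ‖c n * z ^ n‖ := by
    intro c z hz hc
    refine hc.of_nonneg_of_le (fun n => norm_nonneg _) (fun n => ?_)
    rw [norm_mul, norm_pow]
    exact mul_le_of_le_one_right (norm_nonneg _) (pow_le_one₀ (norm_nonneg _) hz.le)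
  set Tc : PowerSeries ℂ := PowerSeries.map Complex.ofRealHom T with hTc
  set G : PowerSeries ℂ := PowerSeries.mk p.coeff with hG
  -- The analytic inverse is turned into a formal one: $T_cG-1$ has absolutely summable coefficients
  -- and sums to $0$ in the open disc, so all its coefficients vanish.
  have hprod : Tc * G = 1 := by
    have hd1 : Summable fun n => ‖coeff n (Tc * G)‖ := by
      have := summable_norm_sum_mul_antidiagonal_of_summable_norm ha1 hc1
      refine this.congr (fun n => ?_)
      rw [coeff_mul]
      simp [hTc, hG]
    have hd2 : Summable fun n => ‖coeff n (1 : PowerSeries ℂ)‖ :=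
      summable_of_ne_finset_zero (s := {0}) (fun n hn => by
        rw [coeff_one, if_neg (by simpa using hn), norm_zero])
    have hd : (fun n => coeff n (Tc * G - 1)) = 0 := by
      refine eq_zero_of_forall_hasSum_zero ?_ (fun z hz => ?_)
      · refine (hd1.add hd2).of_nonneg_of_le (fun n => norm_nonneg _) (fun n => ?_)
        rw [map_sub]
        exact norm_sub_le _ _
      · have h1 := hle z hz ha1
        have h2 := hle z hz hc1
        have h3 := tsum_mul_tsum_eq_tsum_sum_antidiagonal_of_summable_norm h1 h2
        have h4 := (summable_norm_sum_mul_antidiagonal_of_summable_norm h1 h2).of_norm.hasSum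
        rw [← h3, (hgs z hz).tsum_eq, mul_inv_cancel₀ (hne z hz.le)] at h4
        have h5 : HasSum (fun n => coeff n (1 : PowerSeries ℂ) * z ^ n) 1 := by
          have := hasSum_single (f := fun n => coeff n (1 : PowerSeries ℂ) * z ^ n) 0
            (fun n hn => by rw [coeff_one, if_neg hn, zero_mul])
          simpa using this
        have h6 := h4.sub h5
        rw [sub_self] at h6
        refine h6.congr_fun (fun n => ?_)
        rw [map_sub, sub_mul, coeff_mul, Finset.sum_mul]
        congr 1
        refine Finset.sum_congr rfl (fun kl hkl => ?_)
        rw [← Finset.HasAntidiagonal.mem_antidiagonal.1 hkl, pow_add]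
        simp only [hTc, hG, coeff_map, coeff_mk, Complex.ofRealHom_eq_coe]
        ring
    have : Tc * G - 1 = 0 := by
      ext n
      simpa using congrFun hd n
    exact sub_eq_zero.1 this
  have hT0 : coeff 0 T ≠ 0 := by
    intro h0
    refine hne 0 (by simp) ?_
    rw [tsum_eq_single 0 (fun n hn => by simp [hn])]
    simp [h0]
  have hinv : T * T⁻¹ = 1 := PowerSeries.mul_inv_cancel T (by simpa using hT0)
  refine ⟨T⁻¹, ⟨s, hs1, ?_⟩, hinv⟩
  -- Uniqueness of inverses shows that the Taylor coefficients of $1/f$ are the real coefficients of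
  -- the formal inverse.
  have hGinv : PowerSeries.map Complex.ofRealHom T⁻¹ = G := by
    have h1 : Tc * PowerSeries.map Complex.ofRealHom T⁻¹ = 1 := by
      rw [hTc, ← map_mul, hinv, map_one]
    calc PowerSeries.map Complex.ofRealHom T⁻¹
        = PowerSeries.map Complex.ofRealHom T⁻¹ * (Tc * G) := by rw [hprod, mul_one]
      _ = (Tc * PowerSeries.map Complex.ofRealHom T⁻¹) * G := by ring
      _ = G := by rw [h1, one_mul]
  refine hcsum.congr (fun n => ?_)
  have : p.coeff n = ((coeff n T⁻¹ : ℝ) : ℂ) := by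
    have := congrArg (coeff n) hGinv
    simpa [hG] using this.symm
  rw [this, Complex.norm_real, Real.norm_eq_abs]

/-! ### Polynomial weights, first moments and values in the unit disc. -/

namespace ExpDecay

open PowerSeries

variable {f g : PowerSeries ℝ}

/-- Split $R=\sqrt R\cdot\sqrt R$: one factor pays for the polynomial, the other remains as the
rate. -/
lemma mul_pow_bound (hf : ExpDecay f) {c : ℕ → ℝ} {M : ℝ} {N : ℕ}
    (hc : ∀ n : ℕ, |c n| ≤ M * ((n : ℝ) + 1) ^ N) :
    ExpDecay (PowerSeries.mk fun n => coeff n f * c n) := by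
  obtain ⟨R, hR, h⟩ := hf
  have hR0 : (0 : ℝ) ≤ R := by linarith
  set s := √R with hs
  have hs1 : 1 < s := by rw [hs]; exact Real.lt_sqrt_of_sq_lt (by simpa using hR)
  have hss : s * s = R := Real.mul_self_sqrt hR0
  have hd : ExpDecay (PowerSeries.mk fun n => coeff n f * s ^ n) := by
    refine ⟨s, hs1, h.congr (fun n => ?_)⟩
    rw [coeff_mk, abs_mul, abs_of_nonneg (by positivity : 0 ≤ s ^ n), mul_assoc, ← mul_pow, hss]
  refine ⟨s, hs1, ((hd.summable_pow N).mul_left M).of_nonneg_of_le (fun n => by positivity)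
    (fun n => ?_)⟩
  rw [coeff_mk, coeff_mk, abs_mul, abs_mul, abs_of_nonneg (by positivity : 0 ≤ s ^ n)]
  calc |coeff n f| * |c n| * s ^ n ≤ |coeff n f| * (M * ((n : ℝ) + 1) ^ N) * s ^ n := by
        gcongr; exact hc n
    _ = _ := by ring

lemma one_sub_X : ExpDecay (1 - X) := by
  refine ⟨2, by norm_num, summable_of_ne_finset_zero (s := {0, 1}) (fun n hn => ?_)⟩
  simp only [Finset.mem_insert, Finset.mem_singleton, not_or] at hn
  simp [coeff_one, coeff_X, hn.1, hn.2]

lemma tsum_one_sub_X : ∑' n, coeff n (1 - X : PowerSeries ℝ) = 0 := by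
  rw [tsum_eq_sum (s := {0, 1})]
  · simp [coeff_one, coeff_X]
  · intro n hn
    simp only [Finset.mem_insert, Finset.mem_singleton, not_or] at hn
    simp [coeff_one, coeff_X, hn.1, hn.2]

lemma deriv (hf : ExpDecay f) : ExpDecay (derivative (R := ℝ) f) := by
  have h := hf.shift.mul_pow_bound (c := fun n => (n : ℝ) + 1) (M := 1) (N := 1)
    (fun n => by rw [abs_of_nonneg (by positivity)]; simp)
  have he : derivative (R := ℝ) f
      = PowerSeries.mk fun n => coeff n (PowerSeries.mk fun n => coeff (n + 1) f) * ((n : ℝ) + 1) := by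
    ext n
    rw [coeff_derivative, coeff_mk, coeff_mk]
  rw [he]
  exact h

/-- The sum of the tails is the first moment. -/
lemma tsum_tail (hf : ExpDecay f) :
    ∑' n, coeff n (PowerSeries.mk fun k => ∑' i, coeff (i + (k + 1)) f)
      = ∑' n : ℕ, (n : ℝ) * coeff n f := by
  set T := PowerSeries.mk fun k => ∑' i, coeff (i + (k + 1)) f
  have hT : ExpDecay T := hf.tail
  -- Differentiating $(1-X)T=f(1)-f$ gives $T=(1-X)T'+f'$. At $1$ the first term vanishes, so
  -- $T(1)=f'(1)$.
  have hd := congrArg (fun g => derivative (R := ℝ) g) hf.one_sub_X_mul_tail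
  simp only [Derivation.leibniz, map_sub, derivative_one, derivative_X, derivative_C,
    smul_eq_mul, zero_sub] at hd
  have hd' : T = (1 - X) * derivative (R := ℝ) T + derivative (R := ℝ) f := by
    linear_combination -hd
  have hsum : Summable fun n : ℕ => (n : ℝ) * coeff n f := by
    refine Summable.of_norm ((hf.summable_pow 1).of_nonneg_of_le (fun n => norm_nonneg _)
      (fun n => ?_))
    rw [norm_mul, Real.norm_eq_abs, Real.norm_eq_abs, abs_of_nonneg n.cast_nonneg, mul_comm]
    gcongr
    simp
  conv_lhs => rw [hd']
  simp only [map_add]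
  rw [((one_sub_X.mul hT.deriv).summable).tsum_add hf.deriv.summable,
    one_sub_X.tsum_mul hT.deriv, tsum_one_sub_X, zero_mul, zero_add, hsum.tsum_eq_zero_add]
  simp only [Nat.cast_zero, zero_mul, zero_add]
  refine tsum_congr (fun n => ?_)
  rw [coeff_derivative]
  push_cast
  ring

lemma summable_complex (hf : ExpDecay f) {z : ℂ} (hz : ‖z‖ ≤ 1) :
    Summable fun n => ‖((coeff n f : ℝ) : ℂ) * z ^ n‖ := by
  refine hf.summable_abs.of_nonneg_of_le (fun n => norm_nonneg _) (fun n => ?_)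
  rw [norm_mul, norm_pow, Complex.norm_real, Real.norm_eq_abs]
  exact mul_le_of_le_one_right (abs_nonneg _) (pow_le_one₀ (norm_nonneg _) hz)

lemma tsum_mul_complex (hf : ExpDecay f) (hg : ExpDecay g) {z : ℂ} (hz : ‖z‖ ≤ 1) :
    ∑' n, ((coeff n (f * g) : ℝ) : ℂ) * z ^ n
      = (∑' n, ((coeff n f : ℝ) : ℂ) * z ^ n) * ∑' n, ((coeff n g : ℝ) : ℂ) * z ^ n := by
  rw [tsum_mul_tsum_eq_tsum_sum_antidiagonal_of_summable_norm
    (hf.summable_complex hz) (hg.summable_complex hz)]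
  refine tsum_congr (fun n => ?_)
  rw [coeff_mul, Complex.ofReal_sum, Finset.sum_mul]
  refine Finset.sum_congr rfl (fun kl hkl => ?_)
  rw [← Finset.HasAntidiagonal.mem_antidiagonal.1 hkl, pow_add]
  push_cast
  ring

end ExpDecay

/-- A power series with nonnegative coefficients of sum `1` and without periodicity takes the value
`1` in the closed unit disc only at `1`. -/
lemma eq_one_of_tsum_mul_pow_eq_one {p : ℕ → ℝ} (hp0 : ∀ b, 0 ≤ p b) (hp1 : HasSum p 1)
    (haper : ∀ d : ℕ, (∀ i, 0 < p i → d ∣ i) → d = 1) {z : ℂ} (hz : ‖z‖ ≤ 1)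
    (h : HasSum (fun n => (p n : ℂ) * z ^ n) 1) : z = 1 := by
  have hre : HasSum (fun n => p n * (z ^ n).re) 1 := by
    simpa using Complex.hasSum_re h
  have hd : HasSum (fun n => p n * (1 - (z ^ n).re)) 0 := by
    have := hp1.sub hre
    rw [sub_self] at this
    refine this.congr_fun (fun n => by ring)
  have hle : ∀ n, (z ^ n).re ≤ 1 := fun n =>
    (Complex.re_le_norm _).trans (by rw [norm_pow]; exact pow_le_one₀ (norm_nonneg _) hz)
  -- A zero sum of nonnegative terms forces $\operatorname{Re}z^i=1$ wherever $p_i>0$. Together with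
  -- $|z^i|\le1$ this gives $z^i=1$, so the order of $z$ divides the whole support.
  have hz0 := (hasSum_zero_iff_of_nonneg
    (fun n => mul_nonneg (hp0 n) (by linarith [hle n]))).1 hd
  refine orderOf_eq_one_iff.1 (haper _ (fun i hi => orderOf_dvd_of_pow_eq_one ?_))
  have h1 : p i * (1 - (z ^ i).re) = 0 := congrFun hz0 i
  have h2 : (z ^ i).re = 1 := by
    rcases mul_eq_zero.1 h1 with h | h <;> linarith
  have h3 : ‖z ^ i‖ ≤ 1 := by rw [norm_pow]; exact pow_le_one₀ (norm_nonneg _) hz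
  have h4 : (z ^ i).re * (z ^ i).re + (z ^ i).im * (z ^ i).im ≤ 1 := by
    rw [← Complex.normSq_apply, Complex.normSq_eq_norm_sq]
    exact pow_le_one₀ (norm_nonneg _) h3
  refine Complex.ext (by simpa using h2) ?_
  rw [Complex.one_im]
  rw [h2] at h4
  nlinarith

/-! ### Power-law asymptotics of convolutions and first order recursions. -/

open PowerSeries in
/-- Convolution with an exponentially decaying sequence preserves regular variation. -/
lemma ExpDecay.tendsto_mul {f b : PowerSeries ℝ} (hf : ExpDecay f) {γ w : ℝ} (hγ : 0 ≤ γ)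
    (hb : Tendsto (fun n : ℕ => coeff n b * ((n : ℝ) + 1) ^ γ) atTop (𝓝 w)) :
    Tendsto (fun n : ℕ => coeff n (f * b) * ((n : ℝ) + 1) ^ γ) atTop
      (𝓝 ((∑' n, coeff n f) * w)) := by
  obtain ⟨M, hM⟩ := (Metric.isBounded_range_of_tendsto _ hb).exists_norm_le
  have hM' : ∀ n : ℕ, |coeff n b| * ((n : ℝ) + 1) ^ γ ≤ M := by
    intro n
    have := hM _ (Set.mem_range_self n)
    rwa [Real.norm_eq_abs, abs_mul, abs_of_nonneg (a := ((n : ℝ) + 1) ^ γ) (by positivity)] at this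
  -- Dominated convergence for the convolution: for fixed $k$ the shift from $n-k$ to $n$ does not
  -- affect the power asymptotically, and the dominating series uses that $f$ has all polynomial
  -- moments.
  have key := tendsto_tsum_of_dominated_convergence (𝓕 := atTop)
    (f := fun (n k : ℕ) => if k ≤ n then coeff k f * coeff (n - k) b * ((n : ℝ) + 1) ^ γ else 0)
    (g := fun k => coeff k f * w) (bound := fun k : ℕ => |coeff k f| * ((k : ℝ) + 1) ^ γ * M)
    ((hf.summable_rpow γ).mul_right M) (fun k => ?_) (Eventually.of_forall fun n k => ?_)
  · rw [tsum_mul_right] at key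
    refine key.congr (fun n => ?_)
    rw [tsum_eq_sum (s := Finset.range (n + 1)), coeff_mul,
      Finset.Nat.sum_antidiagonal_eq_sum_range_succ_mk, Finset.sum_mul]
    · refine Finset.sum_congr rfl (fun k hk => ?_)
      rw [if_pos (Nat.lt_succ_iff.1 (Finset.mem_range.1 hk))]
    · intro k hk
      rw [if_neg (by simpa using hk)]
  · rw [← tendsto_add_atTop_iff_nat k]
    have h1 : Tendsto (fun n : ℕ => ((((n : ℝ) + k + 1) / ((n : ℝ) + 1)) ^ γ)) atTop (𝓝 1) := by
      have h2 : Tendsto (fun n : ℕ => 1 + (k : ℝ) * (1 / ((n : ℝ) + 1))) atTop (𝓝 (1 + k * 0)) :=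
        (tendsto_one_div_add_atTop_nhds_zero_nat.const_mul _).const_add _
      rw [mul_zero, add_zero] at h2
      have h3 := h2.rpow_const (p := γ) (Or.inl one_ne_zero)
      rw [Real.one_rpow] at h3
      refine h3.congr (fun n => ?_)
      congr 1
      field_simp
      ring
    have h4 := (hb.mul h1).const_mul (coeff k f)
    rw [mul_one] at h4
    refine h4.congr (fun n => ?_)
    rw [if_pos (Nat.le_add_left k n), Nat.add_sub_cancel, Real.div_rpow (by positivity)
      (by positivity)]
    push_cast
    field_simp
  · split_ifs with h
    · rw [norm_mul, norm_mul, Real.norm_eq_abs, Real.norm_eq_abs, Real.norm_eq_abs,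
        abs_of_nonneg (a := ((n : ℝ) + 1) ^ γ) (by positivity), mul_assoc, mul_assoc]
      refine mul_le_mul_of_nonneg_left ?_ (abs_nonneg _)
      -- From $n+1\le(k+1)(n-k+1)$.
      have h5 : ((n : ℝ) + 1) ^ γ ≤ ((k : ℝ) + 1) ^ γ * (((n - k : ℕ) : ℝ) + 1) ^ γ := by
        rw [← Real.mul_rpow (by positivity) (by positivity)]
        refine Real.rpow_le_rpow (by positivity) ?_ hγ
        have : (n : ℝ) = k + ((n - k : ℕ) : ℝ) := by exact_mod_cast (by omega)
        rw [this]
        nlinarith [(k.cast_nonneg : (0 : ℝ) ≤ k), ((n - k).cast_nonneg : (0 : ℝ) ≤ ((n - k : ℕ) : ℝ))]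
      calc |coeff (n - k) b| * ((n : ℝ) + 1) ^ γ
          ≤ |coeff (n - k) b| * (((k : ℝ) + 1) ^ γ * (((n - k : ℕ) : ℝ) + 1) ^ γ) := by gcongr
        _ = ((k : ℝ) + 1) ^ γ * (|coeff (n - k) b| * (((n - k : ℕ) : ℝ) + 1) ^ γ) := by ring
        _ ≤ ((k : ℝ) + 1) ^ γ * M := by gcongr; exact hM' _
    · rw [norm_zero]
      have := (by positivity : 0 ≤ |coeff 0 b| * (((0 : ℕ) : ℝ) + 1) ^ γ).trans (hM' 0)
      positivity

/-- Euler's limit formula for $\Gamma$, applied to numerator and denominator; the limit is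
$\Gamma(c)/\Gamma(a)$. -/
lemma tendsto_prod_ratio {a c : ℝ} (ha : 0 < a) (hc : 0 < c) : ∃ L : ℝ, 0 < L ∧
    Tendsto (fun n : ℕ => (∏ j ∈ Finset.range n, (a + j) / (c + j)) * ((n : ℝ) + 1) ^ (c - a))
      atTop (𝓝 L) := by
  refine ⟨Real.Gamma c / Real.Gamma a, div_pos (Real.Gamma_pos_of_pos hc) (Real.Gamma_pos_of_pos ha),
    ?_⟩
  rw [← tendsto_add_atTop_iff_nat 1]
  have h1 := (Real.GammaSeq_tendsto_Gamma c).div (Real.GammaSeq_tendsto_Gamma a)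
    (Real.Gamma_pos_of_pos ha).ne'
  have h2 : Tendsto (fun n : ℕ => (1 + 2 / (n : ℝ)) ^ (c - a)) atTop (𝓝 1) := by
    have : Tendsto (fun n : ℕ => 1 + 2 / (n : ℝ)) atTop (𝓝 (1 + 0)) :=
      (tendsto_const_div_atTop_nhds_zero_nat 2).const_add 1
    rw [add_zero] at this
    simpa using this.rpow_const (p := c - a) (Or.inl one_ne_zero)
  have h3 := h1.mul h2
  rw [mul_one] at h3
  refine h3.congr' ?_
  filter_upwards [eventually_gt_atTop 0] with n hn
  have hn' : (0 : ℝ) < n := by exact_mod_cast hn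
  have hA : 0 < ∏ j ∈ Finset.range (n + 1), (a + (j : ℝ)) :=
    Finset.prod_pos (fun j _ => by positivity)
  have hC : 0 < ∏ j ∈ Finset.range (n + 1), (c + (j : ℝ)) :=
    Finset.prod_pos (fun j _ => by positivity)
  have e1 : (1 + 2 / (n : ℝ)) = (n + 2) / n := by field_simp
  have e2 : (((n + 1 : ℕ) : ℝ) + 1) = n + 2 := by push_cast; ring
  rw [e1, e2, Real.div_rpow (by positivity) hn'.le, Finset.prod_div_distrib]
  simp only [Pi.div_apply, Real.GammaSeq]
  rw [Real.rpow_sub hn' c a]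
  have := Real.rpow_pos_of_pos hn' a
  have := Real.rpow_pos_of_pos hn' c
  have := Nat.factorial_pos n
  field_simp

open PowerSeries in
/-- Solutions of a first order recursion with a summable perturbation. -/
lemma first_order_recursion {a c : ℝ} (ha : 0 < a) (hac : a ≤ c) {u : ℕ → ℝ} {s : PowerSeries ℝ}
    (hs : ExpDecay s) (h : ∀ n : ℕ, u (n + 1) * (c + n) = u n * (a + n) + coeff n s) :
    ∃ w : ℝ, Tendsto (fun n : ℕ => u n * ((n : ℝ) + 1) ^ (c - a)) atTop (𝓝 w) ∧
      (w = 0 → ExpDecay (PowerSeries.mk u)) := by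
  have hc : 0 < c := ha.trans_le hac
  obtain ⟨L, hL, hφ⟩ := tendsto_prod_ratio ha hc
  -- The solution of the homogeneous recursion. Since $1/\varphi$ grows only polynomially,
  -- $v=u/\varphi$ is a partial sum of an exponentially decaying series and converges.
  set φ : ℕ → ℝ := fun n => ∏ j ∈ Finset.range n, (a + (j : ℝ)) / (c + j) with hφd
  have hφ0 : ∀ n, 0 < φ n := fun n => Finset.prod_pos (fun j _ => by positivity)
  have hφs : ∀ n, φ (n + 1) = φ n * ((a + n) / (c + n)) := fun n => Finset.prod_range_succ _ _
  have hφ1 : ∀ n, φ n ≤ 1 := fun n =>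
    Finset.prod_le_one (fun j _ => by positivity)
      (fun j _ => (div_le_one (by positivity)).2 (by linarith))
  obtain ⟨M, hM⟩ := (Metric.isBounded_range_of_tendsto _ (hφ.inv₀ hL.ne')).exists_norm_le
  set N := ⌈c - a⌉₊ with hN
  have hinv : ∀ n : ℕ, (φ n)⁻¹ ≤ M * ((n : ℝ) + 1) ^ N := by
    intro n
    have h1 := hM _ (Set.mem_range_self n)
    have hpos : 0 < ((n : ℝ) + 1) ^ (c - a) := by positivity
    have hM0 : 0 ≤ M := (norm_nonneg _).trans h1
    have hp' := hφ0 n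
    rw [Real.norm_eq_abs, abs_of_nonneg (by positivity), mul_inv] at h1
    have h2 : (φ n)⁻¹ ≤ M * ((n : ℝ) + 1) ^ (c - a) := by
      rw [← div_le_iff₀ hpos, div_eq_mul_inv]; exact h1
    refine h2.trans ?_
    gcongr
    rw [← Real.rpow_natCast]
    exact Real.rpow_le_rpow_of_exponent_le (by linarith [n.cast_nonneg (α := ℝ)]) (Nat.le_ceil _)
  set g : ℕ → ℝ := fun n => ((c + n) * φ (n + 1))⁻¹ with hg
  have hginc : ExpDecay (PowerSeries.mk fun n => coeff n s * g n) := by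
    refine hs.mul_pow_bound (M := c⁻¹ * (M * 2 ^ N)) (N := N) (fun n => ?_)
    have h1 := hinv (n + 1)
    have hM0 : 0 ≤ M := by
      have := (inv_pos.2 (hφ0 0)).le.trans (hinv 0)
      simpa using this
    have hp' := hφ0 (n + 1)
    simp only [hg]
    rw [abs_of_nonneg (by positivity), mul_inv]
    have h2 : (c + (n : ℝ))⁻¹ ≤ c⁻¹ := inv_anti₀ hc (by simp)
    calc (c + (n : ℝ))⁻¹ * (φ (n + 1))⁻¹ ≤ c⁻¹ * (M * (((n + 1 : ℕ) : ℝ) + 1) ^ N) := by gcongr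
      _ ≤ c⁻¹ * (M * (2 * ((n : ℝ) + 1)) ^ N) := by
          gcongr; push_cast; linarith [n.cast_nonneg (α := ℝ)]
      _ = _ := by rw [mul_pow]; ring
  set v : ℕ → ℝ := fun n => u n / φ n with hv
  have hvs : ∀ n, v (n + 1) = v n + coeff n s * g n := by
    intro n
    have h1 := hφ0 n
    have h2 : (0 : ℝ) < c + n := by positivity
    have h3 : (0 : ℝ) < a + n := by positivity
    have h4 : u (n + 1) = (u n * (a + n) + coeff n s) / (c + n) := by
      rw [← h n, mul_div_cancel_right₀ _ h2.ne']
    simp only [hv, hg, h4, hφs]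
    field_simp
  have hvsum : ∀ n, v n = v 0 + ∑ i ∈ Finset.range n, coeff i s * g i := by
    intro n
    induction n with
    | zero => simp
    | succ n ih => rw [hvs, ih, Finset.sum_range_succ]; ring
  have hsm : Summable fun n => coeff n s * g n := by simpa using hginc.summable
  set W := v 0 + ∑' n, coeff n s * g n with hW
  have hvt : Tendsto v atTop (𝓝 W) := by
    refine (hsm.hasSum.tendsto_sum_nat.const_add (v 0)).congr (fun n => (hvsum n).symm)
  refine ⟨W * L, (hvt.mul hφ).congr (fun n => ?_), fun hw => ?_⟩
  · have := (hφ0 n).ne'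
    change u n / φ n * (φ n * _) = _
    field_simp
  · have hW0 : W = 0 := by
      rcases mul_eq_zero.1 hw with h | h
      · exact h
      · exact absurd h hL.ne'
    have htail := hginc.tail.bound
    obtain ⟨B, r, hB, hr, hr1, hb⟩ := htail
    have hvb : ∀ n, |v (n + 1)| ≤ B * r ^ n := by
      intro n
      have h1 := hb n
      simp only [coeff_mk] at h1
      have h2 := hsm.sum_add_tsum_nat_add (n + 1)
      -- When the limit $W$ of $v$ is $0$, $v$ is minus a tail of that series and decays
      -- exponentially; so does $u$, because $\varphi\le1$.
      have h3 : v (n + 1) = - ∑' i, coeff (i + (n + 1)) s * g (i + (n + 1)) := by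
        rw [hvsum]
        linarith
      rw [h3, abs_neg]
      exact h1
    refine ExpDecay.mk_of_bound (C := |u 0| + B * r⁻¹) hr.le hr1 (fun n => ?_)
    cases n with
    | zero => simp; positivity
    | succ n =>
      have h1 : u (n + 1) = v (n + 1) * φ (n + 1) := by
        simp only [hv]
        rw [div_mul_cancel₀ _ (hφ0 _).ne']
      have h0 : |u (n + 1)| ≤ |v (n + 1)| := by
        rw [h1, abs_mul, abs_of_pos (hφ0 _)]
        exact mul_le_of_le_one_right (abs_nonneg _) (hφ1 _)
      calc |u (n + 1)| ≤ B * r ^ n := h0.trans (hvb n)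
        _ = B * r⁻¹ * r ^ (n + 1) := by rw [pow_succ]; field_simp
        _ ≤ (|u 0| + B * r⁻¹) * r ^ (n + 1) := by gcongr; simp

open PowerSeries in
/-- The generating function of the tails of an aperiodic distribution with positive mean is
invertible among the power series with exponentially decaying coefficients. -/
lemma exists_inverse_tail {p : ℕ → ℝ} (hp0 : ∀ b, 0 ≤ p b) (hp1 : HasSum p 1)
    (hpd : ExpDecay (PowerSeries.mk p)) (hm : 0 < ∑' b : ℕ, (b : ℝ) * p b)
    (haper : ∀ d : ℕ, (∀ i, 0 < p i → d ∣ i) → d = 1) :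
    ∃ T V : PowerSeries ℝ, ExpDecay T ∧ ExpDecay V ∧ (1 - X) * T = 1 - PowerSeries.mk p ∧
      T * V = 1 ∧ ∑' n, coeff n T = ∑' b : ℕ, (b : ℝ) * p b := by
  set T := PowerSeries.mk fun k => ∑' i, coeff (i + (k + 1)) (PowerSeries.mk p) with hTd
  have hT : ExpDecay T := hpd.tail
  have hTP : (1 - X) * T = 1 - PowerSeries.mk p := by
    rw [hTd, hpd.one_sub_X_mul_tail]
    simp [hp1.tsum_eq]
  have hTm : ∑' n, coeff n T = ∑' b : ℕ, (b : ℝ) * p b := by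
    rw [hTd, hpd.tsum_tail]
    simp
  -- At $z=1$ the value is the positive mean. Elsewhere a zero of $T$ would give $P(z)=1$, which
  -- aperiodicity allows only at $z=1$.
  have hne : ∀ z : ℂ, ‖z‖ ≤ 1 → ∑' n, ((coeff n T : ℝ) : ℂ) * z ^ n ≠ 0 := by
    intro z hz h0
    by_cases hz1 : z = 1
    · subst hz1
      simp only [one_pow, mul_one] at h0
      rw [← Complex.ofReal_tsum, hTm] at h0
      exact hm.ne' (by exact_mod_cast h0)
    · refine hz1 (eq_one_of_tsum_mul_pow_eq_one hp0 hp1 haper hz ?_)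
      have h1 := ExpDecay.one_sub_X.tsum_mul_complex hT hz
      rw [hTP, h0, mul_zero] at h1
      have hs1 := (ExpDecay.summable_complex (ExpDecay.const 1) hz).of_norm
      have hs2 := (hpd.summable_complex hz).of_norm
      have h2 : ∑' n, ((coeff n (C (1 : ℝ)) : ℝ) : ℂ) * z ^ n = 1 := by
        rw [tsum_eq_single 0 (fun n hn => by rw [coeff_C, if_neg hn]; simp)]
        simp
      have h3 : ∑' n, ((coeff n (PowerSeries.mk p) : ℝ) : ℂ) * z ^ n = 1 := by
        rw [← h2, ← sub_eq_zero, ← hs2.tsum_sub hs1, ← neg_eq_zero, ← h1, ← tsum_neg]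
        refine tsum_congr (fun n => ?_)
        simp only [map_sub, map_one]
        push_cast
        ring
      have h4 := hs2.hasSum
      rw [h3] at h4
      simpa using h4
  obtain ⟨V, hV, hTV⟩ := hT.exists_inverse hne
  exact ⟨T, V, hT, hV, hTP, hTV, hTm⟩

/-! ### The renewal-type recursion. -/

open PowerSeries in
/-- Nonnegative solutions of the recursion cannot decay exponentially. -/
lemma not_expDecay_of_recursion {p r x : ℕ → ℝ} {s m : ℝ} (hs : 0 < s)
    (hp0 : ∀ b, 0 ≤ p b) (hp1 : HasSum p 1) (hpd : ExpDecay (PowerSeries.mk p))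
    (hm : m = ∑' b : ℕ, (b : ℝ) * p b) (hm0 : 0 < m)
    (hr0 : ∀ j, 0 ≤ r j) (hrpos : ∃ j, 1 ≤ j ∧ 0 < r j) (hx0 : ∀ j, 0 ≤ x j)
    (hrec : ∀ j : ℕ, r j + ∑ kl ∈ Finset.HasAntidiagonal.antidiagonal j, kl.1 * x kl.1 * p kl.2
      ≤ x j * (s + j)) : ¬ ExpDecay (PowerSeries.mk x) := by
  intro hx
  have hxpow : ∀ N : ℕ, ExpDecay (PowerSeries.mk fun n => x n * (n : ℝ) ^ N) := fun N => by
    simpa using hx.mul_pow_bound (c := fun n => (n : ℝ) ^ N) (M := 1) (N := N)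
      (fun n => by rw [abs_of_nonneg (by positivity), one_mul]; gcongr; simp)
  have hpm : ExpDecay (PowerSeries.mk fun n => p n * (n : ℝ)) := by
    simpa using hpd.mul_pow_bound (c := fun n => (n : ℝ)) (M := 1) (N := 1)
      (fun n => by rw [abs_of_nonneg (by positivity), one_mul]; simp)
  -- With $M_k=\sum_n n^kx_n$, the recursion times $j^{N+1}$ sums to $M_{N+2}+(N+1)mM_{N+1}\le
  -- sM_{N+1}+M_{N+2}$. This choice of $N$ makes that impossible, because $M_{N+1}>0$.
  obtain ⟨N, hN⟩ := exists_nat_gt (s / m)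
  have hNm : s < (N + 1) * m := by
    rw [div_lt_iff₀ hm0] at hN
    nlinarith
  set M : ℕ → ℝ := fun N => ∑' n, coeff n (PowerSeries.mk fun n => x n * (n : ℝ) ^ N) with hM
  have hpt : ∑' n, coeff n (PowerSeries.mk p) = 1 := by simpa using hp1.tsum_eq
  have hpmt : ∑' n, coeff n (PowerSeries.mk fun n => p n * (n : ℝ)) = m := by
    rw [hm]
    exact tsum_congr (fun n => by rw [coeff_mk, mul_comm])
  have h1 := (hxpow (N + 2)).tsum_mul hpd
  have h2 := (hxpow (N + 1)).tsum_mul hpm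
  rw [hpt, mul_one] at h1
  rw [hpmt] at h2
  have hle : ∀ n, coeff n ((PowerSeries.mk fun n => x n * (n : ℝ) ^ (N + 2)) * PowerSeries.mk p)
      + (N + 1) * coeff n ((PowerSeries.mk fun n => x n * (n : ℝ) ^ (N + 1)) *
        PowerSeries.mk fun n => p n * (n : ℝ))
      ≤ s * coeff n (PowerSeries.mk fun n => x n * (n : ℝ) ^ (N + 1))
        + coeff n (PowerSeries.mk fun n => x n * (n : ℝ) ^ (N + 2)) := by
    intro n
    have h3 : ∑ kl ∈ Finset.HasAntidiagonal.antidiagonal n, kl.1 * x kl.1 * p kl.2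
        ≤ x n * (s + n) := by linarith [hrec n, hr0 n]
    have h4 := mul_le_mul_of_nonneg_right h3 (by positivity : (0 : ℝ) ≤ (n : ℝ) ^ (N + 1))
    simp only [coeff_mul, coeff_mk, Finset.mul_sum, ← Finset.sum_add_distrib]
    refine le_trans ?_ (h4.trans (le_of_eq (by ring)))
    rw [Finset.sum_mul]
    refine Finset.sum_le_sum (fun kl hkl => ?_)
    rw [← Finset.HasAntidiagonal.mem_antidiagonal.1 hkl]
    push_cast
    set k : ℝ := (kl.1 : ℝ)
    set l : ℝ := (kl.2 : ℝ)
    have hk : 0 ≤ k := Nat.cast_nonneg _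
    have hl : 0 ≤ l := Nat.cast_nonneg _
    -- Bernoulli's inequality in homogeneous form: the binomial terms of degree at most one in $l$.
    have hb : k ^ (N + 1) + (N + 1) * k ^ N * l ≤ (k + l) ^ (N + 1) := by
      have := pow_add_mul_le_add_pow hk (by linarith : 0 ≤ 2 * k + l) (N + 1)
      push_cast at this
      simpa using this
    have hxp : 0 ≤ k * x kl.1 * p kl.2 := mul_nonneg (mul_nonneg hk (hx0 _)) (hp0 _)
    refine le_trans (le_of_eq ?_) (mul_le_mul_of_nonneg_left hb hxp)
    ring
  have hs1 := ((hxpow (N + 2)).mul hpd).summable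
  have hs2 := ((hxpow (N + 1)).mul hpm).summable
  have h5 := Summable.tsum_le_tsum hle (hs1.add (hs2.mul_left _))
    (((hxpow (N + 1)).summable.mul_left _).add (hxpow (N + 2)).summable)
  rw [hs1.tsum_add (hs2.mul_left _), tsum_mul_left, h1, h2,
    ((hxpow (N + 1)).summable.mul_left _).tsum_add (hxpow (N + 2)).summable, tsum_mul_left] at h5
  obtain ⟨j, hj, hrj⟩ := hrpos
  have hxj : 0 < x j := by
    have h6 := hrec j
    have h7 : 0 ≤ ∑ kl ∈ Finset.HasAntidiagonal.antidiagonal j, kl.1 * x kl.1 * p kl.2 :=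
      Finset.sum_nonneg (fun kl _ => mul_nonneg (mul_nonneg (Nat.cast_nonneg _) (hx0 _)) (hp0 _))
    have h8 : 0 < x j * (s + j) := by linarith
    exact pos_of_mul_pos_left h8 (by positivity)
  have hpos : 0 < ∑' n, coeff n (PowerSeries.mk fun n => x n * (n : ℝ) ^ (N + 1)) := by
    refine (hxpow (N + 1)).summable.tsum_pos (fun n => ?_) j ?_
    · rw [coeff_mk]; exact mul_nonneg (hx0 _) (by positivity)
    · rw [coeff_mk]; positivity
  nlinarith

open PowerSeries in
/-- Power law asymptotics for the nonnegative solutions of a renewal-type recursion with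
coefficients that are linear in the index. -/
theorem tendsto_of_recursion {p q r x : ℕ → ℝ} {σ m Q : ℝ} (hσ : 0 < σ)
    (hp0 : ∀ b, 0 ≤ p b) (hp1 : HasSum p 1) (hpd : ExpDecay (PowerSeries.mk p))
    (hm : m = ∑' b : ℕ, (b : ℝ) * p b) (hm0 : 0 < m)
    (haper : ∀ d : ℕ, (∀ i, 0 < p i → d ∣ i) → d = 1)
    (hq0 : ∀ b, 0 ≤ q b) (hq1 : HasSum q Q) (hqd : ExpDecay (PowerSeries.mk q))
    (hr0 : ∀ j, 0 ≤ r j) (hrd : ExpDecay (PowerSeries.mk r)) (hrpos : ∃ j, 1 ≤ j ∧ 0 < r j)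
    (hx0 : ∀ j, 0 ≤ x j)
    (hrec : ∀ j : ℕ, x j * (σ * (1 + Q) + j) = σ * r j +
      ∑ kl ∈ Finset.HasAntidiagonal.antidiagonal j,
        (kl.1 * x kl.1 * p kl.2 + σ * (x kl.1 * q kl.2))) :
    ∃ K : ℝ, 0 < K ∧ Tendsto (fun j : ℕ => x j * ((j : ℝ) + 1) ^ (σ / m + 1)) atTop (𝓝 K) := by
  have hQ0 : 0 ≤ Q := hq1.nonneg hq0
  obtain ⟨T, V, hT, hV, hTP, hTV, hTm⟩ := exists_inverse_tail hp0 hp1 hpd (hm ▸ hm0) haper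
  rw [← hm] at hTm
  set A := PowerSeries.mk x with hA
  set P := PowerSeries.mk p with hP
  set Qs := PowerSeries.mk q with hQs
  set D := X * derivative (R := ℝ) A with hD
  have hDc : ∀ n, coeff n D = n * x n := by
    intro n
    cases n with
    | zero => simp [hD]
    | succ n => rw [hD, coeff_succ_X_mul, coeff_derivative, hA, coeff_mk]; push_cast; ring
  -- The recursion as a differential equation for the generating function, with $D=zA'$ carrying the
  -- factors linear in the index.
  have hode : D + C (σ * (1 + Q)) * A = C σ * PowerSeries.mk r + D * P + C σ * (A * Qs) := by
    ext n
    simp only [map_add, coeff_C_mul]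
    simp only [coeff_mul, hDc, hA, hP, hQs, coeff_mk]
    have := hrec n
    rw [Finset.sum_add_distrib, ← Finset.mul_sum] at this
    linarith
  set H := C σ * V * (C (1 + Q) - Qs) with hH
  have hHd : ExpDecay H := ((ExpDecay.const σ).mul hV).mul ((ExpDecay.const _).sub hqd)
  -- Multiplication by $V=1/T$ reduces the leading coefficient $1-P$ to its simple zero $1-X$.
  have hode2 : (1 - X) * D + H * A = C σ * V * PowerSeries.mk r := by
    have h1 : (T * V) * ((1 - X) * D + H * A)
        = V * (((1 - X) * T) * D + C σ * (C (1 + Q) - Qs) * A * (T * V)) := by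
      rw [hH]; ring
    rw [hTV, hTP, one_mul, mul_one] at h1
    rw [h1]
    have h2 : C (σ * (1 + Q)) = C σ * C (1 + Q) := map_mul _ _ _
    rw [h2] at hode
    linear_combination V * hode
  set α : ℝ := σ / m with hα
  have hα0 : 0 < α := div_pos hσ hm0
  have hHt : ∑' n, coeff n H = α := by
    have h1 : (∑' n, coeff n T) * ∑' n, coeff n V = 1 := by
      rw [← hT.tsum_mul hV, hTV, ← map_one (C (R := ℝ)), ExpDecay.tsum_const]
    have h2 : ∑' n, coeff n (C (1 + Q) - Qs) = 1 := by
      simp only [map_sub]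
      rw [(ExpDecay.const (1 + Q)).summable.tsum_sub hqd.summable, ExpDecay.tsum_const]
      simp [hQs, hq1.tsum_eq]
    rw [hTm] at h1
    rw [hH, ((ExpDecay.const σ).mul hV).tsum_mul ((ExpDecay.const _).sub hqd), h2,
      (ExpDecay.const σ).tsum_mul hV, ExpDecay.tsum_const, hα]
    field_simp
    linarith
  set K := -(PowerSeries.mk fun k => ∑' i, coeff (i + (k + 1)) H) with hK
  have hKd : ExpDecay K := hHd.tail.neg
  have hHK : H = C α + (1 - X) * K := by
    have := hHd.one_sub_X_mul_tail
    rw [hHt] at this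
    rw [hK]
    linear_combination this
  set κ : ℝ := coeff 0 K with hκ
  set K₁ := PowerSeries.mk fun n => coeff (n + 1) K with hK₁
  -- As the derivative occurs as $XA'$, an integrating factor can remove only the part of $K$
  -- divisible by $X$. The constant $\kappa$ stays and merely shifts the index in the recursion.
  have hKs : K = C κ + X * K₁ := K.eq_C_add_X_mul_shift
  obtain ⟨E, F, hE, hF, hEF, hE'⟩ := hKd.shift.exists_integrating_factor
  set B := E * A with hB
  set S := E * (C σ * V * PowerSeries.mk r) with hS
  have hSd : ExpDecay S := hE.mul (((ExpDecay.const σ).mul hV).mul hrd)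
  have hode3 : (1 - X) * (X * derivative (R := ℝ) B) + C α * B + (1 - X) * (C κ * B) = S := by
    have h1 : derivative (R := ℝ) B = E * derivative (R := ℝ) A + A * (K₁ * E) := by
      rw [hB, Derivation.leibniz, hE']
      simp only [smul_eq_mul, hK₁]
    rw [hHK, hKs] at hode2
    rw [h1, hS, hB]
    rw [hD] at hode2
    linear_combination E * hode2
  have hbrec : ∀ n : ℕ, coeff (n + 1) B * ((n : ℝ) + 1 + α + κ)
      = coeff n B * (n + κ) + coeff (n + 1) S := by
    intro n
    have h1 := congrArg (coeff (n + 1)) hode3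
    have h2 : coeff n (X * derivative (R := ℝ) B) = n * coeff n B := by
      cases n with
      | zero => simp
      | succ n => rw [coeff_succ_X_mul, coeff_derivative]; push_cast; ring
    rw [sub_mul, sub_mul, one_mul, one_mul, map_add, map_add, map_sub, map_sub, coeff_succ_X_mul,
      coeff_succ_X_mul, coeff_succ_X_mul, h2, coeff_derivative, coeff_C_mul, coeff_C_mul,
      coeff_C_mul] at h1
    linarith
  -- $\kappa$ may be negative. Starting at index $J$ makes the parameter $a=J+\kappa$ positive,
  -- while $c-a=\alpha+1$ is unaffected.
  obtain ⟨J, hJ⟩ := exists_nat_gt (-κ)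
  have ha : 0 < (J : ℝ) + κ := by linarith
  have hshift : ∀ (f : PowerSeries ℝ), ExpDecay f → ∀ J : ℕ,
      ExpDecay (PowerSeries.mk fun n => coeff (n + J) f) := by
    intro f hf J
    induction J with
    | zero =>
      have e : (PowerSeries.mk fun n => coeff (n + 0) f) = f := by ext n; simp
      rw [e]
      exact hf
    | succ J ih =>
      have := ih.shift
      simp only [coeff_mk] at this
      have e : (PowerSeries.mk fun n => coeff (n + (J + 1)) f)
          = PowerSeries.mk fun n => coeff (n + 1 + J) f := by
        ext n
        rw [coeff_mk, coeff_mk, add_assoc, add_comm 1 J]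
      rw [e]
      exact this
  obtain ⟨w, hw, hw0⟩ := first_order_recursion (a := J + κ) (c := J + 1 + α + κ)
    (u := fun n => coeff (n + J) B) ha (by linarith) (hshift S hSd (J + 1)) (fun n => by
      have := hbrec (n + J)
      rw [coeff_mk]
      have e1 : n + (J + 1) = n + J + 1 := rfl
      have e2 : n + 1 + J = n + J + 1 := by omega
      push_cast at this
      rw [e1, e2]
      linear_combination this)
  have hexp : (J : ℝ) + 1 + α + κ - (J + κ) = α + 1 := by ring
  rw [hexp] at hw
  have hAB : A = F * B := by rw [hB, ← mul_assoc, mul_comm F E, hEF, one_mul]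
  have hnot : ¬ ExpDecay A := by
    refine not_expDecay_of_recursion (s := σ * (1 + Q)) (r := fun j => σ * r j)
      (by positivity) hp0 hp1 hpd hm hm0 (fun j => mul_nonneg hσ.le (hr0 j)) ?_ hx0 (fun j => ?_)
    · obtain ⟨j, hj, hrj⟩ := hrpos
      exact ⟨j, hj, mul_pos hσ hrj⟩
    · rw [hrec, Finset.sum_add_distrib]
      have : 0 ≤ ∑ kl ∈ Finset.HasAntidiagonal.antidiagonal j, σ * (x kl.1 * q kl.2) :=
        Finset.sum_nonneg (fun kl _ => mul_nonneg hσ.le (mul_nonneg (hx0 _) (hq0 _)))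
      linarith
  have hbt : Tendsto (fun n : ℕ => coeff n B * ((n : ℝ) + 1) ^ (α + 1)) atTop (𝓝 w) := by
    rw [← tendsto_add_atTop_iff_nat J]
    have h1 : Tendsto (fun n : ℕ => ((((n : ℝ) + J + 1) / ((n : ℝ) + 1)) ^ (α + 1))) atTop (𝓝 1) := by
      have h2 : Tendsto (fun n : ℕ => 1 + (J : ℝ) * (1 / ((n : ℝ) + 1))) atTop (𝓝 (1 + J * 0)) :=
        (tendsto_one_div_add_atTop_nhds_zero_nat.const_mul _).const_add _
      rw [mul_zero, add_zero] at h2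
      have h3 := h2.rpow_const (p := α + 1) (Or.inl one_ne_zero)
      rw [Real.one_rpow] at h3
      refine h3.congr (fun n => ?_)
      congr 1
      field_simp
      ring
    have h4 := hw.mul h1
    rw [mul_one] at h4
    refine h4.congr (fun n => ?_)
    rw [Real.div_rpow (by positivity) (by positivity)]
    push_cast
    field_simp
  have hxt := hF.tendsto_mul (by linarith : 0 ≤ α + 1) hbt
  rw [← hAB] at hxt
  simp only [hA, coeff_mk] at hxt
  refine ⟨_, lt_of_le_of_ne ?_ (Ne.symm ?_), hxt⟩
  · exact ge_of_tendsto' hxt (fun n => mul_nonneg (hx0 n) (by positivity))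
  · refine mul_ne_zero ?_ ?_
    -- $F(1)\ne0$, since $E(1)F(1)=1$.
    · intro h0
      have h1 := hE.tsum_mul hF
      rw [hEF, h0, mul_zero, ← map_one (C (R := ℝ)), ExpDecay.tsum_const] at h1
      exact one_ne_zero h1
    -- If $w=0$, the shifted $B$ decays exponentially. Enlarging the constant for the first $J$
    -- coefficients shows that $B$, and hence $A=FB$, does too.
    · intro hw1
      refine hnot (hAB ▸ hF.mul ?_)
      have h1 := (hw0 hw1).bound
      obtain ⟨M, ρ, hM, hρ, hρ1, hb⟩ := h1
      refine ExpDecay.of_bound (C := (∑ i ∈ Finset.range J, |coeff i B| / ρ ^ i) + M / ρ ^ J)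
        hρ.le hρ1 (fun n => ?_)
      have hsn : 0 ≤ ∑ i ∈ Finset.range J, |coeff i B| / ρ ^ i :=
        Finset.sum_nonneg (fun i _ => by positivity)
      rcases Nat.lt_or_ge n J with hn | hn
      · have h2 : |coeff n B| / ρ ^ n ≤ ∑ i ∈ Finset.range J, |coeff i B| / ρ ^ i :=
          Finset.single_le_sum (f := fun i => |coeff i B| / ρ ^ i) (fun i _ => by positivity)
            (Finset.mem_range.2 hn)
        rw [← div_le_iff₀ (by positivity)]
        have : 0 ≤ M / ρ ^ J := by positivity
        linarith
      · have h2 := hb (n - J)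
        rw [coeff_mk, Nat.sub_add_cancel hn] at h2
        refine h2.trans ?_
        have h3 : M * ρ ^ (n - J) = M / ρ ^ J * ρ ^ n := by
          have : ρ ^ n = ρ ^ (n - J) * ρ ^ J := by rw [← pow_add, Nat.sub_add_cancel hn]
          rw [this]; field_simp
        rw [h3]
        gcongr
        linarith

/-! ### Martingale strong laws and stochastic approximation. -/

/-- Kronecker's lemma: by Abel summation the average is the difference between the partial sum and
the Cesàro mean of partial sums, which have the same limit. -/
lemma tendsto_average_of_tendsto_sum_div {d : ℕ → ℝ} {l : ℝ}
    (h : Tendsto (fun n => ∑ k ∈ Finset.range n, d k / ((k : ℝ) + 1)) atTop (𝓝 l)) :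
    Tendsto (fun n : ℕ => (∑ k ∈ Finset.range n, d k) / (n : ℝ)) atTop (𝓝 0) := by
  set T : ℕ → ℝ := fun n => ∑ k ∈ Finset.range n, d k / ((k : ℝ) + 1) with hT
  have habel : ∀ n : ℕ, ∑ k ∈ Finset.range n, d k = n * T n - ∑ k ∈ Finset.range n, T k := by
    intro n
    induction n with
    | zero => simp
    | succ n ih =>
      rw [Finset.sum_range_succ, Finset.sum_range_succ, ih]
      have h1 : T (n + 1) = T n + d n / ((n : ℝ) + 1) := Finset.sum_range_succ _ _
      have h2 : d n = ((n : ℝ) + 1) * (d n / ((n : ℝ) + 1)) := by field_simp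
      rw [h1]
      push_cast
      linarith
  have h2 := h.sub h.cesaro
  rw [sub_self] at h2
  refine h2.congr' ?_
  filter_upwards [eventually_gt_atTop 0] with n hn
  have hn' : (0 : ℝ) < n := by exact_mod_cast hn
  rw [habel]
  change T n - (n : ℝ)⁻¹ * ∑ k ∈ Finset.range n, T k = _
  field_simp

section

variable {Ω : Type*} {m0 : MeasurableSpace Ω} {μ : Measure Ω} [IsProbabilityMeasure μ]
  {ℱ : Filtration ℕ m0} {d : ℕ → Ω → ℝ}

lemma integral_mul_eq_zero_of_condExp {m : MeasurableSpace Ω} (hm : m ≤ m0) {f g : Ω → ℝ}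
    (hf : StronglyMeasurable[m] f) (hf2 : MemLp f 2 μ) (hg2 : MemLp g 2 μ)
    (hg : μ[g | m] =ᵐ[μ] 0) : ∫ ω, f ω * g ω ∂μ = 0 := by
  have h1 : Integrable (f * g) μ := hf2.integrable_mul hg2
  have h2 := condExp_mul_of_stronglyMeasurable_left hf h1 (hg2.integrable (by norm_num))
  have h3 : ∫ ω, (f * g) ω ∂μ = ∫ ω, (μ[f * g | m]) ω ∂μ := (integral_condExp hm).symm
  have h4 : μ[f * g | m] =ᵐ[μ] 0 := by
    filter_upwards [h2, hg] with ω h hg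
    rw [h, Pi.mul_apply, hg, Pi.zero_apply, mul_zero]
  rw [integral_congr_ae h4] at h3
  simpa using h3

/-- The strong law of large numbers for square integrable martingale differences. -/
theorem ae_tendsto_average_of_martingale_difference
    (hadp : ∀ n, StronglyMeasurable[ℱ (n + 1)] (d n)) (hd2 : ∀ n, MemLp (d n) 2 μ)
    (hd0 : ∀ n, μ[d n | ℱ n] =ᵐ[μ] 0)
    (hsum : Summable fun n : ℕ => (∫ ω, d n ω ^ 2 ∂μ) / ((n : ℝ) + 1) ^ 2) :
    ∀ᵐ ω ∂μ, Tendsto (fun n : ℕ => (∑ k ∈ Finset.range n, d k ω) / (n : ℝ)) atTop (𝓝 0) := by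
  -- A martingale with orthogonal increments. The summability hypothesis bounds it in $L^2$, hence
  -- in $L^1$ via $|T|\le1+T^2$, so it converges almost surely; Kronecker's lemma finishes.
  set T : ℕ → Ω → ℝ := fun n ω => ∑ k ∈ Finset.range n, d k ω / ((k : ℝ) + 1) with hT
  have hTs : ∀ n, T (n + 1) = fun ω => T n ω + d n ω / ((n : ℝ) + 1) := by
    intro n; funext ω; exact Finset.sum_range_succ _ _
  have hTadp : ∀ n, StronglyMeasurable[ℱ n] (T n) := by
    intro n
    induction n with
    | zero => simpa [hT] using stronglyMeasurable_const
    | succ n ih =>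
      rw [hTs]
      simp only [div_eq_mul_inv]
      exact (ih.mono (ℱ.mono n.le_succ)).add ((hadp n).mul_const _)
  have hd2' : ∀ n, MemLp (fun ω => d n ω / ((n : ℝ) + 1)) 2 μ := fun n => by
    simpa only [div_eq_mul_inv] using (hd2 n).mul_const (((n : ℝ) + 1)⁻¹)
  have hT2 : ∀ n, MemLp (T n) 2 μ := by
    intro n
    induction n with
    | zero => simp [hT]
    | succ n ih => rw [hTs]; exact ih.add (hd2' n)
  have hd0' : ∀ n, μ[fun ω => d n ω / ((n : ℝ) + 1) | ℱ n] =ᵐ[μ] 0 := by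
    intro n
    have h1 : (fun ω => d n ω / ((n : ℝ) + 1)) = (((n : ℝ) + 1)⁻¹) • d n := by
      funext ω; simp [div_eq_inv_mul]
    rw [h1]
    filter_upwards [condExp_smul (μ := μ) (((n : ℝ) + 1)⁻¹) (d n) (ℱ n), hd0 n] with ω h2 h3
    rw [h2, Pi.smul_apply, h3]
    simp
  have hmart : Martingale T ℱ μ := by
    refine martingale_of_condExp_sub_eq_zero_nat hTadp (fun n => (hT2 n).integrable (by norm_num))
      (fun n => ?_)
    have : T (n + 1) - T n = fun ω => d n ω / ((n : ℝ) + 1) := by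
      rw [hTs]; funext ω; simp
    rw [this]
    exact hd0' n
  have hsq : ∀ n, ∫ ω, T n ω ^ 2 ∂μ
      = ∑ k ∈ Finset.range n, (∫ ω, d k ω ^ 2 ∂μ) / ((k : ℝ) + 1) ^ 2 := by
    intro n
    induction n with
    | zero => simp [hT]
    | succ n ih =>
      rw [Finset.sum_range_succ, ← ih, hTs]
      have h1 : ∀ ω, (T n ω + d n ω / ((n : ℝ) + 1)) ^ 2
          = (T n ω ^ 2 + 2 * (T n ω * (d n ω / ((n : ℝ) + 1)))) + (d n ω / ((n : ℝ) + 1)) ^ 2 :=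
        fun ω => by ring
      have hm : Integrable (fun ω => T n ω * (d n ω / ((n : ℝ) + 1))) μ :=
        (hT2 n).integrable_mul (hd2' n)
      simp only [h1]
      have h2 := (hT2 n).integrable_sq.add (hm.const_mul 2)
      rw [integral_add (f := fun ω => T n ω ^ 2 + 2 * (T n ω * (d n ω / ((n : ℝ) + 1)))) h2
        (hd2' n).integrable_sq, integral_add (hT2 n).integrable_sq (hm.const_mul 2), integral_const_mul,
        integral_mul_eq_zero_of_condExp (ℱ.le n) (hTadp n) (hT2 n) (hd2' n) (hd0' n)]
      simp only [div_pow, integral_div]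
      ring
  set V := ∑' n : ℕ, (∫ ω, d n ω ^ 2 ∂μ) / ((n : ℝ) + 1) ^ 2
  have hbdd : ∀ n, eLpNorm (T n) 1 μ ≤ (Real.toNNReal (1 + V)) := by
    intro n
    rw [eLpNorm_one_eq_lintegral_enorm,
      ← ofReal_integral_norm_eq_lintegral_enorm ((hT2 n).integrable (by norm_num))]
    refine ENNReal.ofReal_le_ofReal ?_
    calc ∫ ω, ‖T n ω‖ ∂μ ≤ ∫ ω, (1 + T n ω ^ 2) ∂μ := by
          refine integral_mono ((hT2 n).integrable (by norm_num)).norm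
            ((integrable_const _).add (hT2 n).integrable_sq) (fun ω => ?_)
          dsimp only
          rw [Real.norm_eq_abs]
          nlinarith [sq_nonneg (|T n ω| - 1), sq_abs (T n ω), abs_nonneg (T n ω)]
      _ = 1 + ∫ ω, T n ω ^ 2 ∂μ := by
          rw [integral_add (integrable_const _) (hT2 n).integrable_sq]; simp
      _ ≤ 1 + V := by
          rw [hsq]
          gcongr
          exact hsum.sum_le_tsum _ (fun k _ => by positivity)
  filter_upwards [hmart.submartingale.exists_ae_tendsto_of_bdd hbdd] with ω ⟨c, hc⟩
  exact tendsto_average_of_tendsto_sum_div hc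

/-- The averages of square integrable random variables and those of their conditional expectations
are asymptotically equal. -/
theorem ae_tendsto_average_sub_condExp
    (hadp : ∀ n, StronglyMeasurable[ℱ (n + 1)] (d n)) (hd2 : ∀ n, MemLp (d n) 2 μ)
    (hsum : Summable fun n : ℕ => (∫ ω, d n ω ^ 2 ∂μ) / ((n : ℝ) + 1) ^ 2) :
    ∀ᵐ ω ∂μ, Tendsto (fun n : ℕ => (∑ k ∈ Finset.range n, (d k ω - (μ[d k | ℱ k]) ω)) / (n : ℝ))
      atTop (𝓝 0) := by
  have hc2 : ∀ n, MemLp (d n - μ[d n | ℱ n]) 2 μ := fun n => (hd2 n).sub ((hd2 n).condExp (by norm_num))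
  refine ae_tendsto_average_of_martingale_difference (ℱ := ℱ) (d := fun n => d n - μ[d n | ℱ n])
    (fun n => (hadp n).sub (stronglyMeasurable_condExp.mono (ℱ.mono n.le_succ))) hc2
    (fun n => ?_) (hsum.of_nonneg_of_le (fun n => ?_) (fun n => ?_))
  · refine (condExp_sub ((hd2 n).integrable (by norm_num)) integrable_condExp _).trans ?_
    rw [condExp_of_stronglyMeasurable (ℱ.le n) stronglyMeasurable_condExp integrable_condExp]
    simp
  · exact div_nonneg (integral_nonneg (fun ω => sq_nonneg _)) (by positivity)
  · refine div_le_div_of_nonneg_right ?_ (by positivity)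
    have h1 := condVar_ae_le_condExp_sq (ℱ.le n) (hd2 n)
    have h2 := integral_mono_ae integrable_condVar integrable_condExp h1
    rw [integral_condExp (ℱ.le n)] at h2
    simp only [condVar] at h2
    rw [integral_condExp (ℱ.le n)] at h2
    exact h2

end

/-- A deterministic stochastic approximation lemma. -/
lemma tendsto_div_of_recursion {u a b d : ℕ → ℝ} {A B : ℝ}
    (hu : ∀ᶠ n : ℕ in atTop, u (n + 1) = u n + a n - b n * (u n / n) + d n)
    (ha : Tendsto a atTop (𝓝 A)) (hb : Tendsto b atTop (𝓝 B)) (hb0 : ∀ᶠ n in atTop, 0 ≤ b n)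
    (hd : Tendsto (fun n : ℕ => (∑ k ∈ Finset.range n, d k) / (n : ℝ)) atTop (𝓝 0)) :
    Tendsto (fun n : ℕ => u n / n) atTop (𝓝 (A / (1 + B))) := by
  have hB : 0 ≤ B := ge_of_tendsto hb hb0
  set y := A / (1 + B) with hy
  set S : ℕ → ℝ := fun n => ∑ k ∈ Finset.range n, d k with hS
  -- Subtract the accumulated noise and the expected linear growth, where $y$ solves $A-By=y$. The
  -- rest obeys $w_{n+1}=(1-b_n/n)w_n+\varepsilon_n$ with $\varepsilon_n\to0$.
  set w : ℕ → ℝ := fun n => u n - S n - n * y with hw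
  set ε : ℕ → ℝ := fun n => a n - b n * (S n / n) - b n * y - y with hε
  have hε0 : Tendsto ε atTop (𝓝 0) := by
    have h1 := ((ha.sub (hb.mul hd)).sub (hb.mul_const y)).sub_const y
    have h2 : A - B * 0 - B * y - y = 0 := by
      rw [hy]; field_simp; ring
    rw [h2] at h1
    exact h1
  have hstep : ∀ᶠ n : ℕ in atTop, |w (n + 1)| ≤ |w n| + |ε n| := by
    filter_upwards [hu, hb0, hb.eventually (gt_mem_nhds (lt_add_one B)),
      eventually_ge_atTop (⌈B + 1⌉₊ + 1)] with n h1 h2 h3 h4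
    -- From here on $b_n<n$, so the factor $1-b_n/n$ lies in $[0,1]$ and $|w|$ grows by at most
    -- $|\varepsilon_n|$.
    have hn : B + 1 ≤ n := (Nat.le_ceil _).trans (by exact_mod_cast (by omega))
    have hn0 : (0 : ℝ) < n := by linarith
    have h5 : w (n + 1) = (1 - b n / n) * w n + ε n := by
      have h6 : S (n + 1) = S n + d n := Finset.sum_range_succ _ _
      simp only [hw, hε, h1, h6]
      push_cast
      field_simp
      ring
    rw [h5]
    refine (abs_add_le _ _).trans ?_
    refine add_le_add_left ?_ _
    rw [abs_mul]
    refine mul_le_of_le_one_left (abs_nonneg _) ?_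
    have h7 : b n / n ≤ 1 := (div_le_one hn0).2 (by linarith)
    have h8 : 0 ≤ b n / n := by positivity
    rw [abs_of_nonneg (by linarith)]
    linarith
  obtain ⟨N, hN⟩ := eventually_atTop.1 hstep
  have hbound : ∀ n, N ≤ n → |w n| ≤ |w N| + ∑ k ∈ Finset.range n, |ε k| := by
    intro n hn
    induction n, hn using Nat.le_induction with
    | base => simpa using Finset.sum_nonneg (fun k _ => abs_nonneg (ε k))
    | succ n hn ih =>
      rw [Finset.sum_range_succ]
      linarith [hN n hn]
  have hw0 : Tendsto (fun n : ℕ => w n / n) atTop (𝓝 0) := by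
    have h1 : Tendsto (fun n : ℕ => |w N| / n + (n : ℝ)⁻¹ * ∑ k ∈ Finset.range n, |ε k|) atTop
        (𝓝 (0 + 0)) :=
      (tendsto_const_div_atTop_nhds_zero_nat _).add (by simpa using hε0.abs.cesaro)
    rw [add_zero] at h1
    refine squeeze_zero_norm' ?_ h1
    filter_upwards [eventually_ge_atTop N] with n hn
    rw [Real.norm_eq_abs, abs_div, Nat.abs_cast]
    calc |w n| / n ≤ (|w N| + ∑ k ∈ Finset.range n, |ε k|) / n := by
          gcongr; exact hbound n hn
      _ = _ := by rw [add_div]; ring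
  have h2 := (hw0.add hd).add_const y
  simp only [zero_add] at h2
  refine h2.congr' ?_
  filter_upwards [eventually_gt_atTop 0] with n hn
  have hn' : (n : ℝ) ≠ 0 := by exact_mod_cast hn.ne'
  simp only [hw]
  change (u n - S n - n * y) / n + S n / n + y = _
  field_simp
  ring

/-! ### Weighted random subsets. -/

/-- Summation over a finite set through the ranks of its elements. -/
lemma Finset.sum_card_filter_le {β : Type*} [AddCommMonoid β] (A : Finset ℕ) (h : ℕ → β) :
    ∑ i ∈ A, h (A.filter (fun k => k ≤ i)).card = ∑ l ∈ Finset.Icc 1 A.card, h l := by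
  induction A using Finset.induction_on_max with
  | empty => simp
  | insert a s hs ih =>
    have ha : a ∉ s := fun h => lt_irrefl _ (hs a h)
    rw [Finset.sum_insert ha, Finset.card_insert_of_notMem ha, Finset.sum_Icc_succ_top (by omega),
      ← ih, add_comm]
    congr 1
    · refine Finset.sum_congr rfl (fun i hi => ?_)
      rw [Finset.filter_insert, if_neg (by have := hs i hi; omega)]
    · rw [Finset.filter_insert, if_pos le_rfl, Finset.filter_true_of_mem (fun i hi => (hs i hi).le),
        Finset.card_insert_of_notMem ha]

lemma Finset.sum_powersetCard_filter_mem {α : Type*} [DecidableEq α] {s : Finset α}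
    {i : α} (hi : i ∈ s) (k : ℕ) (h : Finset α → ℝ) :
    ∑ B ∈ (s.powersetCard (k + 1)).filter (fun B => i ∈ B), h B
      = ∑ B ∈ (s.erase i).powersetCard k, h (insert i B) := by
  symm
  refine Finset.sum_bij' (fun B _ => insert i B) (fun B _ => B.erase i) ?_ ?_ ?_ ?_ ?_
  · intro B hB
    rw [Finset.mem_powersetCard] at hB
    have hiB : i ∉ B := fun h => by simpa using hB.1 h
    rw [Finset.mem_filter, Finset.mem_powersetCard, Finset.card_insert_of_notMem hiB, hB.2]
    exact ⟨⟨Finset.insert_subset hi (hB.1.trans (Finset.erase_subset _ _)), rfl⟩,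
      Finset.mem_insert_self _ _⟩
  · intro B hB
    rw [Finset.mem_filter, Finset.mem_powersetCard] at hB
    rw [Finset.mem_powersetCard, Finset.card_erase_of_mem hB.2, hB.1.2]
    exact ⟨Finset.erase_subset_erase _ hB.1.1, rfl⟩
  · intro B hB
    rw [Finset.mem_powersetCard] at hB
    exact Finset.erase_insert (fun h => by simpa using hB.1 h)
  · intro B hB
    rw [Finset.mem_filter] at hB
    exact Finset.insert_erase hB.2
  · intro B hB
    rfl

/-- Double counting: for $k\ge1$ every element of `s` lies in $\binom{|s|-1}{k-1}$ of the
$k$-subsets. The factor $|s|$ avoids a division and covers $k=0$. -/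
lemma Finset.sum_powersetCard_sum {α : Type*} [DecidableEq α] (s : Finset α) (k : ℕ) (w : α → ℝ) :
    (s.card : ℝ) * ∑ B ∈ s.powersetCard k, ∑ j ∈ B, w j = k * s.card.choose k * ∑ j ∈ s, w j := by
  cases k with
  | zero => simp
  | succ k =>
    have h1 : ∑ B ∈ s.powersetCard (k + 1), ∑ j ∈ B, w j
        = ∑ j ∈ s, ∑ B ∈ (s.powersetCard (k + 1)).filter (fun B => j ∈ B), w j := by
      rw [Finset.sum_comm' (t' := s) (s' := fun j => (s.powersetCard (k + 1)).filter (fun B => j ∈ B))]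
      intro B j
      rw [Finset.mem_filter]
      constructor
      · rintro ⟨h1, h2⟩
        exact ⟨⟨h1, h2⟩, (Finset.mem_powersetCard.1 h1).1 h2⟩
      · rintro ⟨⟨h1, h2⟩, -⟩
        exact ⟨h1, h2⟩
    have h2 : ∀ j ∈ s, ∑ B ∈ (s.powersetCard (k + 1)).filter (fun B => j ∈ B), w j
        = ((s.card - 1).choose k : ℝ) * w j := by
      intro j hj
      rw [Finset.sum_powersetCard_filter_mem hj k (fun _ => w j), Finset.sum_const,
        Finset.card_powersetCard, Finset.card_erase_of_mem hj, nsmul_eq_mul]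
    rw [h1, Finset.sum_congr rfl h2, ← Finset.mul_sum, ← mul_assoc]
    rcases Nat.eq_zero_or_pos s.card with h0 | h0
    · rw [Finset.card_eq_zero.1 h0]; simp
    · congr 1
      obtain ⟨c, hc⟩ : ∃ c, s.card = c + 1 := ⟨s.card - 1, by omega⟩
      rw [hc, Nat.add_sub_cancel]
      have := Nat.add_one_mul_choose_eq c k
      rw [mul_comm ((k + 1 : ℕ) : ℝ)]
      exact_mod_cast this

/-- If a `k`-element subset of a finite set is selected with probability proportional to its
weight, then this is the probability that a given element is selected. -/
lemma Finset.sum_filter_mem_div {s : Finset ℕ} {n : ℕ} (hn : 1 ≤ n) (hs : s.card = n + 1)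
    {i : ℕ} (hi : i ∈ s) {k : ℕ} (hk : k ≤ n) (w : ℕ → ℝ) (hw : 0 < ∑ j ∈ s, w j) :
    (∑ A ∈ (s.powersetCard (k + 1)).filter (fun A => i ∈ A),
      (∑ j ∈ A, w j) / ∑ B ∈ s.powersetCard (k + 1), ∑ j ∈ B, w j)
      = w i / (∑ j ∈ s, w j) + k * ((1 - w i / ∑ j ∈ s, w j) / n) := by
  have hn0 : (0 : ℝ) < n := by exact_mod_cast hn
  have hch : (0 : ℝ) < n.choose k := by exact_mod_cast Nat.choose_pos hk
  set S := ∑ j ∈ s, w j with hS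
  have h1 : ∑ B ∈ s.powersetCard (k + 1), ∑ j ∈ B, w j = n.choose k * S := by
    have h := Finset.sum_powersetCard_sum s (k + 1) w
    have h2 := Nat.add_one_mul_choose_eq n k
    have h3 : ((n : ℝ) + 1) * n.choose k = (n + 1).choose (k + 1) * (k + 1) := by exact_mod_cast h2
    rw [hs] at h
    push_cast at h
    have h4 : ((n : ℝ) + 1) * ∑ B ∈ s.powersetCard (k + 1), ∑ j ∈ B, w j
        = ((n : ℝ) + 1) * (n.choose k * S) := by
      rw [h, ← mul_assoc, h3]; ring
    exact mul_left_cancel₀ (by positivity) h4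
  have hcard : (s.erase i).card = n := by rw [Finset.card_erase_of_mem hi, hs, Nat.add_sub_cancel]
  have h2 : ∑ A ∈ (s.powersetCard (k + 1)).filter (fun A => i ∈ A), ∑ j ∈ A, w j
      = n.choose k * w i + k / n * (n.choose k * (S - w i)) := by
    rw [Finset.sum_powersetCard_filter_mem hi]
    have h3 : ∀ B ∈ (s.erase i).powersetCard k, ∑ j ∈ insert i B, w j = w i + ∑ j ∈ B, w j := by
      intro B hB
      rw [Finset.mem_powersetCard] at hB
      exact Finset.sum_insert (fun h => by simpa using hB.1 h)
    rw [Finset.sum_congr rfl h3, Finset.sum_add_distrib, Finset.sum_const,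
      Finset.card_powersetCard, hcard, nsmul_eq_mul]
    congr 1
    have h4 := Finset.sum_powersetCard_sum (s.erase i) k w
    have h5 : ∑ j ∈ s.erase i, w j = S - w i := by
      rw [hS, ← Finset.add_sum_erase s w hi]; ring
    rw [hcard, h5] at h4
    field_simp
    linarith
  rw [← Finset.sum_div, h2, h1]
  field_simp

/-! ### Measurability of weights and bonuses. -/

/-- The model makes only the level sets of the group of authors measurable, so expressions indexed
by the group are split over its countably many values. -/
lemma measurable_of_countable_param {Ω ι β : Type*} [Countable ι] {m : MeasurableSpace Ω}
    [MeasurableSpace β] {G : Ω → ι} (hG : ∀ a, MeasurableSet {ω | G ω = a}) {F : ι → Ω → β}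
    (hF : ∀ a, Measurable (F a)) : Measurable fun ω => F (G ω) ω := by
  intro s hs
  have : (fun ω => F (G ω) ω) ⁻¹' s = ⋃ a, {ω | G ω = a} ∩ F a ⁻¹' s := by
    ext ω; simp
  rw [this]
  exact MeasurableSet.iUnion (fun a => (hG a).inter (hF a hs))

namespace PublicationProcess

variable {Ω : Type*} {M : PublicationProcess Ω}

/-- The bonus of researcher `i` in step `m`. -/
def bonus (M : PublicationProcess Ω) (m i : ℕ) (ω : Ω) : ℕ :=
  if i ∈ M.G m ω then M.Y m ((M.G m ω).filter (fun k => k ≤ i)).card ω else 0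

lemma W_succ (n i : ℕ) (ω : Ω) : M.W (n + 1) i ω = M.W n i ω + M.bonus (n + 1) i ω := by
  rw [W, W, Finset.sum_Icc_succ_top (by omega), bonus, add_assoc]

lemma past_mono (M : PublicationProcess Ω) : Monotone M.past := by
  intro n m h
  refine sup_le_sup ?_ ?_
  · exact biSup_mono (fun i hi => Finset.range_subset_range.2 (by omega) hi)
  · exact biSup_mono (fun i hi => Finset.Icc_subset_Icc_right h hi)

lemma measurable_X_past {i n : ℕ} (h : i ≤ n) : Measurable[M.past n] (M.X i) := by
  refine Measurable.of_comap_le (le_trans ?_ le_sup_left)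
  exact le_biSup (fun i => MeasurableSpace.comap (M.X i) ⊤) (Finset.mem_range.2 (by omega))

lemma bonusSigma_le_past {m n : ℕ} (h1 : 1 ≤ m) (h2 : m ≤ n) : M.bonusSigma m ≤ M.past n :=
  le_trans (le_trans le_sup_left
    (le_biSup (fun m => M.bonusSigma m ⊔ MeasurableSpace.comap (M.G m) ⊤)
      (Finset.mem_Icc.2 ⟨h1, h2⟩))) le_sup_right

lemma measurableSet_G_past {m n : ℕ} (h1 : 1 ≤ m) (h2 : m ≤ n) (A : Finset ℕ) :
    MeasurableSet[M.past n] {ω | M.G m ω = A} := by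
  have h : MeasurableSpace.comap (M.G m) ⊤ ≤ M.past n :=
    le_trans (le_trans le_sup_right
      (le_biSup (fun m => M.bonusSigma m ⊔ MeasurableSpace.comap (M.G m) ⊤)
        (Finset.mem_Icc.2 ⟨h1, h2⟩))) le_sup_right
  exact h _ ⟨{A}, trivial, rfl⟩

lemma measurable_ν_bonusSigma (n : ℕ) : Measurable[M.bonusSigma n] (M.ν n) :=
  Measurable.of_comap_le le_sup_left

lemma measurable_Y_bonusSigma (n l : ℕ) : Measurable[M.bonusSigma n] (M.Y n l) :=
  Measurable.of_comap_le
    ((le_iSup (fun l => MeasurableSpace.comap (M.Y n l) ⊤) l).trans le_sup_right)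

lemma measurable_bonus_of {m : ℕ} {σ : MeasurableSpace Ω}
    (hG : ∀ A, MeasurableSet[σ] {ω | M.G m ω = A}) (hY : ∀ l, Measurable[σ] (M.Y m l)) (i : ℕ) :
    Measurable[σ] (M.bonus m i) := by
  refine measurable_of_countable_param (G := M.G m) hG
    (F := fun A ω => if i ∈ A then M.Y m (A.filter (fun k => k ≤ i)).card ω else 0) (fun A => ?_)
  by_cases h : i ∈ A
  · simpa [h] using hY _
  · simp [h]

lemma measurable_bonus_past {m n : ℕ} (h1 : 1 ≤ m) (h2 : m ≤ n) (i : ℕ) :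
    Measurable[M.past n] (M.bonus m i) :=
  measurable_bonus_of (measurableSet_G_past h1 h2)
    (fun l => (measurable_Y_bonusSigma m l).mono (bonusSigma_le_past h1 h2) le_rfl) i

lemma measurable_W_past {n i : ℕ} (hi : i ≤ n) : Measurable[M.past n] (M.W n i) := by
  refine (measurable_X_past hi).add (Finset.measurable_sum _ (fun m hm => ?_))
  exact measurable_bonus_past (Finset.mem_Icc.1 hm).1 (Finset.mem_Icc.1 hm).2 i

lemma measurable_S_past (n : ℕ) : Measurable[M.past n] (M.S n) :=
  Finset.measurable_sum _ (fun i hi => measurable_W_past (by simpa [Nat.lt_succ_iff] using hi))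

lemma measurable_groupWeight_past {n : ℕ} {A : Finset ℕ} (hA : A ⊆ Finset.range (n + 1)) :
    Measurable[M.past n] (M.groupWeight n A) :=
  Finset.measurable_sum _ (fun i hi => measurable_W_past
    (by simpa [Nat.lt_succ_iff] using hA hi))

namespace IsModel

variable [mΩ : MeasurableSpace Ω] {μ : Measure Ω}

lemma bonusSigma_le (hM : M.IsModel μ) (n : ℕ) : M.bonusSigma n ≤ mΩ :=
  sup_le (hM.measurable_ν n).comap_le (iSup_le (fun l => (hM.measurable_Y n l).comap_le))

lemma past_le (hM : M.IsModel μ) (n : ℕ) : M.past n ≤ mΩ := by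
  refine sup_le (iSup₂_le (fun i _ => (hM.measurable_X i).comap_le))
    (iSup₂_le (fun m _ => sup_le (hM.bonusSigma_le m) ?_))
  let : MeasurableSpace (Finset ℕ) := ⊤
  exact Measurable.comap_le (measurable_to_countable' (fun A => hM.measurable_G m A))

end IsModel

end PublicationProcess

/-! ### Conditional law of the bonus of one researcher. -/

namespace PublicationProcess

variable {Ω Ω' : Type*} [mΩ : MeasurableSpace Ω] {μ : Measure Ω} [IsProbabilityMeasure μ]
  {M : PublicationProcess Ω} [MeasurableSpace Ω'] {μ' : Measure Ω'} [IsProbabilityMeasure μ']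
  {ν' Y' Z' : Ω' → ℕ}

/-- Exchangeability under the transposition of $1$ and $r$: an author's rank in the group does not
affect the law of the bonus. -/
lemma Assumptions.integral_exchange (hM : M.IsModel μ) (hA : M.Assumptions μ μ' ν' Y' Z')
    {n k r : ℕ} (hn : 1 ≤ n) (hr : r ∈ Finset.Icc 1 k) (f : ℕ → ℝ) :
    ∫ ω, (if M.ν n ω = k then f (M.Y n r ω) else 0) ∂μ
      = ∫ ω, (if M.ν n ω = k then f (M.Y n 1 ω) else 0) ∂μ := by
  have hs : MeasurableSet {ω | M.ν n ω = k} := hM.measurable_ν n (measurableSet_singleton k)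
  have hind : ∀ l : ℕ, ∫ ω, (if M.ν n ω = k then f (M.Y n l ω) else 0) ∂μ
      = ∫ ω in {ω | M.ν n ω = k}, f (M.Y n l ω) ∂μ := by
    intro l
    rw [← integral_indicator hs]
    refine integral_congr_ae (Eventually.of_forall fun ω => ?_)
    simp [Set.indicator_apply]
  rw [hind, hind]
  by_cases h0 : μ {ω | M.ν n ω = k} = 0
  · rw [Measure.restrict_eq_zero.2 h0]
    simp
  rw [Finset.mem_Icc] at hr
  have hperm : ∀ l, l ∉ Finset.Icc 1 k → Equiv.swap 1 r l = l := by
    intro l hl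
    refine Equiv.swap_apply_of_ne_of_ne ?_ ?_ <;> rintro rfl <;>
      exact hl (Finset.mem_Icc.2 (by omega))
  have h1 := (hA.exchangeable n k hn h0 (Equiv.swap 1 r) hperm).comp
    (u := fun y : ℕ → ℕ => f (y 1))
    ((measurable_from_top (f := f)).comp (measurable_pi_apply 1))
  have h2 := h1.integral_eq
  simp only [Function.comp_def, Equiv.swap_apply_left, ProbabilityTheory.cond,
    integral_smul_measure] at h2
  have h3 : (μ {ω | M.ν n ω = k})⁻¹.toReal ≠ 0 := by
    rw [ENNReal.toReal_inv]
    exact inv_ne_zero (ENNReal.toReal_ne_zero.2 ⟨h0, measure_ne_top _ _⟩)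
  exact smul_right_injective ℝ h3 h2

/-- The conditional expectation of a function of the bonus on the event that a given group is
selected. -/
lemma Assumptions.condExp_group (hM : M.IsModel μ) (hA : M.Assumptions μ μ' ν' Y' Z')
    {n i : ℕ} {A : Finset ℕ} (hAr : A ⊆ Finset.range (n + 1)) (hi : i ∈ A) {f : ℕ → ℝ}
    (hf : ∀ y, |f y| ≤ 1) :
    μ[fun ω => if 0 < M.S n ω ∧ M.G (n + 1) ω = A then f (M.bonus (n + 1) i ω) else 0 | M.past n]
      =ᵐ[μ] fun ω => (if 0 < M.S n ω then (M.groupWeight n A ω : ℝ) /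
          ∑ B ∈ (Finset.range (n + 1)).powersetCard A.card, (M.groupWeight n B ω : ℝ) else 0) *
        ∫ ω, (if M.ν (n + 1) ω = A.card then f (M.Y (n + 1) 1 ω) else 0) ∂μ := by
  set r := (A.filter (fun k => k ≤ i)).card with hr
  have hrk : r ∈ Finset.Icc 1 A.card := by
    refine Finset.mem_Icc.2 ⟨Finset.card_pos.2 ⟨i, by simp [hi]⟩, Finset.card_filter_le _ _⟩
  have hple := hM.past_le n
  have hble := hM.bonusSigma_le (n + 1)
  have hGle : (M.past n ⊔ M.bonusSigma (n + 1)) ≤ mΩ := sup_le hple hble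
  set I : Ω → ℝ := Set.indicator {ω | M.G (n + 1) ω = A} (fun _ => (1 : ℝ)) with hI
  set ψ : Ω → ℝ := fun ω => if M.ν (n + 1) ω = A.card then f (M.Y (n + 1) r ω) else 0 with hψ
  -- The selection rule prescribes nothing at zero total weight, hence this cut-off.
  set θ : Ω → ℝ := fun ω => if 0 < M.S n ω then 1 else 0 with hθ
  set H : Ω → ℝ := fun ω => if 0 < M.S n ω then (M.groupWeight n A ω : ℝ) /
    ∑ B ∈ (Finset.range (n + 1)).powersetCard A.card, (M.groupWeight n B ω : ℝ) else 0 with hH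
  have hSset : MeasurableSet[M.past n] {ω | 0 < M.S n ω} :=
    measurable_S_past n (measurableSet_Ioi (a := 0))
  have hψm : Measurable[M.bonusSigma (n + 1)] ψ := by
    refine Measurable.ite (measurable_ν_bonusSigma _ (measurableSet_singleton _)) ?_
      measurable_const
    exact (measurable_from_top (f := f)).comp (measurable_Y_bonusSigma (n + 1) r)
  have hθm : Measurable[M.past n] θ := Measurable.ite hSset measurable_const measurable_const
  have hcast : ∀ B : Finset ℕ, B ⊆ Finset.range (n + 1) →
      Measurable[M.past n] (fun ω => (M.groupWeight n B ω : ℝ)) := fun B hB =>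
    (measurable_from_top (f := fun m : ℕ => (m : ℝ))).comp (measurable_groupWeight_past hB)
  have hHm : Measurable[M.past n] H := by
    refine Measurable.ite hSset ?_ measurable_const
    exact (hcast A hAr).div (Finset.measurable_sum _ (fun B hB =>
      hcast B (Finset.mem_powersetCard.1 hB).1))
  have hψb : ∀ ω, |ψ ω| ≤ 1 := by
    intro ω
    simp only [hψ]
    split_ifs
    · exact hf _
    · simp
  have hHb : ∀ ω, |H ω| ≤ 1 := by
    intro ω
    simp only [hH]
    split_ifs
    · rw [abs_of_nonneg (by positivity)]
      refine div_le_one_of_le₀ ?_ (by positivity)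
      exact Finset.single_le_sum (f := fun B => (M.groupWeight n B ω : ℝ))
        (fun B _ => by positivity) (Finset.mem_powersetCard.2 ⟨hAr, rfl⟩)
    · simp
  have hψint : Integrable ψ μ :=
    Integrable.of_bound (hψm.mono hble le_rfl).aestronglyMeasurable 1
      (Eventually.of_forall hψb)
  have hIint : Integrable I μ :=
    (integrable_const (1 : ℝ)).indicator (hM.measurable_G _ A)
  have hfun : (fun ω => if 0 < M.S n ω ∧ M.G (n + 1) ω = A then f (M.bonus (n + 1) i ω) else 0)
      = (fun ω => θ ω * ψ ω) * I := by
    funext ω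
    simp only [Pi.mul_apply, hθ, hψ, hI, Set.indicator_apply, Set.mem_ofPred_eq]
    by_cases hG : M.G (n + 1) ω = A
    · have hν : M.ν (n + 1) ω = A.card := by rw [← hM.card_G (n + 1) (by omega) ω, hG]
      simp [hG, hν, bonus, hi, ← hr]
    · simp [hG]
  have hθψ : StronglyMeasurable[(M.past n ⊔ M.bonusSigma (n + 1))] (fun ω => θ ω * ψ ω) :=
    ((hθm.mono le_sup_left le_rfl).mul (hψm.mono le_sup_right le_rfl)).stronglyMeasurable
  -- Tower property: conditionally on past and bonuses, $\psi$ is known and the selection rule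
  -- applies; conditionally on the past alone, $\psi$ is independent and becomes its mean.
  have h2 : μ[(fun ω => θ ω * ψ ω) * I | (M.past n ⊔ M.bonusSigma (n + 1))] =ᵐ[μ] (fun ω => θ ω * ψ ω) * μ[I | (M.past n ⊔ M.bonusSigma (n + 1))] := by
    refine condExp_stronglyMeasurable_mul_of_bound hGle hθψ hIint 1
      (Eventually.of_forall fun ω => ?_)
    rw [Real.norm_eq_abs, abs_mul]
    refine mul_le_one₀ ?_ (abs_nonneg _) (hψb ω)
    simp only [hθ]
    split_ifs <;> simp
  have h3 : (fun ω => θ ω * ψ ω) * μ[I | (M.past n ⊔ M.bonusSigma (n + 1))] =ᵐ[μ] H * ψ := by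
    filter_upwards [hM.selection n A hAr] with ω hω
    simp only [Pi.mul_apply, hθ, hψ, hH]
    by_cases hS : 0 < M.S n ω
    · by_cases hν : M.ν (n + 1) ω = A.card
      · rw [if_pos hS, if_pos hS, if_pos hν, hω hν hS]
        ring
      · simp [hν]
    · simp [hS]
  have h4 : μ[H * ψ | M.past n] =ᵐ[μ] H * μ[ψ | M.past n] :=
    condExp_stronglyMeasurable_mul_of_bound hple hHm.stronglyMeasurable hψint 1
      (Eventually.of_forall hHb)
  have h5 : μ[ψ | M.past n] =ᵐ[μ] fun _ => μ[ψ] :=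
    condExp_indep_eq hble hple hψm.stronglyMeasurable (hA.indep_bonus_past n)
  have h6 : μ[μ[(fun ω => θ ω * ψ ω) * I | (M.past n ⊔ M.bonusSigma (n + 1))] | M.past n]
      =ᵐ[μ] μ[(fun ω => θ ω * ψ ω) * I | M.past n] := condExp_condExp_of_le le_sup_left hGle
  have h7 := condExp_congr_ae (m := M.past n) (h2.trans h3)
  rw [hfun]
  filter_upwards [h4, h5, h6, h7] with ω h4 h5 h6 h7
  rw [← h6, h7, h4, Pi.mul_apply, h5]
  congr 1
  exact hA.integral_exchange hM (by omega) hrk f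

/-- The conditional expectation of a function of the bonus of a given researcher on the event that
this researcher is an author. -/
lemma Assumptions.condExp_bonus (hM : M.IsModel μ) (hA : M.Assumptions μ μ' ν' Y' Z')
    {n i : ℕ} (hn : 1 ≤ n) (hi : i ≤ n) {f : ℕ → ℝ} (hf : ∀ y, |f y| ≤ 1) :
    μ[fun ω => if 0 < M.S n ω ∧ i ∈ M.G (n + 1) ω then f (M.bonus (n + 1) i ω) else 0 | M.past n]
      =ᵐ[μ] fun ω => if 0 < M.S n ω then
        (M.W n i ω : ℝ) / M.S n ω * (∫ ω, f (M.Y (n + 1) 1 ω) ∂μ) +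
          (1 - (M.W n i ω : ℝ) / M.S n ω) / n *
            (∫ ω, ((M.ν (n + 1) ω : ℝ) - 1) * f (M.Y (n + 1) 1 ω) ∂μ) else 0 := by
  -- Decomposition by the group selected; the index `k` counts the other authors besides `i`, so
  -- that $E[(\nu-1)f(Y)]$ appears as $\sum_k k\,c_k$.
  set J : ℕ → Finset (Finset ℕ) := fun k =>
    ((Finset.range (n + 1)).powersetCard (k + 1)).filter (fun A => i ∈ A) with hJ
  have hJm : ∀ k A, A ∈ J k ↔ (A ⊆ Finset.range (n + 1) ∧ A.card = k + 1) ∧ i ∈ A := by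
    intro k A
    rw [hJ, Finset.mem_filter, Finset.mem_powersetCard]
  set g : Finset ℕ → Ω → ℝ := fun A ω =>
    if 0 < M.S n ω ∧ M.G (n + 1) ω = A then f (M.bonus (n + 1) i ω) else 0 with hg
  have hle : ∀ ω, M.ν (n + 1) ω ≤ n + 1 := by
    intro ω
    rw [← hM.card_G (n + 1) (by omega) ω]
    simpa using Finset.card_le_card (hM.G_subset (n + 1) (by omega) ω)
  have hge : ∀ ω, 1 ≤ M.ν (n + 1) ω := hM.one_le_ν (n + 1) (by omega)
  have hfun : (fun ω => if 0 < M.S n ω ∧ i ∈ M.G (n + 1) ω then f (M.bonus (n + 1) i ω) else 0)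
      = ∑ k ∈ Finset.range (n + 1), ∑ A ∈ J k, g A := by
    funext ω
    simp only [Finset.sum_apply, hg]
    by_cases hS : 0 < M.S n ω
    swap; · simp [hS]
    by_cases hiG : i ∈ M.G (n + 1) ω
    · have hcard := hM.card_G (n + 1) (by omega) ω
      have h1 := hge ω
      have h2 := hle ω
      rw [Finset.sum_eq_single (M.ν (n + 1) ω - 1), Finset.sum_eq_single (M.G (n + 1) ω)]
      · simp [hS, hiG]
      · intro A _ hne
        rw [if_neg (fun h => hne h.2.symm)]
      · intro hnot
        refine absurd ((hJm _ _).2 ⟨⟨hM.G_subset (n + 1) (by omega) ω, by omega⟩, hiG⟩) hnot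
      · intro k _ hne
        refine Finset.sum_eq_zero (fun A hAk => if_neg (fun h => ?_))
        have h3 := ((hJm k A).1 hAk).1.2
        rw [← h.2, hcard] at h3
        omega
      · intro hnot
        exact absurd (Finset.mem_range.2 (by omega)) hnot
    · rw [if_neg (fun h => hiG h.2)]
      refine (Finset.sum_eq_zero (fun k _ => Finset.sum_eq_zero (fun A hAk => if_neg ?_))).symm
      rintro ⟨-, h⟩
      exact hiG (h ▸ ((hJm k A).1 hAk).2)
  have hbm : Measurable (M.bonus (n + 1) i) :=
    measurable_bonus_of (fun A => hM.measurable_G _ A) (fun l => hM.measurable_Y _ l) i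
  have hSset : MeasurableSet {ω | 0 < M.S n ω} :=
    hM.past_le n _ (measurable_S_past n (measurableSet_Ioi (a := 0)))
  have hgint : ∀ A, Integrable (g A) μ := by
    intro A
    refine Integrable.of_bound (C := 1) (Measurable.aestronglyMeasurable ?_)
      (Eventually.of_forall fun ω => ?_)
    · exact Measurable.ite (hSset.inter (hM.measurable_G _ A))
        ((measurable_from_top (f := f)).comp hbm) measurable_const
    · simp only [hg]
      split_ifs
      · exact hf _
      · simp
  set c : ℕ → ℝ := fun k => ∫ ω, (if M.ν (n + 1) ω = k + 1 then f (M.Y (n + 1) 1 ω) else 0) ∂μ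
    with hc
  have hcint : ∀ k, Integrable
      (fun ω => if M.ν (n + 1) ω = k + 1 then f (M.Y (n + 1) 1 ω) else 0) μ := by
    intro k
    refine Integrable.of_bound (C := 1) (Measurable.aestronglyMeasurable ?_)
      (Eventually.of_forall fun ω => ?_)
    · exact Measurable.ite (hM.measurable_ν _ (measurableSet_singleton _))
        ((measurable_from_top (f := f)).comp (hM.measurable_Y _ _)) measurable_const
    · split_ifs
      · exact hf _
      · simp
  have hP : ∫ ω, f (M.Y (n + 1) 1 ω) ∂μ = ∑ k ∈ Finset.range (n + 1), c k := by
    rw [hc, ← integral_finsetSum _ (fun k _ => hcint k)]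
    refine integral_congr_ae (Eventually.of_forall fun ω => ?_)
    have h1 := hge ω
    have h2 := hle ω
    dsimp only
    rw [Finset.sum_eq_single (M.ν (n + 1) ω - 1), if_pos (by omega)]
    · intro k _ hne
      rw [if_neg (by omega)]
    · intro hnot
      exact absurd (Finset.mem_range.2 (by omega)) hnot
  have hQ : ∫ ω, ((M.ν (n + 1) ω : ℝ) - 1) * f (M.Y (n + 1) 1 ω) ∂μ
      = ∑ k ∈ Finset.range (n + 1), k * c k := by
    simp only [hc, ← integral_const_mul]
    rw [← integral_finsetSum _ (fun k _ => (hcint k).const_mul _)]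
    refine integral_congr_ae (Eventually.of_forall fun ω => ?_)
    have h1 := hge ω
    have h2 := hle ω
    dsimp only
    rw [Finset.sum_eq_single (M.ν (n + 1) ω - 1), if_pos (by omega)]
    · push_cast [Nat.cast_sub h1]; ring
    · intro k _ hne
      rw [if_neg (by omega), mul_zero]
    · intro hnot
      exact absurd (Finset.mem_range.2 (by omega)) hnot
  have hsum1 : μ[∑ k ∈ Finset.range (n + 1), ∑ A ∈ J k, g A | M.past n]
      =ᵐ[μ] ∑ k ∈ Finset.range (n + 1), ∑ A ∈ J k, μ[g A | M.past n] := by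
    refine (condExp_finsetSum (fun k _ => integrable_finsetSum' _ (fun A _ => hgint A)) _).trans ?_
    exact eventuallyEq_sum (fun k _ => condExp_finsetSum (fun A _ => hgint A) _)
  have hall : ∀ᵐ ω ∂μ, ∀ k ∈ Finset.range (n + 1), ∀ A ∈ J k, (μ[g A | M.past n]) ω
      = (if 0 < M.S n ω then (M.groupWeight n A ω : ℝ) /
          ∑ B ∈ (Finset.range (n + 1)).powersetCard A.card, (M.groupWeight n B ω : ℝ) else 0) *
        ∫ ω, (if M.ν (n + 1) ω = A.card then f (M.Y (n + 1) 1 ω) else 0) ∂μ := by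
    refine (ae_ball_iff (Finset.range (n + 1)).countable_toSet).2 (fun k _ =>
      (ae_ball_iff (J k).countable_toSet).2 (fun A hAk => ?_))
    have h := (hJm k A).1 hAk
    exact hA.condExp_group hM h.1.1 h.2 hf
  rw [hfun]
  filter_upwards [hsum1, hall] with ω h1 h2
  rw [h1]
  simp only [Finset.sum_apply]
  rw [Finset.sum_congr rfl (fun k hk => Finset.sum_congr rfl (fun A hAk => h2 k hk A hAk))]
  by_cases hS : 0 < M.S n ω
  swap; · simp [hS]
  simp only [if_pos hS]
  have hScast : (M.S n ω : ℝ) = ∑ j ∈ Finset.range (n + 1), (M.W n j ω : ℝ) := by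
    simp [S]
  have hS0 : 0 < ∑ j ∈ Finset.range (n + 1), (M.W n j ω : ℝ) := by
    rw [← hScast]; exact_mod_cast hS
  have h3 : ∀ k ∈ Finset.range (n + 1), ∑ A ∈ J k, ((M.groupWeight n A ω : ℝ) /
          ∑ B ∈ (Finset.range (n + 1)).powersetCard A.card, (M.groupWeight n B ω : ℝ)) *
        ∫ ω, (if M.ν (n + 1) ω = A.card then f (M.Y (n + 1) 1 ω) else 0) ∂μ
      = ((M.W n i ω : ℝ) / M.S n ω + k * ((1 - (M.W n i ω : ℝ) / M.S n ω) / n)) * c k := by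
    intro k hk
    rw [hScast, ← Finset.sum_filter_mem_div hn (Finset.card_range (n + 1))
      (Finset.mem_range.2 (by omega)) (by simpa [Nat.lt_succ_iff] using hk)
      (fun j => (M.W n j ω : ℝ)) hS0, Finset.sum_mul]
    refine Finset.sum_congr rfl (fun A hAk => ?_)
    rw [((hJm k A).1 hAk).1.2]
    simp [groupWeight, hc]
  rw [Finset.sum_congr rfl h3, hP, hQ, Finset.mul_sum, Finset.mul_sum, ← Finset.sum_add_distrib]
  exact Finset.sum_congr rfl (fun k _ => by ring)

end PublicationProcess

/-! ### Laws of integer-valued random variables. -/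

section Discrete

variable {Ω : Type*} [MeasurableSpace Ω] {μ : Measure Ω} {Y : Ω → ℕ}

lemma nullMeasurableSet_eq_of_aemeasurable (hY : AEMeasurable Y μ) (b : ℕ) :
    NullMeasurableSet {ω | Y ω = b} μ :=
  hY.nullMeasurableSet_preimage (measurableSet_singleton b)

lemma integral_ite_eq_setIntegral (hY : AEMeasurable Y μ) (b : ℕ) (g : Ω → ℝ) :
    ∫ ω, (if Y ω = b then g ω else 0) ∂μ = ∫ ω in {ω | Y ω = b}, g ω ∂μ := by
  rw [← integral_indicator₀ (nullMeasurableSet_eq_of_aemeasurable hY b)]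
  refine integral_congr_ae (Eventually.of_forall fun ω => ?_)
  simp [Set.indicator_apply]

lemma integrable_ite_eq (hY : AEMeasurable Y μ) (b : ℕ) {g : Ω → ℝ} (hg : Integrable g μ) :
    Integrable (fun ω => if Y ω = b then g ω else 0) μ := by
  have h : (fun ω => if Y ω = b then g ω else 0) = Set.indicator {ω | Y ω = b} g := by
    funext ω; simp [Set.indicator_apply]
  rw [h]
  exact hg.indicator₀ (nullMeasurableSet_eq_of_aemeasurable hY b)

/-- The law of total expectation, for a partition by the values of an integer valued variable. -/
lemma hasSum_integral_ite_eq (hY : AEMeasurable Y μ) {g : Ω → ℝ} (hg : Integrable g μ) :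
    HasSum (fun b : ℕ => ∫ ω, (if Y ω = b then g ω else 0) ∂μ) (∫ ω, g ω ∂μ) := by
  simp only [integral_ite_eq_setIntegral hY]
  have hU : (⋃ b : ℕ, {ω | Y ω = b}) = Set.univ := by
    ext ω; simp
  have h := hasSum_integral_iUnion_ae (μ := μ) (f := g) (s := fun b : ℕ => {ω | Y ω = b})
    (fun b => nullMeasurableSet_eq_of_aemeasurable hY b)
    (fun a b hab => (Set.disjoint_left.2 fun ω h1 h2 => hab (h1.symm.trans h2)).aedisjoint)
    hg.integrableOn
  rwa [hU, setIntegral_univ] at h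

lemma hasSum_law [IsProbabilityMeasure μ] (hY : AEMeasurable Y μ) :
    HasSum (fun b : ℕ => ∫ ω, (if Y ω = b then (1 : ℝ) else 0) ∂μ) 1 := by
  simpa using hasSum_integral_ite_eq hY (integrable_const (μ := μ) (1 : ℝ))

lemma hasSum_mean (hY : AEMeasurable Y μ) (hi : Integrable (fun ω => (Y ω : ℝ)) μ) :
    HasSum (fun b : ℕ => (b : ℝ) * ∫ ω, (if Y ω = b then (1 : ℝ) else 0) ∂μ)
      (∫ ω, (Y ω : ℝ) ∂μ) := by
  refine (hasSum_integral_ite_eq hY hi).congr_fun (fun b => ?_)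
  rw [← integral_const_mul]
  refine integral_congr_ae (Eventually.of_forall fun ω => ?_)
  dsimp only
  split_ifs with h
  · rw [h, mul_one]
  · rw [mul_zero]

lemma integral_ite_pos_iff [IsProbabilityMeasure μ] (hY : AEMeasurable Y μ) (b : ℕ) :
    0 < ∫ ω, (if Y ω = b then (1 : ℝ) else 0) ∂μ ↔ 0 < μ {ω | Y ω = b} := by
  rw [integral_ite_eq_setIntegral hY, setIntegral_const, smul_eq_mul, mul_one, measureReal_def,
    ENNReal.toReal_pos_iff]
  exact and_iff_left (measure_lt_top _ _)

lemma law_mul_exp_le [IsProbabilityMeasure μ] (hY : AEMeasurable Y μ) {t : ℝ}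
    (ht : Integrable (fun ω => Real.exp (t * (Y ω : ℝ))) μ) (b : ℕ) :
    (∫ ω, (if Y ω = b then (1 : ℝ) else 0) ∂μ) * Real.exp (t * b)
      ≤ ∫ ω, Real.exp (t * (Y ω : ℝ)) ∂μ := by
  rw [← integral_mul_const]
  refine integral_mono ((integrable_ite_eq hY b (integrable_const 1)).mul_const _) ht (fun ω => ?_)
  dsimp only
  split_ifs with h
  · rw [h, one_mul]
  · rw [zero_mul]; positivity

lemma expDecay_law [IsProbabilityMeasure μ] (hY : AEMeasurable Y μ)
    (h : ∃ t : ℝ, 0 < t ∧ Integrable (fun ω => Real.exp (t * (Y ω : ℝ))) μ) :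
    ExpDecay (PowerSeries.mk fun b : ℕ => ∫ ω, (if Y ω = b then (1 : ℝ) else 0) ∂μ) := by
  obtain ⟨t, ht, hi⟩ := h
  refine ExpDecay.mk_of_bound (C := ∫ ω, Real.exp (t * (Y ω : ℝ)) ∂μ) (r := Real.exp (-t))
    (by positivity) (Real.exp_lt_one_iff.2 (by linarith)) (fun b => ?_)
  have h0 : 0 ≤ ∫ ω, (if Y ω = b then (1 : ℝ) else 0) ∂μ :=
    integral_nonneg (fun ω => by dsimp only; split_ifs <;> simp)
  have h1 := law_mul_exp_le hY hi b
  rw [abs_of_nonneg h0, ← Real.exp_nat_mul, mul_neg, Real.exp_neg, mul_comm (b : ℝ), ← div_eq_mul_inv,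
    le_div_iff₀ (Real.exp_pos _)]
  exact h1

lemma integrable_of_mgf (hY : AEMeasurable Y μ)
    (h : ∃ t : ℝ, 0 < t ∧ Integrable (fun ω => Real.exp (t * (Y ω : ℝ))) μ) :
    Integrable (fun ω => (Y ω : ℝ)) μ := by
  obtain ⟨t, ht, hi⟩ := h
  refine (hi.const_mul t⁻¹).mono' ?_ (Eventually.of_forall fun ω => ?_)
  · exact ((measurable_from_top (f := fun m : ℕ => (m : ℝ))).comp_aemeasurable hY).aestronglyMeasurable
  · rw [Real.norm_eq_abs, Nat.abs_cast, ← div_eq_inv_mul, le_div_iff₀ ht, mul_comm]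
    linarith [Real.add_one_le_exp (t * (Y ω : ℝ))]

/-- The truncated first moments of a square integrable variable decay exponentially, too. -/
lemma expDecay_moment [IsProbabilityMeasure μ] (hY : AEMeasurable Y μ)
    (h : ∃ t : ℝ, 0 < t ∧ Integrable (fun ω => Real.exp (t * (Y ω : ℝ))) μ) {g : Ω → ℝ}
    (hg : MemLp g 2 μ) :
    ExpDecay (PowerSeries.mk fun b : ℕ => ∫ ω, (if Y ω = b then g ω else 0) ∂μ) := by
  obtain ⟨t, ht, hi⟩ := h
  have hgi : Integrable g μ := hg.integrable (by norm_num)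
  -- Half the rate: $P(Y=b)$ is of order at most $r^{2b}$, and $|g|\le r^bg^2+r^{-b}$ on $\{Y=b\}$
  -- balances the two terms at $r^b$.
  set r := Real.exp (-(t / 2)) with hr
  have hr0 : 0 < r := Real.exp_pos _
  refine ExpDecay.mk_of_bound (C := ∫ ω, g ω ^ 2 ∂μ + ∫ ω, Real.exp (t * (Y ω : ℝ)) ∂μ) (r := r)
    hr0.le (Real.exp_lt_one_iff.2 (by linarith)) (fun b => ?_)
  have hrb : r ^ b = Real.exp (-(t / 2 * b)) := by
    rw [hr, ← Real.exp_nat_mul]; congr 1; ring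
  have hrb0 : 0 < r ^ b := by positivity
  have hexp : Real.exp (t * b) = (r ^ b)⁻¹ * (r ^ b)⁻¹ := by
    rw [hrb, ← Real.exp_neg, ← Real.exp_add]; congr 1; ring
  have h1 := law_mul_exp_le hY hi b
  have hint := (integrable_ite_eq hY b (integrable_const (μ := μ) (1 : ℝ)))
  calc |∫ ω, (if Y ω = b then g ω else 0) ∂μ|
      ≤ ∫ ω, |if Y ω = b then g ω else 0| ∂μ := abs_integral_le_integral_abs
    _ ≤ ∫ ω, (r ^ b * g ω ^ 2 + (r ^ b)⁻¹ * (if Y ω = b then (1 : ℝ) else 0)) ∂μ := by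
        refine integral_mono (integrable_ite_eq hY b hgi).abs
          ((hg.integrable_sq.const_mul _).add (hint.const_mul _)) (fun ω => ?_)
        dsimp only
        split_ifs
        · have h2 : 0 ≤ r ^ b * (|g ω| - (r ^ b)⁻¹) ^ 2 := by positivity
          have h3 : r ^ b * (|g ω| - (r ^ b)⁻¹) ^ 2 = r ^ b * g ω ^ 2 - 2 * |g ω| + (r ^ b)⁻¹ := by
            rw [sub_sq, sq_abs]; field_simp
          have := abs_nonneg (g ω)
          linarith
        · rw [abs_zero]; positivity
    _ = r ^ b * ∫ ω, g ω ^ 2 ∂μ + (r ^ b)⁻¹ * ∫ ω, (if Y ω = b then (1 : ℝ) else 0) ∂μ := by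
        rw [integral_add (hg.integrable_sq.const_mul _) (hint.const_mul _), integral_const_mul,
          integral_const_mul]
    _ ≤ r ^ b * ∫ ω, g ω ^ 2 ∂μ + r ^ b * ∫ ω, Real.exp (t * (Y ω : ℝ)) ∂μ := by
        refine add_le_add_right ?_ _
        rw [hexp] at h1
        calc (r ^ b)⁻¹ * ∫ ω, (if Y ω = b then (1 : ℝ) else 0) ∂μ
            = r ^ b * ((∫ ω, (if Y ω = b then (1 : ℝ) else 0) ∂μ) * ((r ^ b)⁻¹ * (r ^ b)⁻¹)) := by
              field_simp
          _ ≤ _ := by gcongr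
    _ = _ := by ring

end Discrete

/-! ### Growth of the total weight and limits of the step distributions. -/

namespace PublicationProcess

lemma measurable_Z_bonusSigma {Ω : Type*} {M : PublicationProcess Ω} (n : ℕ) :
    Measurable[M.bonusSigma n] (M.Z n) := by
  refine measurable_of_countable_param (m := M.bonusSigma n) (G := M.ν n)
    (F := fun k ω => ∑ l ∈ Finset.Icc 1 k, M.Y n l ω) (fun k => ?_) (fun k => ?_)
  · exact measurable_ν_bonusSigma n (measurableSet_singleton k)
  · exact Finset.measurable_sum _ (fun l _ => measurable_Y_bonusSigma n l)

lemma W_self {Ω : Type*} [MeasurableSpace Ω] {μ : Measure Ω} {M : PublicationProcess Ω}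
    (hM : M.IsModel μ) {n i : ℕ} (h : n ≤ i) (ω : Ω) : M.W n i ω = M.X i ω := by
  rw [W, Finset.sum_eq_zero, add_zero]
  intro m hm
  rw [Finset.mem_Icc] at hm
  refine if_neg (fun hi => ?_)
  have := Finset.mem_range.1 (hM.G_subset m hm.1 ω hi)
  omega

variable {Ω Ω' : Type*} [mΩ : MeasurableSpace Ω] {μ : Measure Ω}
  {M : PublicationProcess Ω} [MeasurableSpace Ω'] {μ' : Measure Ω'}
  {ν' Y' Z' : Ω' → ℕ}

lemma S_succ (hM : M.IsModel μ) (n : ℕ) (ω : Ω) :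
    M.S (n + 1) ω = M.S n ω + M.X (n + 1) ω + M.Z (n + 1) ω := by
  rw [S, S, Finset.sum_range_succ, W_self hM le_rfl]
  have h1 : ∑ i ∈ Finset.range (n + 1), M.bonus (n + 1) i ω = M.Z (n + 1) ω := by
    rw [Z, ← hM.card_G (n + 1) (by omega) ω, ← Finset.sum_card_filter_le]
    simp only [bonus]
    rw [← Finset.sum_filter, Finset.filter_mem_eq_inter,
      Finset.inter_eq_right.2 (hM.G_subset (n + 1) (by omega) ω)]
  simp only [W_succ, Finset.sum_add_distrib, h1]
  ring

lemma S_eq (hM : M.IsModel μ) (n : ℕ) (ω : Ω) :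
    (M.S n ω : ℝ) = ∑ i ∈ Finset.range (n + 1), (M.X i ω : ℝ)
      + ∑ k ∈ Finset.range n, (M.Z (k + 1) ω : ℝ) := by
  induction n with
  | zero => simp [S, W_self hM le_rfl]
  | succ n ih =>
    rw [S_succ hM, Finset.sum_range_succ (fun i => (M.X i ω : ℝ)) (n + 1),
      Finset.sum_range_succ (fun k => (M.Z (k + 1) ω : ℝ)) n]
    push_cast
    rw [ih]
    ring

lemma ν_le (hM : M.IsModel μ) {n : ℕ} (hn : 1 ≤ n) (ω : Ω) : M.ν n ω ≤ n := by
  rw [← hM.card_G n hn ω]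
  simpa using Finset.card_le_card (hM.G_subset n hn ω)

/-- The filtration generated by the steps of the process. -/
def pastFiltration (hM : M.IsModel μ) : Filtration ℕ mΩ where
  seq := M.past
  mono' := past_mono M
  le' := hM.past_le

variable [IsProbabilityMeasure μ] [IsProbabilityMeasure μ']

lemma Assumptions.integrable_Z (hA : M.Assumptions μ μ' ν' Y' Z') (n : ℕ) :
    Integrable (fun ω => (M.Z (n + 1) ω : ℝ)) μ :=
  (hA.memLp_Z (n + 1) (by omega)).integrable (by norm_num)

/-- The total weight grows linearly. -/
theorem Assumptions.ae_tendsto_S_div (hM : M.IsModel μ) (hA : M.Assumptions μ μ' ν' Y' Z') :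
    ∀ᵐ ω ∂μ, Tendsto (fun n : ℕ => (M.S n ω : ℝ) / n) atTop
      (𝓝 ((∫ ω, (M.X 0 ω : ℝ) ∂μ) + ∫ ω', (Z' ω' : ℝ) ∂μ')) := by
  have hcm : Measurable (fun m : ℕ => (m : ℝ)) := measurable_from_top
  have hX := strong_law_ae_real (μ := μ) (fun i ω => (M.X i ω : ℝ))
    (integrable_of_mgf (hM.measurable_X 0).aemeasurable hA.mgf_X)
    (fun i j hij => (hA.indep_X.indepFun hij).comp hcm hcm)
    (fun i => (hA.ident_X i).comp hcm)
  have hZm : ∀ n, Measurable[M.bonusSigma n] (fun ω => (M.Z n ω : ℝ)) := fun n =>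
    hcm.comp (measurable_Z_bonusSigma n)
  -- The $Z_n$ need not be identically distributed; centred, they are martingale differences because
  -- the bonuses are independent of the past.
  have hZ := ae_tendsto_average_of_martingale_difference (μ := μ) (ℱ := pastFiltration hM)
    (d := fun n ω => (M.Z (n + 1) ω : ℝ) - ∫ ω, (M.Z (n + 1) ω : ℝ) ∂μ)
    (fun n => (((hZm (n + 1)).mono (bonusSigma_le_past (by omega) le_rfl) le_rfl).sub
      measurable_const).stronglyMeasurable)
    (fun n => (hA.memLp_Z (n + 1) (by omega)).sub (memLp_const _))
    (fun n => by
      have h1 := condExp_indep_eq (μ := μ) (hM.bonusSigma_le (n + 1)) (hM.past_le n)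
        ((hZm (n + 1)).sub_const (∫ ω, (M.Z (n + 1) ω : ℝ) ∂μ)).stronglyMeasurable
        (hA.indep_bonus_past n)
      refine h1.trans (Eventually.of_forall fun ω => ?_)
      rw [integral_sub (hA.integrable_Z n) (integrable_const _)]
      simp)
    (by
      refine hA.summable_variance_Z.congr (fun n => ?_)
      rw [variance_eq_integral ((hZm (n + 1)).mono (hM.bonusSigma_le _) le_rfl).aemeasurable])
  filter_upwards [hX, hZ] with ω h1 h2
  have h3 : Tendsto (fun n : ℕ => ((n : ℝ) + 1) / n) atTop (𝓝 1) := by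
    have h := (tendsto_const_div_atTop_nhds_zero_nat (1 : ℝ)).const_add 1
    rw [add_zero] at h
    refine h.congr' ?_
    filter_upwards [eventually_gt_atTop 0] with n hn
    have : (n : ℝ) ≠ 0 := by exact_mod_cast hn.ne'
    field_simp
  have h4 := ((tendsto_add_atTop_iff_nat 1).2 h1).mul h3
  rw [mul_one] at h4
  have h5 := (h4.add h2).add hA.tendsto_mean_Z
  rw [add_zero] at h5
  refine h5.congr' ?_
  filter_upwards [eventually_gt_atTop 0] with n hn
  have hn0 : (n : ℝ) ≠ 0 := by exact_mod_cast hn.ne'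
  have h6 : ∑ i ∈ Finset.Icc 1 n, ∫ ω, (M.Z i ω : ℝ) ∂μ
      = ∑ k ∈ Finset.range n, ∫ ω, (M.Z (k + 1) ω : ℝ) ∂μ := by
    rw [Finset.range_eq_Ico, Finset.sum_Ico_add' (fun i => ∫ ω, (M.Z i ω : ℝ) ∂μ)]
    rfl
  rw [S_eq hM, h6, Finset.sum_sub_distrib]
  push_cast
  field_simp
  ring

lemma Assumptions.tendsto_integral (hA : M.Assumptions μ μ' ν' Y' Z') {F : ℕ × ℕ × ℕ → ℝ} {B : ℝ}
    (hF : ∀ a, |F a| ≤ B) :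
    Tendsto (fun n => ∫ ω, F (M.ν n ω, M.Y n 1 ω, M.Z n ω) ∂μ) atTop
      (𝓝 (∫ ω', F (ν' ω', Y' ω', Z' ω') ∂μ')) := by
  have h := ProbabilityMeasure.tendsto_iff_forall_integral_tendsto.1 hA.tendsto_triple.tendsto
  have h1 := h (BoundedContinuousFunction.ofNormedAddCommGroup F continuous_of_discreteTopology B hF)
  simp only [ProbabilityMeasure.coe_mk, BoundedContinuousFunction.coe_ofNormedAddCommGroup] at h1
  rw [integral_map hA.tendsto_triple.aemeasurable_limit
    (measurable_of_countable F).aestronglyMeasurable] at h1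
  refine h1.congr (fun n => ?_)
  rw [integral_map (hA.tendsto_triple.forall_aemeasurable n)
    (measurable_of_countable F).aestronglyMeasurable]

lemma Assumptions.tendsto_law_Y (hA : M.Assumptions μ μ' ν' Y' Z') (b : ℕ) :
    Tendsto (fun n => ∫ ω, (if M.Y n 1 ω = b then (1 : ℝ) else 0) ∂μ) atTop
      (𝓝 (∫ ω', (if Y' ω' = b then (1 : ℝ) else 0) ∂μ')) :=
  hA.tendsto_integral (F := fun a => if a.2.1 = b then 1 else 0) (B := 1)
    (fun a => by split_ifs <;> simp)

lemma Assumptions.aemeasurable_Y' (hA : M.Assumptions μ μ' ν' Y' Z') : AEMeasurable Y' μ' :=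
  (measurable_fst.comp measurable_snd).comp_aemeasurable hA.tendsto_triple.aemeasurable_limit

lemma memLp_ν (hM : M.IsModel μ) (n : ℕ) : MemLp (fun ω => (M.ν (n + 1) ω : ℝ)) 2 μ := by
  refine MemLp.of_bound ?_ ((n + 1 : ℕ) : ℝ) (Eventually.of_forall fun ω => ?_)
  · exact ((measurable_from_top (f := fun m : ℕ => (m : ℝ))).comp
      (hM.measurable_ν _)).aestronglyMeasurable
  · rw [Real.norm_eq_abs, Nat.abs_cast]
    exact_mod_cast ν_le hM (by omega) ω

/-- Pointwise $N-\min(N,K)\le N^2/K$, so second moments control the truncation error uniformly. -/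
lemma abs_integral_ite_sub_min_le {Ω : Type*} [MeasurableSpace Ω] {μ : Measure Ω}
    [IsProbabilityMeasure μ] {N Y : Ω → ℕ} (hY : AEMeasurable Y μ)
    (hN : MemLp (fun ω => (N ω : ℝ)) 2 μ) (b : ℕ) {K : ℕ} (hK : 0 < K) :
    |∫ ω, (if Y ω = b then (N ω : ℝ) else 0) ∂μ
        - ∫ ω, (if Y ω = b then ((min (N ω) K : ℕ) : ℝ) else 0) ∂μ|
      ≤ (∫ ω, (N ω : ℝ) ^ 2 ∂μ) / K := by
  have hNi : Integrable (fun ω => (N ω : ℝ)) μ := hN.integrable (by norm_num)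
  have hmi : Integrable (fun ω => ((min (N ω) K : ℕ) : ℝ)) μ := by
    have h : (fun ω => ((min (N ω) K : ℕ) : ℝ)) = fun ω => min (N ω : ℝ) (K : ℝ) := by
      funext ω; exact Nat.cast_min _ _
    rw [h]
    exact hNi.inf (integrable_const _)
  have h1 := integrable_ite_eq hY b hNi
  have h2 := integrable_ite_eq hY b hmi
  have hK0 : (0 : ℝ) < K := by exact_mod_cast hK
  rw [← integral_sub h1 h2, ← integral_div]
  refine abs_integral_le_integral_abs.trans
    (integral_mono (h1.sub h2).abs (hN.integrable_sq.div_const _) (fun ω => ?_))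
  dsimp only
  split_ifs
  · rw [le_div_iff₀ hK0]
    rcases le_total (N ω) K with h | h
    · rw [min_eq_left h, sub_self, abs_zero, zero_mul]; positivity
    · have hr : (K : ℝ) ≤ N ω := by exact_mod_cast h
      rw [min_eq_right h, abs_of_nonneg (by linarith)]
      nlinarith
  · rw [sub_zero, abs_zero]; positivity

/-- Convergence in distribution covers only bounded functions. The bounded second moments of $\nu_n$
give uniform integrability, through truncation at $K$. -/
lemma Assumptions.tendsto_ν_law_Y (hM : M.IsModel μ) (hA : M.Assumptions μ μ' ν' Y' Z') (b : ℕ) :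
    Tendsto (fun n => ∫ ω, (if M.Y n 1 ω = b then (M.ν n ω : ℝ) else 0) ∂μ) atTop
      (𝓝 (∫ ω', (if Y' ω' = b then (ν' ω' : ℝ) else 0) ∂μ')) := by
  rw [Metric.tendsto_nhds]
  intro ε hε
  obtain ⟨B, hB⟩ := (Metric.isBounded_range_of_tendsto _ hA.tendsto_sq_ν).exists_norm_le
  have hB' : ∀ n, ∫ ω, (M.ν n ω : ℝ) ^ 2 ∂μ ≤ B := fun n =>
    (le_abs_self _).trans (hB _ (Set.mem_range_self n))
  have hBl : ∫ ω', (ν' ω' : ℝ) ^ 2 ∂μ' ≤ B := le_of_tendsto' hA.tendsto_sq_ν hB'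
  have hB0 : 0 ≤ B := (integral_nonneg (fun ω => by positivity)).trans (hB' 0)
  obtain ⟨K, hK⟩ := exists_nat_gt (max (B / (ε / 3)) 0)
  have hK0 : (0 : ℝ) < K := (le_max_right _ _).trans_lt hK
  have hK0' : 0 < K := by exact_mod_cast hK0
  have hBK : B / K < ε / 3 := by
    rw [div_lt_iff₀ hK0, mul_comm, ← div_lt_iff₀ (by positivity)]
    exact (le_max_left _ _).trans_lt hK
  have hmin := hA.tendsto_integral
    (F := fun a => if a.2.1 = b then ((min a.1 K : ℕ) : ℝ) else 0) (B := K) (fun a => by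
      split_ifs
      · rw [Nat.abs_cast]; exact_mod_cast min_le_right _ _
      · simp)
  rw [Metric.tendsto_nhds] at hmin
  filter_upwards [hmin (ε / 3) (by positivity), eventually_ge_atTop 1] with n h1 hn
  obtain ⟨m, rfl⟩ : ∃ m, n = m + 1 := ⟨n - 1, by omega⟩
  have h2 := abs_integral_ite_sub_min_le (hM.measurable_Y (m + 1) 1).aemeasurable (memLp_ν hM m) b hK0'
  have h3 := abs_integral_ite_sub_min_le hA.aemeasurable_Y' hA.memLp_ν' b hK0'
  have h4 : (∫ ω, (M.ν (m + 1) ω : ℝ) ^ 2 ∂μ) / K ≤ B / K := by gcongr; exact hB' _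
  have h5 : (∫ ω', (ν' ω' : ℝ) ^ 2 ∂μ') / K ≤ B / K := by gcongr
  rw [Real.dist_eq, abs_lt] at h1 ⊢
  rw [abs_le] at h2 h3
  constructor <;> linarith [h1.1, h1.2, h2.1, h2.2, h3.1, h3.2]

end PublicationProcess

/-! ### Drift and fluctuations of the number of researchers of weight $j$. -/

namespace PublicationProcess

/-- The change of the indicator of weight `j` if a bonus `y` is added to the weight `w`. -/
def jump (j w y : ℕ) : ℝ := (if w + y = j then 1 else 0) - (if w = j then 1 else 0)

lemma abs_jump_le (j w y : ℕ) : |jump j w y| ≤ 1 := by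
  unfold jump
  split_ifs <;> norm_num

lemma jump_eq_zero {j w : ℕ} (h : j < w) (y : ℕ) : jump j w y = 0 := by
  rw [jump, if_neg (by omega), if_neg (by omega), sub_zero]

lemma jump_eq {j w : ℕ} (h : w ≤ j) (y : ℕ) :
    jump j w y = (if y = j - w then 1 else 0) - (if w = j then 1 else 0) := by
  rw [jump]
  congr 2
  exact propext ⟨fun h => by omega, fun h => by omega⟩

section

variable {Ω : Type*}

/-- The change in step `n + 1` of the number of researchers of weight `j` among those present
before this step. -/
noncomputable def increment (M : PublicationProcess Ω) (j n : ℕ) (ω : Ω) : ℝ :=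
  if 0 < M.S n ω then ∑ i ∈ Finset.range (n + 1), jump j (M.W n i ω) (M.bonus (n + 1) i ω) else 0

variable {M : PublicationProcess Ω}

lemma measurable_increment (j n : ℕ) : Measurable[M.past (n + 1)] (M.increment j n) := by
  have hS : MeasurableSet[M.past (n + 1)] {ω | 0 < M.S n ω} :=
    past_mono M n.le_succ _ (measurable_S_past n (measurableSet_Ioi (a := 0)))
  refine Measurable.ite hS (Finset.measurable_sum _ (fun i hi => ?_)) measurable_const
  have h1 : Measurable[M.past (n + 1)] (M.W n i) :=
    (measurable_W_past (by simpa [Nat.lt_succ_iff] using hi)).mono (past_mono M n.le_succ) le_rfl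
  have h2 : Measurable[M.past (n + 1)] (M.bonus (n + 1) i) :=
    measurable_bonus_past (by omega) le_rfl i
  exact (measurable_of_countable (fun a : ℕ × ℕ => jump j a.1 a.2)).comp (h1.prodMk h2)

lemma ξ_cast (n j : ℕ) (ω : Ω) :
    (M.ξ n j ω : ℝ) = ∑ i ∈ Finset.range (n + 1), if M.W n i ω = j then (1 : ℝ) else 0 := by
  rw [ξ, Finset.natCast_card_filter]

end

variable {Ω Ω' : Type*} [mΩ : MeasurableSpace Ω] {μ : Measure Ω}
  {M : PublicationProcess Ω} [MeasurableSpace Ω'] {μ' : Measure Ω'}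
  {ν' Y' Z' : Ω' → ℕ}

lemma ξ_succ (hM : M.IsModel μ) (j n : ℕ) {ω : Ω} (hS : 0 < M.S n ω) :
    (M.ξ (n + 1) j ω : ℝ) = M.ξ n j ω + M.increment j n ω
      + (if M.X (n + 1) ω = j then 1 else 0) := by
  rw [ξ_cast, ξ_cast, Finset.sum_range_succ, W_self hM le_rfl, increment, if_pos hS,
    ← Finset.sum_add_distrib]
  congr 1
  refine Finset.sum_congr rfl (fun i _ => ?_)
  rw [W_succ, jump]
  ring

/-- Only the authors of the paper change weight. This makes the second moments of the increments
bounded, as the strong law requires. -/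
lemma abs_increment_le (hM : M.IsModel μ) (j n : ℕ) (ω : Ω) :
    |M.increment j n ω| ≤ M.ν (n + 1) ω := by
  unfold increment
  split_ifs
  · refine (Finset.abs_sum_le_sum_abs _ _).trans ?_
    calc ∑ i ∈ Finset.range (n + 1), |jump j (M.W n i ω) (M.bonus (n + 1) i ω)|
        ≤ ∑ i ∈ Finset.range (n + 1), if i ∈ M.G (n + 1) ω then (1 : ℝ) else 0 := by
          refine Finset.sum_le_sum (fun i _ => ?_)
          split_ifs with h
          · exact abs_jump_le _ _ _
          · simp [bonus, h, jump]
      _ = M.ν (n + 1) ω := by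
          rw [← Finset.natCast_card_filter, Finset.filter_mem_eq_inter,
            Finset.inter_eq_right.2 (hM.G_subset (n + 1) (by omega) ω), hM.card_G (n + 1) (by omega)]
  · simp

variable [IsProbabilityMeasure μ] [IsProbabilityMeasure μ']

lemma memLp_increment (hM : M.IsModel μ) (j n : ℕ) : MemLp (M.increment j n) 2 μ :=
  (memLp_ν hM n).mono
    ((measurable_increment j n).mono (hM.past_le (n + 1)) le_rfl).aestronglyMeasurable
    (Eventually.of_forall fun ω => by
      rw [Real.norm_eq_abs, Real.norm_eq_abs, Nat.abs_cast]
      exact abs_increment_le hM j n ω)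

lemma integral_jump (hM : M.IsModel μ) {j w : ℕ} (h : w ≤ j) (n : ℕ) :
    ∫ ω, jump j w (M.Y n 1 ω) ∂μ
      = (∫ ω, (if M.Y n 1 ω = j - w then (1 : ℝ) else 0) ∂μ) - (if w = j then 1 else 0) := by
  simp only [jump_eq h]
  rw [integral_sub (integrable_ite_eq (hM.measurable_Y n 1).aemeasurable _ (integrable_const 1))
    (integrable_const _)]
  simp

lemma integral_ν_mul_jump (hM : M.IsModel μ) {j w : ℕ} (h : w ≤ j) (n : ℕ) :
    ∫ ω, ((M.ν (n + 1) ω : ℝ) - 1) * jump j w (M.Y (n + 1) 1 ω) ∂μ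
      = (∫ ω, (if M.Y (n + 1) 1 ω = j - w then ((M.ν (n + 1) ω : ℝ) - 1) else 0) ∂μ)
        - (if w = j then ∫ ω, ((M.ν (n + 1) ω : ℝ) - 1) ∂μ else 0) := by
  have hint : Integrable (fun ω => (M.ν (n + 1) ω : ℝ) - 1) μ :=
    ((memLp_ν hM n).integrable (by norm_num)).sub (integrable_const 1)
  have h1 : ∀ ω, ((M.ν (n + 1) ω : ℝ) - 1) * jump j w (M.Y (n + 1) 1 ω)
      = (if M.Y (n + 1) 1 ω = j - w then ((M.ν (n + 1) ω : ℝ) - 1) else 0)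
        - (if w = j then ((M.ν (n + 1) ω : ℝ) - 1) else 0) := by
    intro ω
    rw [jump_eq h]
    split_ifs <;> ring
  simp only [h1]
  rw [integral_sub (integrable_ite_eq (hM.measurable_Y _ 1).aemeasurable _ hint)]
  · split_ifs <;> simp
  · split_ifs
    · exact hint
    · exact integrable_zero _ _ _

/-- The conditional expectation of the change of the number of researchers of weight `j`. -/
theorem Assumptions.condExp_increment (hM : M.IsModel μ) (hA : M.Assumptions μ μ' ν' Y' Z')
    (j : ℕ) {n : ℕ} (hn : 1 ≤ n) :
    μ[M.increment j n | M.past n] =ᵐ[μ] fun ω => if 0 < M.S n ω then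
      ∑ w ∈ Finset.range (j + 1), (M.ξ n w ω : ℝ) *
        ((w : ℝ) / M.S n ω *
            ((∫ ω, (if M.Y (n + 1) 1 ω = j - w then (1 : ℝ) else 0) ∂μ) - (if w = j then 1 else 0))
          + (1 - (w : ℝ) / M.S n ω) / n *
            ((∫ ω, (if M.Y (n + 1) 1 ω = j - w then ((M.ν (n + 1) ω : ℝ) - 1) else 0) ∂μ)
              - (if w = j then ∫ ω, ((M.ν (n + 1) ω : ℝ) - 1) ∂μ else 0))) else 0 := by
  have hSset : MeasurableSet[M.past n] {ω | 0 < M.S n ω} :=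
    measurable_S_past n (measurableSet_Ioi (a := 0))
  -- Splitting by the current weight, which is known from the past, makes the $w$ in the jump
  -- deterministic. Weights above $j$ contribute nothing, since weights never decrease.
  set χ : ℕ → ℕ → Ω → ℝ := fun i w ω => if M.W n i ω = w then 1 else 0 with hχ
  set g : ℕ → ℕ → Ω → ℝ := fun i w ω =>
    if 0 < M.S n ω ∧ i ∈ M.G (n + 1) ω then jump j w (M.bonus (n + 1) i ω) else 0 with hg
  have hgint : ∀ i w, Integrable (g i w) μ := by
    intro i w
    refine Integrable.of_bound (C := 1) (Measurable.aestronglyMeasurable ?_)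
      (Eventually.of_forall fun ω => ?_)
    · have hG : MeasurableSet {ω | i ∈ M.G (n + 1) ω} :=
        measurable_of_countable_param (G := M.G (n + 1)) (hM.measurable_G (n + 1))
          (F := fun A _ => i ∈ A) (fun A => measurable_const) |>.setOf
      exact Measurable.ite ((hM.past_le n _ hSset).inter hG)
        ((measurable_from_top (f := jump j w)).comp
          (measurable_bonus_of (hM.measurable_G _) (hM.measurable_Y _) i)) measurable_const
    · simp only [hg]
      split_ifs
      · exact abs_jump_le _ _ _
      · simp
  have hχm : ∀ i ∈ Finset.range (n + 1), ∀ w, StronglyMeasurable[M.past n] (χ i w) := by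
    intro i hi w
    exact (Measurable.ite (measurable_W_past (by simpa [Nat.lt_succ_iff] using hi)
      (measurableSet_singleton w)) measurable_const measurable_const).stronglyMeasurable
  have hχb : ∀ i w ω, |χ i w ω| ≤ 1 := by
    intro i w ω
    simp only [hχ]
    split_ifs <;> simp
  have hfun : M.increment j n
      = ∑ i ∈ Finset.range (n + 1), ∑ w ∈ Finset.range (j + 1), χ i w * g i w := by
    funext ω
    simp only [Finset.sum_apply, Pi.mul_apply, increment, hχ, hg]
    by_cases hS : 0 < M.S n ω
    swap; · simp [hS]
    rw [if_pos hS]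
    refine Finset.sum_congr rfl (fun i _ => ?_)
    by_cases hiG : i ∈ M.G (n + 1) ω
    · simp only [hS, hiG, and_self, if_true, ite_mul, one_mul, zero_mul, Finset.sum_ite_eq,
        Finset.mem_range]
      split_ifs with h
      · rfl
      · exact jump_eq_zero (by omega) _
    · simp [hiG, bonus, jump]
  have hprod : ∀ i ∈ Finset.range (n + 1), ∀ w, Integrable (χ i w * g i w) μ := by
    intro i hi w
    exact (hgint i w).bdd_mul ((hχm i hi w).mono (hM.past_le n)).aestronglyMeasurable
      (Eventually.of_forall (hχb i w))
  have hsum : μ[M.increment j n | M.past n] =ᵐ[μ]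
      ∑ i ∈ Finset.range (n + 1), ∑ w ∈ Finset.range (j + 1), μ[χ i w * g i w | M.past n] := by
    rw [hfun]
    refine (condExp_finsetSum (fun i hi => integrable_finsetSum' _
      (fun w _ => hprod i hi w)) _).trans ?_
    exact eventuallyEq_sum (fun i hi => condExp_finsetSum (fun w _ => hprod i hi w) _)
  have hall : ∀ᵐ ω ∂μ, ∀ i ∈ Finset.range (n + 1), ∀ w ∈ Finset.range (j + 1),
      (μ[χ i w * g i w | M.past n]) ω = χ i w ω * (if 0 < M.S n ω then
        (M.W n i ω : ℝ) / M.S n ω * (∫ ω, jump j w (M.Y (n + 1) 1 ω) ∂μ) +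
          (1 - (M.W n i ω : ℝ) / M.S n ω) / n *
            (∫ ω, ((M.ν (n + 1) ω : ℝ) - 1) * jump j w (M.Y (n + 1) 1 ω) ∂μ) else 0) := by
    refine (ae_ball_iff (Finset.range (n + 1)).countable_toSet).2 (fun i hi =>
      (ae_ball_iff (Finset.range (j + 1)).countable_toSet).2 (fun w _ => ?_))
    have h1 := condExp_stronglyMeasurable_mul_of_bound (hM.past_le n) (hχm i hi w) (hgint i w) 1
      (Eventually.of_forall (hχb i w))
    have hi' : i < n + 1 := Finset.mem_range.1 hi
    have h2 := hA.condExp_bonus hM hn (Nat.lt_succ_iff.1 hi') (abs_jump_le j w)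
    filter_upwards [h1, h2] with ω h1 h2
    rw [h1, Pi.mul_apply, h2]
  filter_upwards [hsum, hall] with ω h1 h2
  rw [h1]
  simp only [Finset.sum_apply]
  rw [Finset.sum_congr rfl (fun i hi => Finset.sum_congr rfl (fun w hw => h2 i hi w hw))]
  by_cases hS : 0 < M.S n ω
  swap; · simp [hS]
  simp only [if_pos hS]
  rw [Finset.sum_comm]
  refine Finset.sum_congr rfl (fun w hw => ?_)
  have hwj : w ≤ j := Nat.lt_succ_iff.1 (Finset.mem_range.1 hw)
  rw [integral_jump hM hwj, integral_ν_mul_jump hM hwj, ξ_cast, Finset.sum_mul]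
  refine Finset.sum_congr rfl (fun i _ => ?_)
  simp only [hχ]
  split_ifs with h <;> simp [h]

lemma Assumptions.ae_tendsto_increment (hM : M.IsModel μ) (hA : M.Assumptions μ μ' ν' Y' Z')
    (j : ℕ) :
    ∀ᵐ ω ∂μ, Tendsto (fun n : ℕ => (∑ k ∈ Finset.range n,
      (M.increment j k ω - (μ[M.increment j k | M.past k]) ω)) / (n : ℝ)) atTop (𝓝 0) := by
  obtain ⟨B, hB⟩ := (Metric.isBounded_range_of_tendsto _ hA.tendsto_sq_ν).exists_norm_le
  have hB' : ∀ n, ∫ ω, (M.ν n ω : ℝ) ^ 2 ∂μ ≤ B := fun n =>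
    (le_abs_self _).trans (hB _ (Set.mem_range_self n))
  refine ae_tendsto_average_sub_condExp (ℱ := pastFiltration hM)
    (fun n => (measurable_increment j n).stronglyMeasurable) (memLp_increment hM j) ?_
  have h1 : Summable fun n : ℕ => B * (1 / ((n + 1 : ℕ) : ℝ) ^ 2) :=
    ((summable_nat_add_iff 1).2 (Real.summable_one_div_nat_pow.2 one_lt_two)).mul_left B
  refine h1.of_nonneg_of_le (fun n => div_nonneg (integral_nonneg fun ω => sq_nonneg _)
    (by positivity)) (fun n => ?_)
  rw [mul_one_div]
  push_cast
  refine div_le_div_of_nonneg_right (le_trans ?_ (hB' (n + 1))) (by positivity)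
  refine integral_mono (memLp_increment hM j n).integrable_sq (memLp_ν hM n).integrable_sq
    (fun ω => ?_)
  exact sq_le_sq' (abs_le.1 (abs_increment_le hM j n ω)).1 (abs_le.1 (abs_increment_le hM j n ω)).2

lemma Assumptions.ae_tendsto_X (hM : M.IsModel μ) (hA : M.Assumptions μ μ' ν' Y' Z') (j : ℕ) :
    ∀ᵐ ω ∂μ, Tendsto (fun n : ℕ => (∑ k ∈ Finset.range n,
      ((if M.X (k + 1) ω = j then (1 : ℝ) else 0)
        - ∫ ω, (if M.X 0 ω = j then (1 : ℝ) else 0) ∂μ)) / (n : ℝ)) atTop (𝓝 0) := by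
  set F : ℕ → ℝ := fun y => if y = j then 1 else 0 with hF
  have hFm : Measurable F := measurable_from_top
  have hFb : ∀ y, |F y| ≤ 1 := fun y => by simp only [hF]; split_ifs <;> simp
  have hint : ∀ k, Integrable (fun ω => F (M.X k ω)) μ := fun k =>
    Integrable.of_bound (hFm.comp (hM.measurable_X k)).aestronglyMeasurable 1
      (Eventually.of_forall fun ω => hFb _)
  have hmean : ∀ k, ∫ ω, F (M.X k ω) ∂μ = ∫ ω, F (M.X 0 ω) ∂μ := fun k =>
    ((hA.ident_X k).comp hFm).integral_eq
  set c := ∫ ω, F (M.X 0 ω) ∂μ with hc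
  have hcb : |c| ≤ 1 := by
    have := norm_integral_le_of_norm_le_const (μ := μ) (f := fun ω => F (M.X 0 ω)) (C := 1)
      (Eventually.of_forall fun ω => hFb _)
    simpa using this
  have hb : ∀ k ω, |F (M.X k ω) - c| ≤ 2 := fun k ω => by
    have := abs_sub (F (M.X k ω)) c
    linarith [hFb (M.X k ω)]
  have hL : ∀ k, MemLp (fun ω => F (M.X (k + 1) ω) - c) 2 μ := fun k =>
    MemLp.of_bound ((hFm.comp (hM.measurable_X _)).sub_const c).aestronglyMeasurable 2
      (Eventually.of_forall (hb _))
  refine ae_tendsto_average_of_martingale_difference (ℱ := pastFiltration hM)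
    (d := fun k ω => F (M.X (k + 1) ω) - c)
    (fun n => ((hFm.comp (measurable_X_past le_rfl)).sub_const c).stronglyMeasurable) hL
    (fun n => ?_) ?_
  · have hm : Measurable[MeasurableSpace.comap (M.X (n + 1)) ⊤] (fun ω => F (M.X (n + 1) ω) - c) :=
      (hFm.comp (comap_measurable (M.X (n + 1)))).sub_const c
    have h1 := condExp_indep_eq (μ := μ) (hM.measurable_X (n + 1)).comap_le (hM.past_le n)
      hm.stronglyMeasurable (indep_of_indep_of_le_right (hA.indep_X_past n) le_sup_left)
    refine h1.trans (Eventually.of_forall fun ω => ?_)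
    rw [integral_sub (hint _) (integrable_const _), hmean]
    simp
  · have h1 : Summable fun n : ℕ => 4 * (1 / ((n + 1 : ℕ) : ℝ) ^ 2) :=
      ((summable_nat_add_iff 1).2 (Real.summable_one_div_nat_pow.2 one_lt_two)).mul_left 4
    refine h1.of_nonneg_of_le (fun n => div_nonneg (integral_nonneg fun ω => sq_nonneg _)
      (by positivity)) (fun n => ?_)
    rw [mul_one_div]
    push_cast
    refine div_le_div_of_nonneg_right ?_ (by positivity)
    calc ∫ ω, (F (M.X (n + 1) ω) - c) ^ 2 ∂μ ≤ ∫ _, (4 : ℝ) ∂μ := by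
          refine integral_mono (hL n).integrable_sq (integrable_const _) (fun ω => ?_)
          have := abs_le.1 (hb (n + 1) ω)
          dsimp only
          nlinarith [this.1, this.2]
      _ = 4 := by simp

end PublicationProcess

/-! ### The limiting proportions. -/

/-- The limiting weight distribution, defined by its recursion. -/
noncomputable def weightLimit (p q r : ℕ → ℝ) (σ Q : ℝ) : ℕ → ℝ
  | j => (r j + ∑ w : Fin j, weightLimit p q r σ Q w * ((w : ℝ) / σ * p (j - w) + q (j - w))) /
      (1 + ((j : ℝ) / σ * (1 - p 0) + (Q - q 0)))
termination_by j => j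
decreasing_by exact w.2

lemma weightLimit_eq (p q r : ℕ → ℝ) (σ Q : ℝ) (j : ℕ) :
    weightLimit p q r σ Q j =
      (r j + ∑ w ∈ Finset.range j,
        weightLimit p q r σ Q w * ((w : ℝ) / σ * p (j - w) + q (j - w))) /
      (1 + ((j : ℝ) / σ * (1 - p 0) + (Q - q 0))) := by
  rw [weightLimit, Fin.sum_univ_eq_sum_range
    (fun w => weightLimit p q r σ Q w * ((w : ℝ) / σ * p (j - w) + q (j - w)))]

lemma weightLimit_recursion {p q r : ℕ → ℝ} {σ Q : ℝ} (hσ : 0 < σ) (hp : p 0 ≤ 1) (hq : q 0 ≤ Q)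
    (j : ℕ) : weightLimit p q r σ Q j * (σ * (1 + Q) + j) = σ * r j +
      ∑ kl ∈ Finset.HasAntidiagonal.antidiagonal j,
        (kl.1 * weightLimit p q r σ Q kl.1 * p kl.2 + σ * (weightLimit p q r σ Q kl.1 * q kl.2)) := by
  have hden : 0 < 1 + ((j : ℝ) / σ * (1 - p 0) + (Q - q 0)) := by
    have h1 : 0 ≤ (j : ℝ) / σ * (1 - p 0) := mul_nonneg (by positivity) (by linarith)
    linarith
  have h := weightLimit_eq p q r σ Q j
  rw [eq_div_iff hden.ne'] at h
  rw [Finset.Nat.sum_antidiagonal_eq_sum_range_succ_mk, Finset.sum_range_succ]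
  have h2 : ∑ k ∈ Finset.range j, ((k : ℝ) * weightLimit p q r σ Q k * p (j - k) +
      σ * (weightLimit p q r σ Q k * q (j - k)))
      = σ * ∑ w ∈ Finset.range j,
        weightLimit p q r σ Q w * ((w : ℝ) / σ * p (j - w) + q (j - w)) := by
    rw [Finset.mul_sum]
    refine Finset.sum_congr rfl (fun k _ => ?_)
    field_simp
  rw [h2, Nat.sub_self]
  have h3 := congrArg (fun y => σ * y) h
  rw [mul_add σ] at h3
  have h4 : σ * (weightLimit p q r σ Q j * (1 + ((j : ℝ) / σ * (1 - p 0) + (Q - q 0))))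
      = weightLimit p q r σ Q j * (σ * (1 + Q) + j)
        - (j * weightLimit p q r σ Q j * p 0 + σ * (weightLimit p q r σ Q j * q 0)) := by
    field_simp
    ring
  linarith

namespace PublicationProcess

variable {Ω Ω' : Type*} [mΩ : MeasurableSpace Ω] {μ : Measure Ω} [IsProbabilityMeasure μ]
  {M : PublicationProcess Ω} [MeasurableSpace Ω'] {μ' : Measure Ω'} [IsProbabilityMeasure μ']
  {ν' Y' Z' : Ω' → ℕ}

/-- The convergence of the proportion of the researchers of a given weight along a single
trajectory. -/
lemma tendsto_ξ_div {S : ℕ → ℝ} {ξ : ℕ → ℕ → ℝ} {p q : ℕ → ℕ → ℝ} {Q : ℕ → ℝ}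
    {p' q' r x : ℕ → ℝ} {Q' σ : ℝ} {d : ℕ → ℝ} {j : ℕ} (hσ : 0 < σ)
    (hS : Tendsto (fun n : ℕ => S n / n) atTop (𝓝 σ))
    (hp : ∀ b, Tendsto (fun n => p n b) atTop (𝓝 (p' b)))
    (hq : ∀ b, Tendsto (fun n => q n b) atTop (𝓝 (q' b)))
    (hQ : Tendsto Q atTop (𝓝 Q')) (hp1 : ∀ n, p n 0 ≤ 1) (hq1 : ∀ n, q n 0 ≤ Q n)
    (hd : Tendsto (fun n : ℕ => (∑ k ∈ Finset.range n, d k) / (n : ℝ)) atTop (𝓝 0))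
    (hx : ∀ w < j, Tendsto (fun n : ℕ => ξ n w / n) atTop (𝓝 (x w)))
    (hξ : ∀ᶠ n : ℕ in atTop, ξ (n + 1) j = ξ n j + r j + d n +
      ∑ w ∈ Finset.range (j + 1), ξ n w *
        ((w : ℝ) / S n * (p n (j - w) - (if w = j then 1 else 0))
          + (1 - (w : ℝ) / S n) / n * (q n (j - w) - (if w = j then Q n else 0)))) :
    Tendsto (fun n : ℕ => ξ n j / n) atTop
      (𝓝 ((r j + ∑ w ∈ Finset.range j, x w * ((w : ℝ) / σ * p' (j - w) + q' (j - w))) /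
        (1 + ((j : ℝ) / σ * (1 - p' 0) + (Q' - q' 0))))) := by
  have hnS : ∀ w : ℕ, Tendsto (fun n : ℕ => (w : ℝ) * (n / S n)) atTop (𝓝 (w / σ)) := by
    intro w
    have h := (hS.inv₀ hσ.ne').const_mul (w : ℝ)
    rw [← div_eq_mul_inv] at h
    exact h.congr (fun n => by rw [inv_div])
  have hwS : ∀ w : ℕ, Tendsto (fun n : ℕ => 1 - (w : ℝ) / S n) atTop (𝓝 1) := by
    intro w
    have h := ((hnS w).mul (tendsto_inv_atTop_nhds_zero_nat (𝕜 := ℝ))).const_sub 1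
    rw [mul_zero, sub_zero] at h
    refine h.congr' ?_
    filter_upwards [eventually_gt_atTop 0] with n hn
    have : (n : ℝ) ≠ 0 := by exact_mod_cast hn.ne'
    field_simp
  have hSpos : ∀ᶠ n : ℕ in atTop, 0 < S n := by
    filter_upwards [hS.eventually (lt_mem_nhds hσ), eventually_gt_atTop 0] with n h1 hn
    have : (0 : ℝ) < n := by exact_mod_cast hn
    exact (div_pos_iff_of_pos_right this).1 h1
  -- The terms $w<j$ and the newcomers form the inflow `a`, which converges by hypothesis; the term
  -- $w=j$ is the loss, at rate `b`.
  refine tendsto_div_of_recursion (d := d)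
    (a := fun n => r j + ∑ w ∈ Finset.range j, ξ n w / n *
      ((w : ℝ) * (n / S n) * p n (j - w) + (1 - (w : ℝ) / S n) * q n (j - w)))
    (b := fun n => (j : ℝ) * (n / S n) * (1 - p n 0) + (1 - (j : ℝ) / S n) * (Q n - q n 0))
    ?_ ?_ ?_ ?_ hd
  · filter_upwards [hξ, eventually_gt_atTop 0] with n h1 hn
    have hn0 : (n : ℝ) ≠ 0 := by exact_mod_cast hn.ne'
    rw [h1, Finset.sum_range_succ, if_pos rfl, if_pos rfl, Nat.sub_self]
    have h2 : ∑ w ∈ Finset.range j, ξ n w *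
        ((w : ℝ) / S n * (p n (j - w) - (if w = j then 1 else 0))
          + (1 - (w : ℝ) / S n) / n * (q n (j - w) - (if w = j then Q n else 0)))
        = ∑ w ∈ Finset.range j, ξ n w / n *
      ((w : ℝ) * (n / S n) * p n (j - w) + (1 - (w : ℝ) / S n) * q n (j - w)) := by
      refine Finset.sum_congr rfl (fun w hw => ?_)
      have hwj : w ≠ j := (Finset.mem_range.1 hw).ne
      rw [if_neg hwj, if_neg hwj]
      field_simp
      ring
    rw [h2]
    field_simp
    ring
  · refine (tendsto_finsetSum _ (fun w hw => ?_)).const_add (r j)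
    have h := (hx w (Finset.mem_range.1 hw)).mul
      (((hnS w).mul (hp (j - w))).add ((hwS w).mul (hq (j - w))))
    simpa only [one_mul] using h
  · have h := ((hnS j).mul ((hp 0).const_sub 1)).add ((hwS j).mul (hQ.sub (hq 0)))
    simpa only [one_mul] using h
  · filter_upwards [(hwS j).eventually (lt_mem_nhds one_pos), hSpos] with n h1 h2
    have h3 := hp1 n
    have h4 := hq1 n
    exact add_nonneg (mul_nonneg (by positivity) (by linarith))
      (mul_nonneg h1.le (by linarith))

lemma Assumptions.mean_pos (hM : M.IsModel μ) (hA : M.Assumptions μ μ' ν' Y' Z') :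
    0 < (∫ ω, (M.X 0 ω : ℝ) ∂μ) + ∫ ω', (Z' ω' : ℝ) ∂μ' := by
  have h1 : 0 < ∫ ω, (M.X 0 ω : ℝ) ∂μ := by
    rw [integral_pos_iff_support_of_nonneg (fun ω => by positivity)
      (integrable_of_mgf (hM.measurable_X 0).aemeasurable hA.mgf_X)]
    refine hA.pos_X.trans_le (measure_mono fun ω hω => ?_)
    have : 0 < M.X 0 ω := hω
    simpa using this.ne'
  have h2 : 0 ≤ ∫ ω', (Z' ω' : ℝ) ∂μ' := integral_nonneg (fun ω => by positivity)
  linarith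

lemma Assumptions.mean_Y_pos (hA : M.Assumptions μ μ' ν' Y' Z') :
    0 < ∫ ω', (Y' ω' : ℝ) ∂μ' := by
  rw [integral_pos_iff_support_of_nonneg (fun ω => by positivity)
    (integrable_of_mgf hA.aemeasurable_Y' hA.mgf_Y)]
  refine hA.pos_Y'.trans_le (measure_mono fun ω hω => ?_)
  have : 0 < Y' ω := hω
  simpa using this.ne'

lemma integrable_ν (hM : M.IsModel μ) (n : ℕ) : Integrable (fun ω => (M.ν (n + 1) ω : ℝ)) μ :=
  (memLp_ν hM n).integrable (by norm_num)

lemma integrable_ν_sub_one (hM : M.IsModel μ) (n : ℕ) :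
    Integrable (fun ω => (M.ν (n + 1) ω : ℝ) - 1) μ :=
  (integrable_ν hM n).sub (integrable_const 1)

lemma integral_ite_sub_one {Ω : Type*} [MeasurableSpace Ω] {μ : Measure Ω} [IsProbabilityMeasure μ]
    {Y : Ω → ℕ} (hY : AEMeasurable Y μ) {g : Ω → ℝ} (hg : Integrable g μ) (b : ℕ) :
    ∫ ω, (if Y ω = b then g ω - 1 else 0) ∂μ
      = (∫ ω, (if Y ω = b then g ω else 0) ∂μ) - ∫ ω, (if Y ω = b then 1 else 0) ∂μ := by
  rw [← integral_sub (integrable_ite_eq hY b hg) (integrable_ite_eq hY b (integrable_const 1))]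
  refine integral_congr_ae (Eventually.of_forall fun ω => ?_)
  dsimp only
  split_ifs <;> simp

lemma ite_ν_sub_one_mem {Ω : Type*} [MeasurableSpace Ω] {μ : Measure Ω} {M : PublicationProcess Ω}
    (hM : M.IsModel μ) (n b : ℕ) (ω : Ω) :
    (0 : ℝ) ≤ (if M.Y (n + 1) 1 ω = b then ((M.ν (n + 1) ω : ℝ) - 1) else 0) ∧
      (if M.Y (n + 1) 1 ω = b then ((M.ν (n + 1) ω : ℝ) - 1) else 0) ≤ (M.ν (n + 1) ω : ℝ) - 1 := by
  have h : (1 : ℝ) ≤ M.ν (n + 1) ω := by exact_mod_cast hM.one_le_ν (n + 1) (by omega) ω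
  split_ifs <;> constructor <;> linarith

/-- The proportions of the researchers of given weights converge, and the limits satisfy a
recursion. -/
theorem Assumptions.ae_tendsto_ξ_div (hM : M.IsModel μ) (hA : M.Assumptions μ μ' ν' Y' Z') (j : ℕ) :
    ∀ᵐ ω ∂μ, Tendsto (fun n : ℕ => (M.ξ n j ω : ℝ) / n) atTop
      (𝓝 (weightLimit (fun b => ∫ ω', (if Y' ω' = b then (1 : ℝ) else 0) ∂μ')
        (fun b => ∫ ω', (if Y' ω' = b then ((ν' ω' : ℝ) - 1) else 0) ∂μ')
        (fun b => ∫ ω, (if M.X 0 ω = b then (1 : ℝ) else 0) ∂μ)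
        ((∫ ω, (M.X 0 ω : ℝ) ∂μ) + ∫ ω', (Z' ω' : ℝ) ∂μ') (∫ ω', ((ν' ω' : ℝ) - 1) ∂μ') j)) := by
  have hσ := hA.mean_pos hM
  have hν'i : Integrable (fun ω' => (ν' ω' : ℝ)) μ' := hA.memLp_ν'.integrable (by norm_num)
  have hp : ∀ b, Tendsto (fun n => ∫ ω, (if M.Y (n + 1) 1 ω = b then (1 : ℝ) else 0) ∂μ) atTop
      (𝓝 (∫ ω', (if Y' ω' = b then (1 : ℝ) else 0) ∂μ')) := fun b =>
    (tendsto_add_atTop_iff_nat 1).2 (hA.tendsto_law_Y b)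
  have hq : ∀ b, Tendsto (fun n => ∫ ω, (if M.Y (n + 1) 1 ω = b then ((M.ν (n + 1) ω : ℝ) - 1)
      else 0) ∂μ) atTop (𝓝 (∫ ω', (if Y' ω' = b then ((ν' ω' : ℝ) - 1) else 0) ∂μ')) := by
    intro b
    have h := ((tendsto_add_atTop_iff_nat 1).2 (hA.tendsto_ν_law_Y hM b)).sub (hp b)
    rw [integral_ite_sub_one hA.aemeasurable_Y' hν'i]
    refine h.congr (fun n => ?_)
    rw [integral_ite_sub_one (hM.measurable_Y _ 1).aemeasurable (integrable_ν hM n)]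
  have hQ : Tendsto (fun n => ∫ ω, ((M.ν (n + 1) ω : ℝ) - 1) ∂μ) atTop
      (𝓝 (∫ ω', ((ν' ω' : ℝ) - 1) ∂μ')) := by
    have h := ((tendsto_add_atTop_iff_nat 1).2 hA.tendsto_mean_ν).sub_const 1
    rw [integral_sub hν'i (integrable_const 1)]
    simp only [integral_const, probReal_univ, one_smul]
    refine h.congr (fun n => ?_)
    rw [integral_sub (integrable_ν hM n) (integrable_const 1)]
    simp
  have hcond : ∀ j, ∀ᵐ ω ∂μ, ∀ n, 1 ≤ n → (μ[M.increment j n | M.past n]) ω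
      = if 0 < M.S n ω then
      ∑ w ∈ Finset.range (j + 1), (M.ξ n w ω : ℝ) *
        ((w : ℝ) / M.S n ω *
            ((∫ ω, (if M.Y (n + 1) 1 ω = j - w then (1 : ℝ) else 0) ∂μ) - (if w = j then 1 else 0))
          + (1 - (w : ℝ) / M.S n ω) / n *
            ((∫ ω, (if M.Y (n + 1) 1 ω = j - w then ((M.ν (n + 1) ω : ℝ) - 1) else 0) ∂μ)
              - (if w = j then ∫ ω, ((M.ν (n + 1) ω : ℝ) - 1) ∂μ else 0))) else 0 := fun j =>
    ae_all_iff.2 (fun n => by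
      by_cases hn : 1 ≤ n
      · filter_upwards [hA.condExp_increment hM j hn] with ω h _ using h
      · exact Eventually.of_forall fun ω h => absurd h hn)
  generalize hx : weightLimit _ _ _ _ _ = x
  induction j using Nat.strong_induction_on with
  | _ j ih =>
    have ih' : ∀ᵐ ω ∂μ, ∀ w, w < j → Tendsto (fun n : ℕ => (M.ξ n w ω : ℝ) / n) atTop (𝓝 (x w)) := by
      refine ae_all_iff.2 (fun w => ?_)
      by_cases hw : w < j
      · filter_upwards [ih w hw] with ω h _ using h
      · exact Eventually.of_forall fun ω h => absurd h hw
    filter_upwards [ih', hcond j, hA.ae_tendsto_S_div hM, hA.ae_tendsto_increment hM j,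
      hA.ae_tendsto_X hM j] with ω h1 h2 h3 h4 h5
    rw [← hx, weightLimit_eq, hx]
    have hd := h4.add h5
    simp only [← add_div, ← Finset.sum_add_distrib, add_zero] at hd
    refine tendsto_ξ_div (S := fun n => (M.S n ω : ℝ)) (ξ := fun n j => (M.ξ n j ω : ℝ))
      (p := fun n b => ∫ ω, (if M.Y (n + 1) 1 ω = b then (1 : ℝ) else 0) ∂μ)
      (q := fun n b => ∫ ω, (if M.Y (n + 1) 1 ω = b then ((M.ν (n + 1) ω : ℝ) - 1) else 0) ∂μ)
      (Q := fun n => ∫ ω, ((M.ν (n + 1) ω : ℝ) - 1) ∂μ)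
      (p' := fun b => ∫ ω', (if Y' ω' = b then (1 : ℝ) else 0) ∂μ')
      (q' := fun b => ∫ ω', (if Y' ω' = b then ((ν' ω' : ℝ) - 1) else 0) ∂μ')
      (r := fun b => ∫ ω, (if M.X 0 ω = b then (1 : ℝ) else 0) ∂μ)
      (x := x) (Q' := ∫ ω', ((ν' ω' : ℝ) - 1) ∂μ') hσ h3 hp hq
      hQ (fun n => ?_) (fun n => ?_) hd h1 ?_
    · calc ∫ ω, (if M.Y (n + 1) 1 ω = 0 then (1 : ℝ) else 0) ∂μ ≤ ∫ _, (1 : ℝ) ∂μ := by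
            refine integral_mono (integrable_ite_eq (hM.measurable_Y _ 1).aemeasurable _
              (integrable_const 1)) (integrable_const 1) (fun ω => ?_)
            dsimp only
            split_ifs <;> simp
        _ = 1 := by simp
    · exact integral_mono (integrable_ite_eq (hM.measurable_Y _ 1).aemeasurable _
        (integrable_ν_sub_one hM n)) (integrable_ν_sub_one hM n)
        (fun ω => (ite_ν_sub_one_mem hM n 0 ω).2)
    -- Since $S_n/n\to\sigma>0$, the degenerate case of zero total weight eventually disappears on
    -- this trajectory.
    · filter_upwards [h3.eventually (lt_mem_nhds hσ), eventually_ge_atTop 1] with n hS hn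
      have hS' : 0 < M.S n ω := by
        rcases Nat.eq_zero_or_pos (M.S n ω) with h | h
        · rw [h] at hS; simp at hS
        · exact h
      have h6 := h2 n hn
      rw [if_pos hS'] at h6
      rw [ξ_succ hM j n hS', ← h6]
      ring

end PublicationProcess

/-! ### Scale-free weight distribution. -/

theorem theorem2 {Ω Ω' : Type*} [MeasurableSpace Ω] [MeasurableSpace Ω']
    (μ : Measure Ω) [IsProbabilityMeasure μ] (μ' : Measure Ω') [IsProbabilityMeasure μ']
    (M : PublicationProcess Ω) (ν' Y' Z' : Ω' → ℕ)
    (hM : M.IsModel μ) (hA : M.Assumptions μ μ' ν' Y' Z') :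
    ∃ x : ℕ → ℝ,
      (∀ j : ℕ, 1 ≤ j →
        ∀ᵐ ω ∂μ, Tendsto (fun n : ℕ => (M.ξ n j ω : ℝ) / (n : ℝ)) atTop (𝓝 (x j))) ∧
      ∃ C : ℝ, 0 < C ∧
        x ~[atTop] fun j : ℕ => C * (j : ℝ) ^
          (-(((∫ ω, (M.X 0 ω : ℝ) ∂μ) + ∫ ω', (Z' ω' : ℝ) ∂μ') / (∫ ω', (Y' ω' : ℝ) ∂μ') + 1)) := by
  have hσ := hA.mean_pos hM
  have hν'i : Integrable (fun ω' => (ν' ω' : ℝ)) μ' := hA.memLp_ν'.integrable (by norm_num)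
  have hY := hA.aemeasurable_Y'
  have hX := (hM.measurable_X 0).aemeasurable (μ := μ)
  have hQi : Integrable (fun ω' => (ν' ω' : ℝ) - 1) μ' := hν'i.sub (integrable_const 1)
  have hlim := fun j => hA.ae_tendsto_ξ_div hM j
  set p : ℕ → ℝ := fun b => ∫ ω', (if Y' ω' = b then (1 : ℝ) else 0) ∂μ' with hp
  set q : ℕ → ℝ := fun b => ∫ ω', (if Y' ω' = b then ((ν' ω' : ℝ) - 1) else 0) ∂μ' with hq
  set r : ℕ → ℝ := fun b => ∫ ω, (if M.X 0 ω = b then (1 : ℝ) else 0) ∂μ with hr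
  set σ := (∫ ω, (M.X 0 ω : ℝ) ∂μ) + ∫ ω', (Z' ω' : ℝ) ∂μ' with hσd
  set Q := ∫ ω', ((ν' ω' : ℝ) - 1) ∂μ' with hQ
  set x := weightLimit p q r σ Q with hx
  have hp0 : ∀ b, 0 ≤ p b := fun b => integral_nonneg (fun ω => by dsimp only; split_ifs <;> simp)
  have hr0 : ∀ b, 0 ≤ r b := fun b => integral_nonneg (fun ω => by dsimp only; split_ifs <;> simp)
  have hp1 : HasSum p 1 := hasSum_law hY
  have hq1 : HasSum q Q := hasSum_integral_ite_eq hY hQi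
  -- $\nu'\ge1$ is not among the assumptions on the limit triple; nonnegativity is inherited from
  -- the steps, where $\nu_n\ge1$.
  have hq0 : ∀ b, 0 ≤ q b := by
    intro b
    have h := ((tendsto_add_atTop_iff_nat 1).2 (hA.tendsto_ν_law_Y hM b)).sub
      ((tendsto_add_atTop_iff_nat 1).2 (hA.tendsto_law_Y b))
    rw [← PublicationProcess.integral_ite_sub_one hY hν'i] at h
    refine ge_of_tendsto' h (fun n => ?_)
    rw [← PublicationProcess.integral_ite_sub_one (hM.measurable_Y _ 1).aemeasurable
      (PublicationProcess.integrable_ν hM n)]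
    exact integral_nonneg (fun ω => (PublicationProcess.ite_ν_sub_one_mem hM n b ω).1)
  have hx0 : ∀ j, 0 ≤ x j := by
    intro j
    obtain ⟨ω, hω⟩ := (hlim j).exists
    exact ge_of_tendsto' hω (fun n => by positivity)
  have hm : ∫ ω', (Y' ω' : ℝ) ∂μ' = ∑' b : ℕ, (b : ℝ) * p b :=
    (hasSum_mean hY (integrable_of_mgf hY hA.mgf_Y)).tsum_eq.symm
  have hrpos : ∃ j, 1 ≤ j ∧ 0 < r j := by
    by_contra! hcon
    have h0 : ∀ᵐ ω ∂μ, ∀ j, 1 ≤ j → M.X 0 ω ≠ j := by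
      refine ae_all_iff.2 (fun j => ?_)
      by_cases hj : 1 ≤ j
      · have h1 : μ {ω | M.X 0 ω = j} = 0 := by
          by_contra hne
          exact absurd ((integral_ite_pos_iff hX j).2 (pos_iff_ne_zero.2 hne))
            (not_lt.2 (hcon j hj))
        filter_upwards [measure_eq_zero_iff_ae_notMem.1 h1] with ω h _ using h
      · exact Eventually.of_forall fun ω h => absurd h hj
    refine hA.pos_X.ne' (measure_eq_zero_iff_ae_notMem.2 ?_)
    filter_upwards [h0] with ω h hpos
    exact h (M.X 0 ω) hpos rfl
  obtain ⟨C, hC, hlimC⟩ := tendsto_of_recursion (p := p) (q := q) (r := r) (x := x) hσ hp0 hp1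
    (expDecay_law hY hA.mgf_Y) hm hA.mean_Y_pos
    (fun d hd => hA.aperiodic d (fun i hi => hd i ((integral_ite_pos_iff hY i).2 hi)))
    hq0 hq1 (expDecay_moment hY hA.mgf_Y (hA.memLp_ν'.sub (memLp_const 1)))
    hr0 (expDecay_law hX hA.mgf_X) hrpos hx0
    (weightLimit_recursion hσ (le_hasSum hp1 0 (fun b _ => hp0 b))
      (le_hasSum hq1 0 (fun b _ => hq0 b)))
  refine ⟨x, fun j _ => hlim j, C, hC, ?_⟩
  set γ := σ / (∫ ω', (Y' ω' : ℝ) ∂μ') + 1 with hγ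
  refine isEquivalent_of_tendsto_one ?_
  -- Replaces $(j+1)^\gamma$ by $j^\gamma$.
  have h1 : Tendsto (fun n : ℕ => (1 + 1 / (n : ℝ)) ^ γ) atTop (𝓝 1) := by
    have h2 : Tendsto (fun n : ℕ => 1 + 1 / (n : ℝ)) atTop (𝓝 (1 + 0)) :=
      (tendsto_const_div_atTop_nhds_zero_nat 1).const_add 1
    rw [add_zero] at h2
    simpa using h2.rpow_const (p := γ) (Or.inl one_ne_zero)
  have h2 := (hlimC.div h1 one_ne_zero).div_const C
  rw [div_one, div_self hC.ne'] at h2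
  refine h2.congr' ?_
  filter_upwards [eventually_gt_atTop 0] with n hn
  have hn0 : (0 : ℝ) < n := by exact_mod_cast hn
  have e1 : 1 + 1 / (n : ℝ) = (n + 1) / n := by field_simp
  simp only [Pi.div_apply]
  rw [e1, Real.div_rpow (by positivity) hn0.le, Real.rpow_neg hn0.le]
  have := Real.rpow_pos_of_pos hn0 γ
  have : 0 < ((n : ℝ) + 1) ^ γ := by positivity
  field_simp
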